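/- Write $\langle t\rangle=(1+t^2)^{1/2}$. For $h:\mathbb{R}^2_x\times\mathbb{R}^2_v\to\mathbb{R}$ and $t\in\mathbb{R}$ let $$\rho_h(x,t)=\int_{\mathbb{R}^2}h^2(x-tw,w)\,dw,\qquad \phi_h(\cdot,t)=(1-\Delta)^{-1}\rho_h(\cdot,t)=G_2*\rho_h(\cdot,t),$$ where $G_2(x)=\frac1{4\pi}\int_0^\infty e^{-|x|^2/(4R)}e^{-R}\frac{dR}{R}$ is the Green function of $1-\Delta$ on $\mathbb{R}^2$. Let $$\|h\|_{L^2_xH^k_v}=\Big(\sum_{|\beta|\le k}\|\partial_v^\beta h\|_{L^2_{x,v}}^2\Big)^{1/2},\qquad \|h\|_{Z}=\|h\|_{L^\infty_vL^2_x},$$ $$\|h\|_{Z'}=\|h\|_Z+\langle t\rangle^{-1/4}\big(\|h\|_{L^2_xH^2_v}+\|xh\|_{L^2_{x,v}}\big),$$ where derivatives are weak derivatives. Let $\tau>0$. The following estimates hold for all $t\in\mathbb{R}$ with $|t|\ge\tau$ and all $h$ for which the norm on the right-hand side is finite (the weak derivatives of $\phi_h$ on the left-hand side then exist), with implicit constants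 that depend on $\tau$, in (2)-(4) also on $\alpha$, in (2)-(3) also on $\delta$, and on nothing else. (1) $\|\rho_h(\cdot,t)\|_{L^\infty_x(\mathbb{R}^2)}\lesssim\langle t\rangle^{-2}\|h\|_{Z'}^2$. (2) For every $0<\delta<1$ and every multi-index $\alpha\in\mathbb{N}_0^2$: $\|\partial_x^\alpha\nabla_x\phi_h(\cdot,t)\|_{L^\infty_x(\mathbb{R}^2)}\lesssim\langle t\rangle^{-2-|\alpha|+\delta}\|h\|_{L^2_xH^{|\alpha|+1}_v}^2$. (3) For every $0<\delta<1$ and every multi-index $\alpha\in\mathbb{N}_0^2$: $\|\partial_x^\alpha\nabla_x\phi_h(\cdot,t)\|_{L^\infty_x(\mathbb{R}^2)}\lesssim\langle t\rangle^{-3-|\alpha|+\delta}\|h\|_{L^2_xH^{|\alpha|+2}_v}^2$. (4) For every multi-index $\alpha\in\mathbb{N}_0^2$ with $|\alpha|\ge2$: $\|\partial_x^\alpha\nabla_x\phi_h(\cdot,t)\|_{L^2_x(\mathbb{R}^2)}\lesssim\langle t\rangle^{-\frac12-|\alpha|}\|h\|_{L^2_xH^{|\alpha|}_v}^2$. -/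

import Mathlib

open MeasureTheory Set
open scoped ENNReal NNReal ContDiff

namespace ScreenedVP

noncomputable section

/-- The Euclidean plane `ℝ²`. -/
abbrev Plane : Type := EuclideanSpace ℝ (Fin 2)

/-- The Japanese bracket `⟨t⟩ = (1 + t²)^{1/2}`. -/
def japaneseBracket (t : ℝ) : ℝ := Real.sqrt (1 + t ^ 2)

/-- The length `|α| = α₁ + α₂` of a multi-index `α ∈ ℕ₀²`. -/
def multiLength (α : Fin 2 → ℕ) : ℕ := ∑ i, α i

/-- The unit vector in the `i`-th coordinate direction of `ℝ²`. -/
def xDir (i : Fin 2) : Plane := EuclideanSpace.single i (1 : ℝ)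

/-- The unit vector in the direction of the velocity coordinate `v_i` of `ℝ²_x × ℝ²_v`. -/
def vDir (i : Fin 2) : Plane × Plane := (0, EuclideanSpace.single i (1 : ℝ))

section WeakDerivatives

variable {V : Type*} [NormedAddCommGroup V] [NormedSpace ℝ V]

/-- The classical derivative of `ψ` in the direction `e`. -/
def dirDeriv (e : V) (ψ : V → ℝ) : V → ℝ := fun p => fderiv ℝ ψ p e

/-- The classical partial derivative `∂^α ψ = ∂_{b₀}^{α₀} ∂_{b₁}^{α₁} ψ` with respect to the two
directions `b₀`, `b₁`. -/
def multiDeriv (b : Fin 2 → V) (α : Fin 2 → ℕ) (ψ : V → ℝ) : V → ℝ :=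
  (dirDeriv (b 0))^[α 0] ((dirDeriv (b 1))^[α 1] ψ)

/-- `g` is the weak (distributional) derivative `∂^α u` with respect to the directions `b₀`, `b₁`:
both functions are locally integrable and `∫ u ∂^α ψ = (-1)^{|α|} ∫ g ψ` for all test functions
`ψ ∈ C_c^∞`. -/
def IsWeakDeriv [MeasureSpace V] (b : Fin 2 → V) (α : Fin 2 → ℕ) (u g : V → ℝ) : Prop :=
  LocallyIntegrable u ∧ LocallyIntegrable g ∧
    ∀ ψ : V → ℝ, ContDiff ℝ ∞ ψ → HasCompactSupport ψ →
      ∫ p, u p * multiDeriv b α ψ p = (-1) ^ multiLength α * ∫ p, g p * ψ p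

end WeakDerivatives

/-- `‖∂_v^β h‖_{L²_{x,v}}`, with value `∞` if `h` has no weak derivative `∂_v^β h`. As weak
derivatives are unique almost everywhere, the infimum ranges over at most one value. -/
def vDerivNorm (β : Fin 2 → ℕ) (h : Plane × Plane → ℝ) : ℝ≥0∞ :=
  ⨅ (g : Plane × Plane → ℝ) (_ : IsWeakDeriv vDir β h g), eLpNorm g 2 volume

/-- The norm `‖h‖_{L²_x H^k_v} = (∑_{|β| ≤ k} ‖∂_v^β h‖²_{L²_{x,v}})^{1/2}`, with value `∞` if `h`
does not belong to `L²_x H^k_v`. -/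
def normL2xHv (k : ℕ) (h : Plane × Plane → ℝ) : ℝ≥0∞ :=
  (∑ n ∈ Finset.range (k + 1), ∑ β ∈ Finset.piAntidiag (Finset.univ : Finset (Fin 2)) n,
    vDerivNorm β h ^ 2) ^ (1 / 2 : ℝ)

/-- `‖h‖_Z = ‖h‖_{L^∞_v L²_x}`. -/
def normZ (h : Plane × Plane → ℝ) : ℝ≥0∞ :=
  essSup (fun v : Plane => eLpNorm (fun x : Plane => h (x, v)) 2 volume) volume

/-- `‖h‖_{Z'} = ‖h‖_Z + ⟨t⟩^{-1/4} (‖h‖_{L²_x H²_v} + ‖x h‖_{L²_{x,v}})`, which depends on the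
time `t`. -/
def normZ' (t : ℝ) (h : Plane × Plane → ℝ) : ℝ≥0∞ :=
  normZ h + ENNReal.ofReal (japaneseBracket t ^ (-(1 / 4) : ℝ)) *
    (normL2xHv 2 h + eLpNorm (fun p : Plane × Plane => ‖p.1‖ * h p) 2 volume)

/-- The density `ρ_h(x,t) = ∫ h²(x - t w, w) dw`. -/
def density (h : Plane × Plane → ℝ) (t : ℝ) (x : Plane) : ℝ :=
  ∫ w : Plane, h (x - t • w, w) ^ 2

/-- The Green function of `1 - Δ` on `ℝ²`,
`G₂(x) = (4π)⁻¹ ∫_0^∞ χ(R^{-1/2} x) e^{-R} R⁻¹ dR` with `χ(x) = e^{-|x|²/4}`. -/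
def green (x : Plane) : ℝ :=
  (4 * Real.pi)⁻¹ *
    ∫ R in Ioi (0 : ℝ), Real.exp (-‖(R ^ (-(1 / 2) : ℝ)) • x‖ ^ 2 / 4) * Real.exp (-R) / R

/-- The screened potential `φ_h(·,t) = (1 - Δ)⁻¹ ρ_h(·,t) = G₂ * ρ_h(·,t)`. -/
def potential (h : Plane × Plane → ℝ) (t : ℝ) (x : Plane) : ℝ :=
  ∫ y : Plane, green (x - y) * density h t y

/-- The vector field `F` on `ℝ²` is the weak derivative `∂_x^α ∇_x u`, that is, its `j`-th component
is the weak derivative `∂_x^α ∂_{x_j} u`. -/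
def IsWeakDerivGrad (α : Fin 2 → ℕ) (u : Plane → ℝ) (F : Plane → Plane) : Prop :=
  ∀ j : Fin 2, IsWeakDeriv xDir (α + Pi.single j 1) u (fun x => F x j)

end

end ScreenedVP

namespace ScreenedVP

noncomputable section

/-! ### Calculus of iterated directional derivatives -/

/-! The mechanism is dispersion: the substitution y = x - tw turns a velocity average into |t|^{-2}
times an integral over y of a function of (y, (x-y)/t), and every x-derivative of such an average is
1/t times a v-derivative.

Density. One has ρ(x,t) = |t|^{-2} ∫ h²(y, (x-y)/t) dy. Freezing the velocity at x/t gives at most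
‖h‖_Z² for almost every x. The error is controlled by a Hölder estimate for squares of H² functions
of the plane, |f²(a) - f²(c)| ≲ |a-c|^{1/2} ‖f‖_{L²}^{1/2} ‖f‖_{H²}^{3/2}
(`exists_enorm_sq_sub_sq_le`), applied to f = h(y,·) with |a-c| = |y/t|. Hölder's inequality in y
with exponents 4 and 4/3 turns it into |t|^{-1/2} ‖xh‖^{1/2} ‖h‖_{L²H²}^{3/2}
(`exists_ae_lintegral_enorm_sq_sub_sq_le`). The gain |t|^{-1/2} is exactly the square of the weight
in the norm Z'.

Potential. Integration by parts in v against ψ(y + tv) shows that ∂_x^β ρ is t^{-|β|} times the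
velocity average of ∂_v^β(h²), a sum of products of v-derivatives of h
(`SliceFamily.isWeakDeriv_transport`). In (2) and (4) the gradient falls on the Green function, in
(3) on the density; G and ∇G lie in L^p for 1 ≤ p < 2. After a shear, the convolution is dominated
by ∫∫ |K(x-y-tw)| Q(y,w) dw dy, with Q the sum of the absolute products. For the sup norm, Hölder's
inequality in w gives |t|^{-2/p}, while the products are in L^q_w because H¹ embeds in L^{2q} for
finite q; p = 1 would need q = ∞, and this is the loss of δ. For the L² norm, a top-order factor is
only in L²; its partner is in L⁴, so the product is in L^{4/3}, and Young's inequality L^{4/3} *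
L^{4/3} → L² gives |t|^{-1/2}. In both cases the bound on a slice is the square of its Sobolev norm,
hence integrable in y.

Weak derivatives. Mollification, cutoff and Fubini show that for almost every y the slices at y of h
and of its v-derivatives are joint L² limits of a test function and its derivatives
(`isTestLimit_of_isWeakDeriv`, `ae_isTestLimit_slice`). Sobolev inequalities are therefore proved
for test functions and passed to the limit. -/

theorem multiIndex_induction {P : (Fin 2 → ℕ) → Prop} (zero : P 0)
    (succ : ∀ α j, P α → P (α + Pi.single j 1)) (α : Fin 2 → ℕ) : P α := by
  have key : ∀ m n : ℕ, P ![m, n] := by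
    intro m
    induction m with
    | zero =>
      intro n
      induction n with
      | zero => convert zero using 1; ext i; fin_cases i <;> rfl
      | succ n ih => convert succ _ 1 ih using 1; ext i; fin_cases i <;> simp
    | succ m ih => intro n; convert succ _ 0 (ih n) using 1; ext i; fin_cases i <;> simp
  convert key (α 0) (α 1) using 1
  ext i; fin_cases i <;> rfl

theorem multiLength_add (α β : Fin 2 → ℕ) :
    multiLength (α + β) = multiLength α + multiLength β := by
  simp [multiLength]; ring

@[simp] theorem multiLength_zero : multiLength 0 = 0 := by simp [multiLength]

@[simp] theorem multiLength_single (j : Fin 2) : multiLength (Pi.single j 1) = 1 := by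
  simp [multiLength]

section Calculus

variable {V W : Type*} [NormedAddCommGroup V] [NormedSpace ℝ V]
  [NormedAddCommGroup W] [NormedSpace ℝ W]

theorem contDiff_dirDeriv (e : V) {ψ : V → ℝ} (hψ : ContDiff ℝ ∞ ψ) :
    ContDiff ℝ ∞ (dirDeriv e ψ) :=
  (hψ.fderiv_right (m := ∞) (by simp)).clm_apply contDiff_const

theorem hasCompactSupport_dirDeriv (e : V) {ψ : V → ℝ} (hψ : HasCompactSupport ψ) :
    HasCompactSupport (dirDeriv e ψ) :=
  hψ.fderiv_apply (𝕜 := ℝ) e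

theorem dirDeriv_comm (e e' : V) {ψ : V → ℝ} (hψ : ContDiff ℝ ∞ ψ) :
    dirDeriv e (dirDeriv e' ψ) = dirDeriv e' (dirDeriv e ψ) := by
  ext p
  have h2 : DifferentiableAt ℝ (fderiv ℝ ψ) p :=
    ((hψ.fderiv_right (m := ∞) (by simp)).differentiable (by simp)) p
  have hsymm : IsSymmSndFDerivAt ℝ ψ p :=
    hψ.contDiffAt.isSymmSndFDerivAt (by simp only [minSmoothness_of_isRCLikeNormedField]; exact WithTop.coe_le_coe.2 le_top)
  have key : ∀ a c : V, dirDeriv a (dirDeriv c ψ) p = fderiv ℝ (fderiv ℝ ψ) p a c := by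
    intro a c
    change fderiv ℝ (fun q => fderiv ℝ ψ q c) p a = _
    rw [fderiv_clm_apply h2 (differentiableAt_const c)]
    simp
  rw [key, key]
  exact hsymm e e'

theorem contDiff_iterate_dirDeriv (e : V) (n : ℕ) {ψ : V → ℝ} (hψ : ContDiff ℝ ∞ ψ) :
    ContDiff ℝ ∞ ((dirDeriv e)^[n] ψ) := by
  induction n with
  | zero => exact hψ
  | succ n ih => rw [Function.iterate_succ_apply']; exact contDiff_dirDeriv e ih

theorem contDiff_multiDeriv (b : Fin 2 → V) (α : Fin 2 → ℕ) {ψ : V → ℝ} (hψ : ContDiff ℝ ∞ ψ) :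
    ContDiff ℝ ∞ (multiDeriv b α ψ) :=
  contDiff_iterate_dirDeriv _ _ (contDiff_iterate_dirDeriv _ _ hψ)

theorem hasCompactSupport_iterate_dirDeriv (e : V) (n : ℕ) {ψ : V → ℝ}
    (hψ : HasCompactSupport ψ) : HasCompactSupport ((dirDeriv e)^[n] ψ) := by
  induction n with
  | zero => exact hψ
  | succ n ih => rw [Function.iterate_succ_apply']; exact hasCompactSupport_dirDeriv e ih

theorem hasCompactSupport_multiDeriv (b : Fin 2 → V) (α : Fin 2 → ℕ) {ψ : V → ℝ}
    (hψ : HasCompactSupport ψ) : HasCompactSupport (multiDeriv b α ψ) :=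
  hasCompactSupport_iterate_dirDeriv _ _ (hasCompactSupport_iterate_dirDeriv _ _ hψ)

@[simp] theorem multiDeriv_zero (b : Fin 2 → V) (ψ : V → ℝ) : multiDeriv b 0 ψ = ψ := rfl

theorem iterate_dirDeriv_comm (e e' : V) (n : ℕ) {ψ : V → ℝ} (hψ : ContDiff ℝ ∞ ψ) :
    (dirDeriv e)^[n] (dirDeriv e' ψ) = dirDeriv e' ((dirDeriv e)^[n] ψ) := by
  induction n with
  | zero => rfl
  | succ n ih =>
    rw [Function.iterate_succ_apply', Function.iterate_succ_apply', ih,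
      dirDeriv_comm _ _ (contDiff_iterate_dirDeriv e n hψ)]

theorem multiDeriv_add_single (b : Fin 2 → V) (α : Fin 2 → ℕ) (j : Fin 2) {ψ : V → ℝ}
    (hψ : ContDiff ℝ ∞ ψ) :
    multiDeriv b (α + Pi.single j 1) ψ = dirDeriv (b j) (multiDeriv b α ψ) := by
  fin_cases j
  · simp [multiDeriv, Function.iterate_succ_apply']
  · simp [multiDeriv, Function.iterate_succ_apply',
      iterate_dirDeriv_comm _ _ _ (contDiff_iterate_dirDeriv _ _ hψ)]

theorem multiDeriv_dirDeriv (b : Fin 2 → V) (α : Fin 2 → ℕ) (j : Fin 2) {ψ : V → ℝ}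
    (hψ : ContDiff ℝ ∞ ψ) :
    multiDeriv b α (dirDeriv (b j) ψ) = dirDeriv (b j) (multiDeriv b α ψ) := by
  simp only [multiDeriv]
  rw [iterate_dirDeriv_comm _ _ _ hψ,
    iterate_dirDeriv_comm _ _ _ (contDiff_iterate_dirDeriv _ _ hψ)]

theorem dirDeriv_mul (e : V) {f g : V → ℝ} (hf : ContDiff ℝ ∞ f) (hg : ContDiff ℝ ∞ g) :
    dirDeriv e (fun x => f x * g x) = fun x => dirDeriv e f x * g x + f x * dirDeriv e g x := by
  ext x
  have := fderiv_fun_mul (hf.differentiable (by simp) x) (hg.differentiable (by simp) x)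
  simp only [dirDeriv, this]
  simp
  ring

theorem dirDeriv_list_sum {ι : Type*} (e : V) (s : List ι) (f : ι → V → ℝ)
    (hf : ∀ i, ContDiff ℝ ∞ (f i)) :
    dirDeriv e (fun x => (s.map fun i => f i x).sum) =
      fun x => (s.map fun i => dirDeriv e (f i) x).sum := by
  induction s with
  | nil => ext x; simp [dirDeriv]
  | cons i s ih =>
    have hs : ContDiff ℝ ∞ (fun x => (s.map fun i => f i x).sum) := by
      clear ih
      induction s with
      | nil => simpa using contDiff_const
      | cons k s ih => simpa using (hf k).add ih
    ext x
    have := congrFun ih x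
    have h2 := fderiv_fun_add (hf i |>.differentiable (by simp) x) (hs.differentiable (by simp) x)
    simp only [dirDeriv, List.map_cons, List.sum_cons] at this ⊢
    rw [h2, ← this]
    simp

/-- Repeated pairs in the list play the role of the binomial coefficients; later arguments need only
that each pair sums to β. The list depends on β alone, so it can be fixed before the functions and
before any constant. -/
theorem exists_leibniz (b : Fin 2 → V) (β : Fin 2 → ℕ) :
    ∃ s : List ((Fin 2 → ℕ) × (Fin 2 → ℕ)), (∀ p ∈ s, p.1 + p.2 = β) ∧
      ∀ f g : V → ℝ, ContDiff ℝ ∞ f → ContDiff ℝ ∞ g →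
        multiDeriv b β (fun x => f x * g x) =
          fun x => (s.map fun p => multiDeriv b p.1 f x * multiDeriv b p.2 g x).sum := by
  induction β using multiIndex_induction with
  | zero => exact ⟨[(0, 0)], by simp, by intros; simp⟩
  | succ β j ih =>
    obtain ⟨s, hs, hfg⟩ := ih
    refine ⟨s.map (fun p => (p.1 + Pi.single j 1, p.2)) ++
      s.map (fun p => (p.1, p.2 + Pi.single j 1)), ?_, ?_⟩
    · intro p hp
      simp only [List.mem_append, List.mem_map] at hp
      rcases hp with ⟨q, hq, rfl⟩ | ⟨q, hq, rfl⟩ <;> simp only [← hs q hq] <;> abel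
    · intro f g hf hg
      rw [multiDeriv_add_single _ _ _ (hf.mul hg), hfg f g hf hg, dirDeriv_list_sum (b j) s
        (fun p x => multiDeriv b p.1 f x * multiDeriv b p.2 g x)
        (fun p => (contDiff_multiDeriv b p.1 hf).mul (contDiff_multiDeriv b p.2 hg))]
      ext x
      rw [List.map_append, List.sum_append, List.map_map, List.map_map, ← List.sum_map_add]
      congr 2
      ext p
      rw [dirDeriv_mul _ (contDiff_multiDeriv b p.1 hf) (contDiff_multiDeriv b p.2 hg)]
      simp [multiDeriv_add_single _ _ _ hf, multiDeriv_add_single _ _ _ hg]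

/-- An affine map has constant derivative, so the chain rule merely transports the directions. This
one rule covers restriction to slices, dilation of cutoffs, reflection in convolutions and the
substitution v ↦ y + tv. -/
theorem multiDeriv_comp_affine (b : Fin 2 → W) (L : W →L[ℝ] V) (c : V) (α : Fin 2 → ℕ)
    {ψ : V → ℝ} (hψ : ContDiff ℝ ∞ ψ) :
    multiDeriv b α (fun w => ψ (c + L w)) =
      fun w => multiDeriv (fun i => L (b i)) α ψ (c + L w) := by
  have hL : ContDiff ℝ ∞ (fun w => c + L w) := contDiff_const.add L.contDiff
  induction α using multiIndex_induction with
  | zero => rfl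
  | succ α j ih =>
    rw [multiDeriv_add_single b α j (ψ := fun w => ψ (c + L w)) (hψ.comp hL), ih,
      multiDeriv_add_single _ _ _ hψ]
    ext w
    have h1 : HasFDerivAt (fun w => c + L w) L w := L.hasFDerivAt.const_add c
    have h2 := ((contDiff_multiDeriv (fun i => L (b i)) α hψ).differentiable (by simp)
      (c + L w)).hasFDerivAt.comp w h1
    simp only [dirDeriv]
    exact DFunLike.congr_fun h2.fderiv (b j)

theorem multiDeriv_const_smul_dir (b : Fin 2 → V) (r : ℝ) (α : Fin 2 → ℕ) {ψ : V → ℝ}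
    (hψ : ContDiff ℝ ∞ ψ) (x : V) :
    multiDeriv (fun i => r • b i) α ψ x = r ^ multiLength α * multiDeriv b α ψ x := by
  induction α using multiIndex_induction generalizing x with
  | zero => simp
  | succ α j ih =>
    rw [multiDeriv_add_single _ _ _ hψ, multiDeriv_add_single _ _ _ hψ]
    have : multiDeriv (fun i => r • b i) α ψ = fun x => r ^ multiLength α * multiDeriv b α ψ x :=
      funext ih
    rw [this]
    simp only [dirDeriv]
    rw [fderiv_const_mul ((contDiff_multiDeriv b α hψ).differentiable (by simp) x)]
    simp [multiLength_add]
    ring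

theorem multiDeriv_const_sub (b : Fin 2 → V) (α : Fin 2 → ℕ) {φ : V → ℝ} (hφ : ContDiff ℝ ∞ φ)
    (x y : V) :
    multiDeriv b α (fun t => φ (x - t)) y = (-1) ^ multiLength α * multiDeriv b α φ (x - y) := by
  have h := multiDeriv_comp_affine b (-ContinuousLinearMap.id ℝ V) x α hφ
  simp only [_root_.neg_apply, ContinuousLinearMap.id_apply, ← sub_eq_add_neg] at h
  rw [h]
  have := multiDeriv_const_smul_dir b (-1) α hφ (x - y)
  simpa using this

/-! ### Integration by parts against test functions. -/

section Integral

variable [MeasureSpace V] [BorelSpace V] [FiniteDimensional ℝ V]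
  [(volume : Measure V).IsAddHaarMeasure]

theorem integral_mul_dirDeriv (e : V) {f ψ : V → ℝ} (hf : ContDiff ℝ ∞ f) (hψ : ContDiff ℝ ∞ ψ)
    (hc : HasCompactSupport ψ) :
    ∫ x, f x * dirDeriv e ψ x = - ∫ x, dirDeriv e f x * ψ x := by
  apply integral_mul_fderiv_eq_neg_fderiv_mul_of_integrable
  · exact ((contDiff_dirDeriv e hf).continuous.mul hψ.continuous).integrable_of_hasCompactSupport
      hc.mul_left
  · exact (hf.continuous.mul (contDiff_dirDeriv e hψ).continuous).integrable_of_hasCompactSupport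
      (hasCompactSupport_dirDeriv e hc).mul_left
  · exact (hf.continuous.mul hψ.continuous).integrable_of_hasCompactSupport hc.mul_left
  · exact fun x _ => hf.differentiable (by simp) x
  · exact fun x _ => hψ.differentiable (by simp) x

theorem integral_mul_multiDeriv (b : Fin 2 → V) (α : Fin 2 → ℕ) {f ψ : V → ℝ}
    (hf : ContDiff ℝ ∞ f) (hψ : ContDiff ℝ ∞ ψ) (hc : HasCompactSupport ψ) :
    ∫ x, f x * multiDeriv b α ψ x = (-1) ^ multiLength α * ∫ x, multiDeriv b α f x * ψ x := by
  induction α using multiIndex_induction generalizing f with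
  | zero => simp
  | succ α j ih =>
    rw [multiDeriv_add_single _ _ _ hψ, integral_mul_dirDeriv _ hf (contDiff_multiDeriv b α hψ)
      (hasCompactSupport_multiDeriv b α hc), ih (contDiff_dirDeriv _ hf),
      multiDeriv_add_single _ _ _ hf, multiDeriv_dirDeriv _ _ _ hf, multiLength_add]
    simp [pow_succ]

end Integral

end Calculus

end

end ScreenedVP

namespace ScreenedVP

noncomputable section

open Filter Topology Convolution ContinuousLinearMap

/-! ### Square integrals and the Cauchy-Schwarz inequality -/

section Sq

variable {α : Type*} [MeasurableSpace α] {μ : Measure α}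

theorem eLpNorm_two_sq {E : Type*} [NormedAddCommGroup E] (f : α → E) :
    eLpNorm f 2 μ ^ 2 = ∫⁻ x, ‖f x‖ₑ ^ 2 ∂μ := by
  rw [eLpNorm_eq_lintegral_rpow_enorm_toReal (by simp) (by simp), ← ENNReal.rpow_natCast,
    ← ENNReal.rpow_mul]
  simp

theorem sq_lintegral_mul_le {f g : α → ℝ≥0∞} (hf : AEMeasurable f μ) (hg : AEMeasurable g μ) :
    (∫⁻ x, f x * g x ∂μ) ^ 2 ≤ (∫⁻ x, f x ^ 2 ∂μ) * ∫⁻ x, g x ^ 2 ∂μ := by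
  have h := ENNReal.lintegral_mul_le_Lp_mul_Lq μ Real.HolderConjugate.two_two hf hg
  have h2 := pow_le_pow_left' h 2
  refine h2.trans (le_of_eq ?_)
  rw [mul_pow, ← ENNReal.rpow_natCast, ← ENNReal.rpow_mul, ← ENNReal.rpow_natCast (_ ^ _),
    ← ENNReal.rpow_mul]
  simp

/-- Convergence almost everywhere without loss of norm is convergence in L². The parallelogram law
bounds ‖u_n + v‖² + ‖u_n - v‖² by 4‖v‖², and by Fatou the first term alone already has lower limit
at least 4‖v‖². -/
theorem tendsto_lintegral_enorm_sub_sq {u : ℕ → α → ℝ} {v : α → ℝ}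
    (hu : ∀ n, AEStronglyMeasurable (u n) μ) (hv : AEStronglyMeasurable v μ)
    (hae : ∀ᵐ x ∂μ, Tendsto (fun n => u n x) atTop (𝓝 (v x)))
    (hle : ∀ n, ∫⁻ x, ‖u n x‖ₑ ^ 2 ∂μ ≤ ∫⁻ x, ‖v x‖ₑ ^ 2 ∂μ)
    (hfin : ∫⁻ x, ‖v x‖ₑ ^ 2 ∂μ ≠ ⊤) :
    Tendsto (fun n => ∫⁻ x, ‖u n x - v x‖ₑ ^ 2 ∂μ) atTop (𝓝 0) := by
  set U := ∫⁻ x, ‖v x‖ₑ ^ 2 ∂μ with hU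
  have hpar : ∀ n, ∫⁻ x, ‖u n x + v x‖ₑ ^ 2 ∂μ + ∫⁻ x, ‖u n x - v x‖ₑ ^ 2 ∂μ ≤ 4 * U := by
    intro n
    have hm : AEMeasurable (fun x => ‖u n x + v x‖ₑ ^ 2) μ := ((hu n).add hv).enorm.pow_const 2
    rw [← lintegral_add_left' hm]
    calc ∫⁻ x, ‖u n x + v x‖ₑ ^ 2 + ‖u n x - v x‖ₑ ^ 2 ∂μ
        = ∫⁻ x, (2 * ‖u n x‖ₑ ^ 2 + 2 * ‖v x‖ₑ ^ 2) ∂μ := by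
          congr 1; ext x
          simp only [Real.enorm_eq_ofReal_abs]
          rw [← ENNReal.ofReal_pow (abs_nonneg _), ← ENNReal.ofReal_pow (abs_nonneg _),
            ← ENNReal.ofReal_pow (abs_nonneg _), ← ENNReal.ofReal_pow (abs_nonneg _),
            ← ENNReal.ofReal_add (by positivity) (by positivity),
            show (2 : ℝ≥0∞) = ENNReal.ofReal 2 by simp,
            ← ENNReal.ofReal_mul (by norm_num), ← ENNReal.ofReal_mul (by norm_num),
            ← ENNReal.ofReal_add (by positivity) (by positivity)]
          congr 1
          simp only [sq_abs]; ring
      _ = 2 * ∫⁻ x, ‖u n x‖ₑ ^ 2 ∂μ + 2 * U := by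
          rw [lintegral_add_left' (((hu n).enorm.pow_const 2).const_mul _),
            lintegral_const_mul' _ _ (by simp), lintegral_const_mul' _ _ (by simp)]
      _ ≤ 2 * U + 2 * U := by gcongr; exact hle n
      _ = 4 * U := by ring
  have hfat : 4 * U ≤ liminf (fun n => ∫⁻ x, ‖u n x + v x‖ₑ ^ 2 ∂μ) atTop := by
    calc 4 * U = ∫⁻ x, liminf (fun n => ‖u n x + v x‖ₑ ^ 2) atTop ∂μ := by
          rw [hU, ← lintegral_const_mul' _ _ (by simp)]
          apply lintegral_congr_ae
          filter_upwards [hae] with x hx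
          have : Tendsto (fun n => ‖u n x + v x‖ₑ ^ 2) atTop (𝓝 (‖v x + v x‖ₑ ^ 2)) :=
            ((ENNReal.continuous_pow 2).tendsto _).comp ((hx.add_const (v x)).enorm)
          rw [this.liminf_eq, ← two_mul, enorm_mul, mul_pow]
          congr 1
          rw [Real.enorm_eq_ofReal_abs]
          norm_num
      _ ≤ _ := lintegral_liminf_le' fun n => ((hu n).add hv).enorm.pow_const 2
  rw [ENNReal.tendsto_atTop_zero]
  intro ε hε
  by_cases h0 : U = 0
  · refine ⟨0, fun n _ => ?_⟩
    have := hpar n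
    rw [h0, mul_zero] at this
    exact (le_trans le_add_self this).trans bot_le
  have h4 : 4 * U ≠ ⊤ := ENNReal.mul_ne_top (by simp) hfin
  have hlt : 4 * U - ε < liminf (fun n => ∫⁻ x, ‖u n x + v x‖ₑ ^ 2 ∂μ) atTop :=
    lt_of_lt_of_le (ENNReal.sub_lt_self h4 (by simp [h0]) hε.ne') hfat
  obtain ⟨N, hN⟩ := eventually_atTop.1 (eventually_lt_of_lt_liminf hlt)
  refine ⟨N, fun n hn => ?_⟩
  have h1 := hpar n
  have h2 := hN n hn
  by_contra hcon
  push Not at hcon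
  have h3 : 4 * U ≤ (4 * U - ε) + ε := le_tsub_add
  have : 4 * U < 4 * U := by
    calc 4 * U ≤ (4 * U - ε) + ε := h3
      _ < ∫⁻ x, ‖u n x + v x‖ₑ ^ 2 ∂μ + ∫⁻ x, ‖u n x - v x‖ₑ ^ 2 ∂μ :=
        ENNReal.add_lt_add h2 hcon
      _ ≤ 4 * U := h1
  exact lt_irrefl _ this

end Sq

/-! ### Mollification -/

section Mollification

variable {V : Type*} [NormedAddCommGroup V] [NormedSpace ℝ V] [FiniteDimensional ℝ V]
  [MeasureSpace V] [BorelSpace V] [(volume : Measure V).IsAddHaarMeasure]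

theorem dirDeriv_convolution (e : V) {φ u : V → ℝ} (hφ : ContDiff ℝ ∞ φ)
    (hc : HasCompactSupport φ) (hu : LocallyIntegrable u) :
    dirDeriv e (φ ⋆[lsmul ℝ ℝ] u) = (dirDeriv e φ) ⋆[lsmul ℝ ℝ] u := by
  ext x
  have h1 : ContDiff ℝ 1 φ := hφ.of_le (by simp)
  rw [← convolution_flip, dirDeriv,
    (hc.hasFDerivAt_convolution_right (lsmul ℝ ℝ : ℝ →L[ℝ] ℝ →L[ℝ] ℝ).flip hu h1 x).fderiv,
    convolution_precompR_apply _ hu (hc.fderiv ℝ) (h1.continuous_fderiv one_ne_zero),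
    convolution_flip]
  rfl

theorem multiDeriv_convolution (b : Fin 2 → V) (α : Fin 2 → ℕ) {φ u : V → ℝ}
    (hφ : ContDiff ℝ ∞ φ) (hc : HasCompactSupport φ) (hu : LocallyIntegrable u) :
    multiDeriv b α (φ ⋆[lsmul ℝ ℝ] u) = (multiDeriv b α φ) ⋆[lsmul ℝ ℝ] u := by
  induction α using multiIndex_induction with
  | zero => rfl
  | succ α j ih =>
    rw [multiDeriv_add_single _ _ _ (hc.contDiff_convolution_left _ hφ hu), ih,
      dirDeriv_convolution _ (contDiff_multiDeriv b α hφ) (hasCompactSupport_multiDeriv b α hc) hu,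
      multiDeriv_add_single _ _ _ hφ]

/-- The test function is t ↦ φ(x - t): the sign from the reflection cancels the sign in the
definition of the weak derivative. -/
theorem convolution_of_isWeakDeriv {b : Fin 2 → V} {α : Fin 2 → ℕ} {φ u g : V → ℝ}
    (hφ : ContDiff ℝ ∞ φ) (hc : HasCompactSupport φ) (h : IsWeakDeriv b α u g) :
    (multiDeriv b α φ) ⋆[lsmul ℝ ℝ] u = φ ⋆[lsmul ℝ ℝ] g := by
  ext x
  have hsub : ContDiff ℝ ∞ (fun t => φ (x - t)) := hφ.comp (contDiff_const.sub contDiff_id)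
  have hcs : HasCompactSupport (fun t => φ (x - t)) :=
    hc.comp_homeomorph (Homeomorph.subLeft x)
  have := h.2.2 _ hsub hcs
  simp only [multiDeriv_const_sub b α hφ] at this
  rw [convolution_eq_swap, convolution_eq_swap]
  simp only [lsmul_apply, smul_eq_mul]
  have h1 : (-1 : ℝ) ^ multiLength α * (-1) ^ multiLength α = 1 := by
    rw [← mul_pow]; simp
  have h2 : ∫ p, u p * ((-1) ^ multiLength α * multiDeriv b α φ (x - p)) =
      (-1) ^ multiLength α * ∫ p, multiDeriv b α φ (x - p) * u p := by
    rw [← integral_const_mul]; congr 1; ext p; ring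
  rw [h2] at this
  calc ∫ t, multiDeriv b α φ (x - t) * u t
      = (-1) ^ multiLength α * ((-1) ^ multiLength α * ∫ t, multiDeriv b α φ (x - t) * u t) := by
        rw [← mul_assoc, h1, one_mul]
    _ = ∫ t, φ (x - t) * g t := by
        rw [this, ← mul_assoc, h1, one_mul]; congr 1; ext p; ring

/-- Splitting φ = φ^{1/2} φ^{1/2}, Cauchy-Schwarz and the unit mass of φ give |φ * u|² ≤ φ * |u|²
pointwise; Tonelli and the unit mass again finish. -/
theorem lintegral_enorm_convolution_sq_le {φ u : V → ℝ} (hφ : Continuous φ) (h0 : ∀ x, 0 ≤ φ x)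
    (h1 : ∫⁻ x, ENNReal.ofReal (φ x) = 1) (hu : AEStronglyMeasurable u) :
    ∫⁻ x, ‖(φ ⋆[lsmul ℝ ℝ] u) x‖ₑ ^ 2 ≤ ∫⁻ x, ‖u x‖ₑ ^ 2 := by
  have hm : Measurable fun x => ENNReal.ofReal (φ x) := hφ.measurable.ennreal_ofReal
  have hpt : ∀ x, ‖(φ ⋆[lsmul ℝ ℝ] u) x‖ₑ ^ 2 ≤
      ∫⁻ t, ENNReal.ofReal (φ (x - t)) * ‖u t‖ₑ ^ 2 := by
    intro x
    have hmx : Measurable fun t => ENNReal.ofReal (φ (x - t)) :=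
      hm.comp (measurable_const.sub measurable_id)
    have hs : ∀ t, ENNReal.ofReal (φ (x - t)) = (ENNReal.ofReal (φ (x - t)) ^ (1 / 2 : ℝ)) ^ 2 := by
      intro t
      rw [← ENNReal.rpow_natCast, ← ENNReal.rpow_mul]; simp
    rw [convolution_eq_swap]
    calc ‖∫ t, (lsmul ℝ ℝ) (φ (x - t)) (u t)‖ₑ ^ 2
        ≤ (∫⁻ t, ‖(lsmul ℝ ℝ) (φ (x - t)) (u t)‖ₑ) ^ 2 := by
          gcongr; exact enorm_integral_le_lintegral_enorm _
      _ = (∫⁻ t, ENNReal.ofReal (φ (x - t)) ^ (1 / 2 : ℝ) *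
            (ENNReal.ofReal (φ (x - t)) ^ (1 / 2 : ℝ) * ‖u t‖ₑ)) ^ 2 := by
          congr 2; ext t
          rw [← mul_assoc, ← sq, ← hs, lsmul_apply, enorm_smul, Real.enorm_eq_ofReal (h0 _)]
      _ ≤ (∫⁻ t, (ENNReal.ofReal (φ (x - t)) ^ (1 / 2 : ℝ)) ^ 2) *
            ∫⁻ t, (ENNReal.ofReal (φ (x - t)) ^ (1 / 2 : ℝ) * ‖u t‖ₑ) ^ 2 :=
          sq_lintegral_mul_le (hmx.pow_const _).aemeasurable
            ((hmx.pow_const _).aemeasurable.mul hu.enorm)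
      _ = _ := by
          simp only [mul_pow, ← hs]
          rw [lintegral_sub_left_eq_self (fun t => ENNReal.ofReal (φ t)), h1, one_mul]
  calc ∫⁻ x, ‖(φ ⋆[lsmul ℝ ℝ] u) x‖ₑ ^ 2
      ≤ ∫⁻ x, ∫⁻ t, ENNReal.ofReal (φ (x - t)) * ‖u t‖ₑ ^ 2 := lintegral_mono hpt
    _ = ∫⁻ t, ∫⁻ x, ENNReal.ofReal (φ (x - t)) * ‖u t‖ₑ ^ 2 := by
        apply lintegral_lintegral_swap
        have ha : AEMeasurable (fun p : V × V => ENNReal.ofReal (φ (p.1 - p.2)))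
            ((volume : Measure V).prod volume) :=
          (hm.comp (measurable_fst.sub measurable_snd)).aemeasurable
        exact ha.mul (AEMeasurable.comp_snd (f := fun t => ‖u t‖ₑ ^ 2) (hu.enorm.pow_const 2))
    _ = ∫⁻ t, ‖u t‖ₑ ^ 2 := by
        congr 1; ext t
        have hmt : Measurable fun x => ENNReal.ofReal (φ (x - t)) :=
          hm.comp (measurable_id.sub measurable_const)
        rw [lintegral_mul_const _ hmt,
          lintegral_sub_right_eq_self (fun x => ENNReal.ofReal (φ x)), h1, one_mul]

variable (V) in
/-- A sequence of bump functions concentrating at the origin. -/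
def bumpSeq (n : ℕ) : ContDiffBump (0 : V) where
  rIn := 1 / (n + 1)
  rOut := 2 / (n + 1)
  rIn_pos := by positivity
  rIn_lt_rOut := by gcongr; norm_num

/-- Lebesgue differentiation gives convergence almost everywhere, and averaging does not increase
the L² norm, so convergence in norm follows. -/
theorem tendsto_mollify {u : V → ℝ} (hu : MemLp u 2) :
    Tendsto (fun n => ∫⁻ x, ‖((bumpSeq V n).normed volume ⋆[lsmul ℝ ℝ] u) x - u x‖ₑ ^ 2)
      atTop (𝓝 0) := by
  have hloc : LocallyIntegrable u := hu.locallyIntegrable (by norm_num)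
  apply tendsto_lintegral_enorm_sub_sq
  · intro n
    exact (((bumpSeq V n).hasCompactSupport_normed (μ := volume)).contDiff_convolution_left _
      ((bumpSeq V n).contDiff_normed (n := 0)) hloc).continuous.aestronglyMeasurable
  · exact hu.1
  · apply ContDiffBump.ae_convolution_tendsto_right_of_locallyIntegrable (K := 2) _ _ hloc
    · have := (tendsto_one_div_add_atTop_nhds_zero_nat (𝕜 := ℝ)).const_mul 2
      simpa [bumpSeq, div_eq_mul_inv] using this
    · exact Eventually.of_forall fun n => by simp [bumpSeq]; field_simp; rfl
  · intro n
    apply lintegral_enorm_convolution_sq_le ((bumpSeq V n).continuous_normed) _ _ hu.1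
    · exact fun x => (bumpSeq V n).nonneg_normed x
    · rw [← ofReal_integral_eq_lintegral_ofReal, (bumpSeq V n).integral_normed, ENNReal.ofReal_one]
      · exact (bumpSeq V n).integrable_normed
      · exact Eventually.of_forall fun x => (bumpSeq V n).nonneg_normed x
  · rw [← eLpNorm_two_sq]
    exact ENNReal.pow_ne_top hu.2.ne

end Mollification

end

end ScreenedVP

namespace ScreenedVP

noncomputable section

open Filter Topology Convolution ContinuousLinearMap

/-! ### Approximation by test functions -/

/-- The finite set of multi-indices of length at most `k`. -/
def multiIdx (k : ℕ) : Finset (Fin 2 → ℕ) :=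
  (Finset.range (k + 1)).biUnion fun n => Finset.piAntidiag Finset.univ n

@[simp] theorem mem_multiIdx {k : ℕ} {β : Fin 2 → ℕ} : β ∈ multiIdx k ↔ multiLength β ≤ k := by
  simp [multiIdx, multiLength]

theorem enorm_add_sq_le (a c : ℝ) : ‖a + c‖ₑ ^ 2 ≤ 2 * (‖a‖ₑ ^ 2 + ‖c‖ₑ ^ 2) := by
  simp only [Real.enorm_eq_ofReal_abs]
  rw [← ENNReal.ofReal_pow (abs_nonneg _), ← ENNReal.ofReal_pow (abs_nonneg _),
    ← ENNReal.ofReal_pow (abs_nonneg _), ← ENNReal.ofReal_add (by positivity) (by positivity),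
    show (2 : ℝ≥0∞) = ENNReal.ofReal 2 by simp, ← ENNReal.ofReal_mul (by norm_num)]
  apply ENNReal.ofReal_le_ofReal
  simp only [sq_abs]
  nlinarith [sq_nonneg (a - c)]

theorem lintegral_enorm_sub_sq_le {α : Type*} [MeasurableSpace α] {μ : Measure α} {f g h : α → ℝ}
    (hf : AEStronglyMeasurable f μ) (hg : AEStronglyMeasurable g μ) :
    ∫⁻ x, ‖f x - h x‖ₑ ^ 2 ∂μ ≤
      2 * (∫⁻ x, ‖f x - g x‖ₑ ^ 2 ∂μ + ∫⁻ x, ‖g x - h x‖ₑ ^ 2 ∂μ) := by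
  have hm : AEMeasurable (fun x => ‖f x - g x‖ₑ ^ 2) μ := (hf.sub hg).enorm.pow_const 2
  rw [← lintegral_add_left' hm, ← lintegral_const_mul' _ _ (by simp)]
  apply lintegral_mono
  intro x
  have := enorm_add_sq_le (f x - g x) (g x - h x)
  simpa using this

section Approx

variable {V : Type*} [NormedAddCommGroup V] [NormedSpace ℝ V]

/-- The family `H β`, `|β| ≤ k`, is an `L²`-limit of the derivatives `∂^β f` of test functions. -/
def IsTestLimit [MeasureSpace V] (b : Fin 2 → V) (k : ℕ) (H : (Fin 2 → ℕ) → V → ℝ) : Prop :=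
  ∀ ε : ℝ≥0∞, ε ≠ 0 → ∃ f : V → ℝ, ContDiff ℝ ∞ f ∧ HasCompactSupport f ∧
    ∀ β, multiLength β ≤ k → ∫⁻ p, ‖multiDeriv b β f p - H β p‖ₑ ^ 2 ≤ ε

variable [FiniteDimensional ℝ V]

variable (V) in
/-- The function `χ - 1` for a standard cutoff function `χ`. -/
def cutoffSubOne (x : V) : ℝ := (⟨1, 2, by norm_num, by norm_num⟩ : ContDiffBump (0 : V)) x - 1

theorem contDiff_cutoffSubOne : ContDiff ℝ ∞ (cutoffSubOne V) :=
  (ContDiffBump.contDiff _).sub contDiff_const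

theorem exists_bound_multiDeriv_cutoffSubOne (b : Fin 2 → V) (γ : Fin 2 → ℕ) :
    ∃ C : ℝ, ∀ x, |multiDeriv b γ (cutoffSubOne V) x| ≤ C := by
  set χ : ContDiffBump (0 : V) := ⟨1, 2, by norm_num, by norm_num⟩ with hχ
  have hdir : ∀ e, dirDeriv e (cutoffSubOne V) = dirDeriv e χ := by
    intro e; ext x
    simp only [dirDeriv]
    congr 1
    exact fderiv_sub_const (1 : ℝ)
  induction γ using multiIndex_induction with
  | zero =>
    refine ⟨1, fun x => ?_⟩
    have h1 := χ.nonneg (x := x)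
    have h2 := χ.le_one (x := x)
    simp only [multiDeriv_zero, cutoffSubOne, ← hχ]
    rw [abs_le]; constructor <;> linarith
  | succ γ j _ =>
    rw [multiDeriv_add_single _ _ _ contDiff_cutoffSubOne, ← multiDeriv_dirDeriv _ _ _
      contDiff_cutoffSubOne, hdir]
    obtain ⟨C, hC⟩ := (hasCompactSupport_multiDeriv b γ (hasCompactSupport_dirDeriv (b j)
      χ.hasCompactSupport)).exists_bound_of_continuous
      (contDiff_multiDeriv b γ (contDiff_dirDeriv (b j) χ.contDiff)).continuous
    exact ⟨C, hC⟩

theorem multiDeriv_cutoffSubOne_smul (b : Fin 2 → V) (γ : Fin 2 → ℕ) (r : ℝ) (x : V) :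
    multiDeriv b γ (fun x => cutoffSubOne V (r • x)) x =
      r ^ multiLength γ * multiDeriv b γ (cutoffSubOne V) (r • x) := by
  have h := multiDeriv_comp_affine b (r • ContinuousLinearMap.id ℝ V) 0 γ
    (contDiff_cutoffSubOne (V := V))
  simp only [zero_add, FunLike.coe_smul, Pi.smul_apply, coe_id', id_eq] at h
  rw [h]
  exact multiDeriv_const_smul_dir b r γ contDiff_cutoffSubOne (r • x)

/-- Each derivative brings down a factor 1/(m+1); at order zero the limit is χ(0) - 1 = 0. -/
theorem tendsto_multiDeriv_cutoffSubOne (b : Fin 2 → V) (γ : Fin 2 → ℕ) (x : V) :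
    Tendsto (fun m : ℕ => multiDeriv b γ
      (fun x => cutoffSubOne V ((1 / ((m : ℝ) + 1)) • x)) x) atTop (𝓝 0) := by
  simp only [multiDeriv_cutoffSubOne_smul]
  have hr := tendsto_one_div_add_atTop_nhds_zero_nat (𝕜 := ℝ)
  have h1 : Tendsto (fun m : ℕ => multiDeriv b γ (cutoffSubOne V) ((1 / ((m : ℝ) + 1)) • x)) atTop
      (𝓝 (multiDeriv b γ (cutoffSubOne V) ((0 : ℝ) • x))) :=
    ((contDiff_multiDeriv b γ contDiff_cutoffSubOne).continuous.tendsto _).comp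
      (hr.smul_const x)
  have h2 := (hr.pow (multiLength γ)).mul h1
  convert h2 using 2
  rcases Nat.eq_zero_or_pos (multiLength γ) with h | h
  · have : γ = 0 := by
      ext i
      have := Finset.single_le_sum (f := γ) (fun i _ => Nat.zero_le _) (Finset.mem_univ i)
      simp only [multiLength] at h
      simp only [Pi.zero_apply]
      omega
    subst this
    have h1 := (⟨1, 2, by norm_num, by norm_num⟩ : ContDiffBump (0 : V)).one_of_mem_closedBall
      (x := 0) (by simp)
    simp [cutoffSubOne, h1]
  · rw [zero_pow h.ne', zero_mul]

theorem memLp_list_sum {ι : Type*} {α : Type*} [MeasurableSpace α] {μ : Measure α} (s : List ι)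
    (f : ι → α → ℝ) {q : ℝ≥0∞} (h : ∀ i ∈ s, MemLp (f i) q μ) :
    MemLp (fun x => (s.map fun i => f i x).sum) q μ := by
  induction s with
  | nil => simp
  | cons i s ih =>
    simp only [List.map_cons, List.sum_cons]
    exact (h i (by simp)).add (ih fun i hi => h i (by simp [hi]))

variable [MeasureSpace V] [BorelSpace V]

/-- The error of the cutoff u ↦ χ(x/(m+1)) u is the product of χ(x/(m+1)) - 1 with u. Every Leibniz
term of this product tends to 0 pointwise and is dominated by a derivative of u, so dominated
convergence applies. -/
theorem exists_cutoff {b : Fin 2 → V} {k : ℕ} {u : V → ℝ} (hu : ContDiff ℝ ∞ u)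
    (hL : ∀ β, multiLength β ≤ k → MemLp (multiDeriv b β u) 2) {ε : ℝ≥0∞} (hε : ε ≠ 0) :
    ∃ f : V → ℝ, ContDiff ℝ ∞ f ∧ HasCompactSupport f ∧
      ∀ β, multiLength β ≤ k → ∫⁻ p, ‖multiDeriv b β f p - multiDeriv b β u p‖ₑ ^ 2 ≤ ε := by
  set χ : ContDiffBump (0 : V) := ⟨1, 2, by norm_num, by norm_num⟩ with hχ
  set c : ℕ → V → ℝ := fun m x => cutoffSubOne V ((1 / ((m : ℝ) + 1)) • x) with hc
  have hcs : ∀ m, ContDiff ℝ ∞ (c m) := fun m =>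
    contDiff_cutoffSubOne.comp (contDiff_const_smul (1 / ((m : ℝ) + 1)))
  have key : ∀ β, multiLength β ≤ k → Tendsto (fun m => ∫⁻ p,
      ‖multiDeriv b β (fun x => c m x * u x) p‖ₑ ^ 2) atTop (𝓝 0) := by
    intro β hβ
    obtain ⟨s, hs, hleib⟩ := exists_leibniz b β
    choose C hC using exists_bound_multiDeriv_cutoffSubOne b
    have hp2 : ∀ p ∈ s, multiLength p.2 ≤ k := by
      intro p hp
      have := congrArg multiLength (hs p hp)
      rw [multiLength_add] at this
      omega
    -- The majorant does not depend on m, since the dilation factors (1/(m+1))^{|γ|} are at most 1.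
    have hmem : MemLp (fun x => (s.map fun p => C p.1 * |multiDeriv b p.2 u x|).sum) 2 volume :=
      memLp_list_sum s (fun p x => C p.1 * |multiDeriv b p.2 u x|) fun p hp =>
        (hL p.2 (hp2 p hp)).norm.const_mul _
    have hz : (0 : ℝ≥0∞) = ∫⁻ _ : V, 0 := by simp
    rw [hz]
    refine tendsto_lintegral_of_dominated_convergence
      (fun x => ‖(s.map fun p => C p.1 * |multiDeriv b p.2 u x|).sum‖ₑ ^ 2) ?_ ?_ ?_ ?_
    · intro m
      exact (contDiff_multiDeriv b β ((hcs m).mul hu)).continuous.measurable.enorm.pow_const 2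
    · intro m
      refine Eventually.of_forall fun x => ?_
      simp only
      gcongr
      rw [hleib _ _ (hcs m) hu, Real.enorm_eq_ofReal_abs, Real.enorm_eq_ofReal_abs]
      apply ENNReal.ofReal_le_ofReal
      refine le_trans ?_ (le_abs_self _)
      clear hmem hleib hs hp2
      induction s with
      | nil => simp
      | cons p s ih =>
        simp only [List.map_cons, List.sum_cons]
        refine (abs_add_le _ _).trans (add_le_add ?_ ih)
        rw [abs_mul]
        gcongr
        rw [multiDeriv_cutoffSubOne_smul, abs_mul]
        refine le_trans ?_ (hC p.1 ((1 / ((m : ℝ) + 1)) • x))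
        apply mul_le_of_le_one_left (abs_nonneg _)
        rw [abs_of_nonneg (by positivity)]
        apply pow_le_one₀ (by positivity)
        rw [div_le_one (by positivity)]
        linarith [Nat.cast_nonneg (α := ℝ) m]
    · rw [← eLpNorm_two_sq]
      exact ENNReal.pow_ne_top hmem.2.ne
    · refine Eventually.of_forall fun x => ?_
      have h0 : Tendsto (fun m => multiDeriv b β (fun x => c m x * u x) x) atTop (𝓝 0) := by
        have : ∀ m, multiDeriv b β (fun x => c m x * u x) x =
            (s.map fun p => multiDeriv b p.1 (c m) x * multiDeriv b p.2 u x).sum :=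
          fun m => congrFun (hleib _ _ (hcs m) hu) x
        simp only [this]
        clear hmem hleib hs hp2 this
        induction s with
        | nil => simp
        | cons p s ih =>
          simp only [List.map_cons, List.sum_cons]
          have := ((tendsto_multiDeriv_cutoffSubOne b p.1 x).mul_const
            (multiDeriv b p.2 u x)).add ih
          simpa only [zero_mul, zero_add] using this
      have := ((ENNReal.continuous_pow 2).tendsto _).comp h0.enorm
      simpa [Function.comp_def] using this
  have hall : ∀ᶠ m in atTop, ∀ β ∈ multiIdx k,
      ∫⁻ p, ‖multiDeriv b β (fun x => c m x * u x) p‖ₑ ^ 2 ≤ ε := by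
    rw [Filter.eventually_all_finset]
    intro β hβ
    exact ((key β (by simpa using hβ)).eventually_lt_const (pos_iff_ne_zero.2 hε)).mono
      fun _ h => h.le
  obtain ⟨m, hm⟩ := hall.exists
  refine ⟨fun x => c m x * u x + u x, ((hcs m).mul hu).add hu, ?_, ?_⟩
  · have hsupp : HasCompactSupport (fun x : V => χ ((1 / ((m : ℝ) + 1)) • x)) :=
      χ.hasCompactSupport.comp_homeomorph
        (Homeomorph.smulOfNeZero (1 / ((m : ℝ) + 1)) (by positivity))
    have : (fun x => c m x * u x + u x) = fun x => χ ((1 / ((m : ℝ) + 1)) • x) * u x := by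
      ext x; simp only [hc, cutoffSubOne, ← hχ]; ring
    rw [this]
    exact hsupp.mul_right
  · intro β hβ
    refine le_trans (le_of_eq ?_) (hm β (by simpa using hβ))
    obtain ⟨s, hs, hleib⟩ := exists_leibniz b β
    have hadd : ∀ x, multiDeriv b β (fun x => c m x * u x + u x) x =
        multiDeriv b β (fun x => c m x * u x) x + multiDeriv b β u x := by
      clear hs hleib hβ s
      induction β using multiIndex_induction with
      | zero => intro x; rfl
      | succ β j ih =>
        intro x
        have h1 := contDiff_multiDeriv b β ((hcs m).mul hu)
        have h2 := contDiff_multiDeriv b β hu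
        rw [multiDeriv_add_single _ _ _ (((hcs m).mul hu).add hu),
          multiDeriv_add_single _ _ _ ((hcs m).mul hu), multiDeriv_add_single _ _ _ hu]
        simp only [dirDeriv]
        rw [funext ih, fderiv_fun_add (h1.differentiable (by simp) x)
          (h2.differentiable (by simp) x)]
        rfl
    congr 1; ext x
    rw [hadd]; simp

variable [(volume : Measure V).IsAddHaarMeasure]

/-- Mollifying h mollifies all its weak derivatives by the same kernel; a cutoff then makes the
mollification compactly supported. Each step costs ε/4, and the inequality (a+c)² ≤ 2(a²+c²)
restores ε. -/
theorem isTestLimit_of_isWeakDeriv {b : Fin 2 → V} {k : ℕ} {h : V → ℝ}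
    {H : (Fin 2 → ℕ) → V → ℝ} (hw : ∀ β, multiLength β ≤ k → IsWeakDeriv b β h (H β))
    (hL : ∀ β, multiLength β ≤ k → MemLp (H β) 2) : IsTestLimit b k H := by
  intro ε hε
  have hε4 : ε / 4 ≠ 0 := by simp [hε]
  set φ : ℕ → V → ℝ := fun n => (bumpSeq V n).normed volume
  have hφ : ∀ n, ContDiff ℝ ∞ (φ n) := fun n => (bumpSeq V n).contDiff_normed
  have hφc : ∀ n, HasCompactSupport (φ n) := fun n => (bumpSeq V n).hasCompactSupport_normed
  have hloc : LocallyIntegrable h := (hw 0 (by simp)).1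
  have hder : ∀ n β, multiLength β ≤ k →
      multiDeriv b β (φ n ⋆[lsmul ℝ ℝ] h) = φ n ⋆[lsmul ℝ ℝ] (H β) := by
    intro n β hβ
    rw [multiDeriv_convolution b β (hφ n) (hφc n) hloc,
      convolution_of_isWeakDeriv (hφ n) (hφc n) (hw β hβ)]
  have hall : ∀ᶠ n in atTop, ∀ β ∈ multiIdx k,
      ∫⁻ p, ‖(φ n ⋆[lsmul ℝ ℝ] (H β)) p - H β p‖ₑ ^ 2 ≤ ε / 4 := by
    rw [Filter.eventually_all_finset]
    intro β hβ
    exact ((tendsto_mollify (hL β (by simpa using hβ))).eventually_lt_const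
      (pos_iff_ne_zero.2 hε4)).mono fun _ h => h.le
  obtain ⟨n, hn⟩ := hall.exists
  have hsm : ContDiff ℝ ∞ (φ n ⋆[lsmul ℝ ℝ] h) := (hφc n).contDiff_convolution_left _ (hφ n) hloc
  obtain ⟨f, hf, hfc, hfe⟩ := exists_cutoff (b := b) (k := k) hsm (fun β hβ => by
    refine ⟨(contDiff_multiDeriv b β hsm).continuous.aestronglyMeasurable, ?_⟩
    rw [hder n β hβ]
    have h1 := lintegral_enorm_convolution_sq_le (hφ n).continuous
      (fun x => (bumpSeq V n).nonneg_normed x) (by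
        rw [← ofReal_integral_eq_lintegral_ofReal, (bumpSeq V n).integral_normed,
          ENNReal.ofReal_one]
        · exact (bumpSeq V n).integrable_normed
        · exact Eventually.of_forall fun x => (bumpSeq V n).nonneg_normed x) (hL β hβ).1
    rw [← eLpNorm_two_sq, ← eLpNorm_two_sq] at h1
    exact lt_of_le_of_lt ((ENNReal.pow_le_pow_left_iff two_ne_zero).1 h1) (hL β hβ).2) hε4
  refine ⟨f, hf, hfc, fun β hβ => ?_⟩
  calc ∫⁻ p, ‖multiDeriv b β f p - H β p‖ₑ ^ 2
      ≤ 2 * ((∫⁻ p, ‖multiDeriv b β f p - multiDeriv b β (φ n ⋆[lsmul ℝ ℝ] h) p‖ₑ ^ 2) +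
          ∫⁻ p, ‖multiDeriv b β (φ n ⋆[lsmul ℝ ℝ] h) p - H β p‖ₑ ^ 2) :=
        lintegral_enorm_sub_sq_le
          (contDiff_multiDeriv b β hf).continuous.aestronglyMeasurable
          (contDiff_multiDeriv b β hsm).continuous.aestronglyMeasurable
    _ ≤ 2 * (ε / 4 + ε / 4) := by
        gcongr
        · exact hfe β hβ
        · rw [hder n β hβ]; exact hn β (by simpa using hβ)
    _ = ε := by
        rw [← two_mul, ← mul_assoc, show (2 * 2 : ℝ≥0∞) = 4 by norm_num]
        exact ENNReal.mul_div_cancel (by simp) (by simp)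

end Approx

/-! ### Slices and the norms of the statement -/

theorem multiDeriv_slice (β : Fin 2 → ℕ) {f : Plane × Plane → ℝ} (hf : ContDiff ℝ ∞ f)
    (y v : Plane) :
    multiDeriv xDir β (fun v => f (y, v)) v = multiDeriv vDir β f (y, v) := by
  have h := multiDeriv_comp_affine xDir (ContinuousLinearMap.inr ℝ Plane Plane) (y, 0) β hf
  have h2 : multiDeriv xDir β (fun v => f (y, v)) v =
      multiDeriv (fun i => (0, xDir i)) β f (y, v) := by simpa using congrFun h v
  exact h2

/-- Approximation at the geometric rate 2^{-n} makes the sum over n of the squared errors integrable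
in y. For almost every y that sum is finite, hence the errors on the slice tend to 0 along one and
the same sequence for all β. -/
theorem ae_isTestLimit_slice {k : ℕ} {H : (Fin 2 → ℕ) → Plane × Plane → ℝ}
    (hm : ∀ β, StronglyMeasurable (H β)) (hH : IsTestLimit vDir k H) :
    ∀ᵐ y : Plane, IsTestLimit xDir k (fun β v => H β (y, v)) := by
  choose! f hf hfc hfe using fun n : ℕ => hH ((2⁻¹ : ℝ≥0∞) ^ n) (by simp)
  have hmeas : ∀ n β, Measurable fun p : Plane × Plane =>
      ‖multiDeriv vDir β (f n) p - H β p‖ₑ ^ 2 := fun n β =>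
    ((contDiff_multiDeriv vDir β (hf n)).continuous.measurable.sub
      (hm β).measurable).enorm.pow_const 2
  have hae : ∀ᵐ y : Plane, ∀ β, multiLength β ≤ k →
      ∑' n, ∫⁻ v, ‖multiDeriv vDir β (f n) (y, v) - H β (y, v)‖ₑ ^ 2 < ⊤ := by
    rw [ae_all_iff]
    intro β
    by_cases hβ : multiLength β ≤ k
    swap
    · simp [hβ]
    simp only [hβ, forall_const]
    have hmy : ∀ n, Measurable fun y : Plane =>
        ∫⁻ v, ‖multiDeriv vDir β (f n) (y, v) - H β (y, v)‖ₑ ^ 2 := fun n =>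
      (hmeas n β).lintegral_prod_right'
    apply ae_lt_top (Measurable.tsum hmy)
    rw [lintegral_tsum fun n => (hmy n).aemeasurable]
    have : ∀ n, ∫⁻ y, ∫⁻ v, ‖multiDeriv vDir β (f n) (y, v) - H β (y, v)‖ₑ ^ 2 ≤
        (2⁻¹ : ℝ≥0∞) ^ n := by
      intro n
      rw [← lintegral_prod _ (hmeas n β).aemeasurable]
      exact hfe n β hβ
    refine ne_top_of_le_ne_top ?_ (ENNReal.tsum_le_tsum this)
    rw [ENNReal.tsum_geometric]
    simp
  filter_upwards [hae] with y hy ε hε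
  have hall : ∀ᶠ n in atTop, ∀ β ∈ multiIdx k,
      ∫⁻ v, ‖multiDeriv vDir β (f n) (y, v) - H β (y, v)‖ₑ ^ 2 ≤ ε := by
    rw [Filter.eventually_all_finset]
    intro β hβ
    exact ((ENNReal.tendsto_atTop_zero_of_tsum_ne_top
      (hy β (by simpa using hβ)).ne).eventually_lt_const (pos_iff_ne_zero.2 hε)).mono
      fun _ h => h.le
  obtain ⟨n, hn⟩ := hall.exists
  refine ⟨fun v => f n (y, v), (hf n).comp (contDiff_const.prodMk contDiff_id), ?_, fun β hβ => ?_⟩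
  -- The slice vanishes off the projection of the support to the velocities, which is compact.
  · refine HasCompactSupport.intro ((hfc n).image continuous_snd) fun v hv => ?_
    by_contra hne
    exact hv ⟨(y, v), subset_tsupport _ hne, rfl⟩
  · simp only [multiDeriv_slice β (hf n)]
    exact hn β (by simpa using hβ)

/-! ### Uniqueness of weak derivatives, and what finiteness of the norms provides. -/

theorem IsWeakDeriv.ae_eq {V : Type*} [NormedAddCommGroup V] [NormedSpace ℝ V] [MeasureSpace V]
    [BorelSpace V] [FiniteDimensional ℝ V] {b : Fin 2 → V} {β : Fin 2 → ℕ} {u g g' : V → ℝ}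
    (h : IsWeakDeriv b β u g) (h' : IsWeakDeriv b β u g') : g =ᵐ[volume] g' := by
  apply ae_eq_of_integral_contDiff_smul_eq h.2.1 h'.2.1
  intro ψ hψ hc
  have h1 := h.2.2 ψ hψ hc
  rw [h'.2.2 ψ hψ hc] at h1
  have := mul_left_cancel₀ (by simp) h1
  simpa [mul_comm] using this.symm

theorem IsWeakDeriv.congr {V : Type*} [NormedAddCommGroup V] [NormedSpace ℝ V] [MeasureSpace V]
    {b : Fin 2 → V} {β : Fin 2 → ℕ} {u g g' : V → ℝ}
    (h : IsWeakDeriv b β u g) (hg : g =ᵐ[volume] g') : IsWeakDeriv b β u g' := by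
  refine ⟨h.1, h.2.1.congr hg, fun ψ hψ hc => ?_⟩
  rw [h.2.2 ψ hψ hc]
  congr 1
  apply integral_congr_ae
  filter_upwards [hg] with x hx
  rw [hx]

theorem IsWeakDeriv.vDerivNorm_eq {β : Fin 2 → ℕ} {h g : Plane × Plane → ℝ}
    (hg : IsWeakDeriv vDir β h g) : vDerivNorm β h = eLpNorm g 2 volume := by
  apply le_antisymm
  · exact iInf₂_le g hg
  · exact le_iInf₂ fun g' hg' => (eLpNorm_congr_ae (hg.ae_eq hg')).le

theorem vDerivNorm_sq_le {k : ℕ} {β : Fin 2 → ℕ} (hβ : multiLength β ≤ k)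
    (h : Plane × Plane → ℝ) : vDerivNorm β h ^ 2 ≤ normL2xHv k h ^ 2 := by
  rw [normL2xHv, ← ENNReal.rpow_natCast (_ ^ _), ← ENNReal.rpow_mul]
  norm_num
  calc vDerivNorm β h ^ 2 ≤ ∑ β ∈ Finset.piAntidiag (Finset.univ : Finset (Fin 2)) (multiLength β),
        vDerivNorm β h ^ 2 :=
        Finset.single_le_sum (f := fun β => vDerivNorm β h ^ 2) (fun _ _ => bot_le)
          (by simp [multiLength])
    _ ≤ _ := Finset.single_le_sum
        (f := fun n => ∑ β ∈ Finset.piAntidiag (Finset.univ : Finset (Fin 2)) n,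
          vDerivNorm β h ^ 2) (fun _ _ => bot_le) (by simp; omega)

/-- A finite norm excludes an infimum over the empty set, so each weak derivative exists. Strongly
measurable representatives are chosen so that every slice is measurable. -/
theorem exists_weakDerivs {k : ℕ} {h : Plane × Plane → ℝ} (hk : normL2xHv k h < ⊤) :
    ∃ H : (Fin 2 → ℕ) → Plane × Plane → ℝ, (∀ β, StronglyMeasurable (H β)) ∧
      (H 0 =ᵐ[volume] h) ∧ ∀ β, multiLength β ≤ k →
        IsWeakDeriv vDir β h (H β) ∧ MemLp (H β) 2 ∧
          ∫⁻ p, ‖H β p‖ₑ ^ 2 ≤ normL2xHv k h ^ 2 := by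
  have key : ∀ β : Fin 2 → ℕ, ∃ g : Plane × Plane → ℝ, StronglyMeasurable g ∧
      (multiLength β ≤ k → IsWeakDeriv vDir β h g ∧ MemLp g 2 ∧
        ∫⁻ p, ‖g p‖ₑ ^ 2 ≤ normL2xHv k h ^ 2) := by
    intro β
    by_cases hβ : multiLength β ≤ k
    swap
    · exact ⟨0, stronglyMeasurable_zero, fun h => absurd h hβ⟩
    have hle := vDerivNorm_sq_le hβ h
    have hfin : vDerivNorm β h < ⊤ := by
      by_contra hcon
      rw [not_lt, top_le_iff] at hcon
      rw [hcon] at hle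
      have : normL2xHv k h ^ 2 < ⊤ := ENNReal.pow_lt_top hk
      simp at hle
      simp [hle] at hk
    obtain ⟨g, hg⟩ : ∃ g, IsWeakDeriv vDir β h g := by
      by_contra hcon
      push Not at hcon
      simp [vDerivNorm, hcon] at hfin
    have hae := hg.2.1.aestronglyMeasurable
    have hg' := hg.congr hae.ae_eq_mk
    refine ⟨hae.mk g, hae.stronglyMeasurable_mk, fun _ => ⟨hg', ?_, ?_⟩⟩
    · exact ⟨hae.stronglyMeasurable_mk.aestronglyMeasurable, by rwa [← hg'.vDerivNorm_eq]⟩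
    · rw [← eLpNorm_two_sq, ← hg'.vDerivNorm_eq]; exact hle
  choose H hm hH using key
  refine ⟨H, hm, ?_, hH⟩
  have h0 := (hH 0 (by simp)).1
  -- A function is its own weak derivative of order zero, so uniqueness identifies `H 0` with h.
  exact h0.ae_eq ⟨h0.1, h0.1, fun ψ _ _ => by simp⟩

end

end ScreenedVP

namespace ScreenedVP

noncomputable section

open Filter Topology

/-! ### Sobolev inequalities in the plane -/

/-- The square of the `H^k` norm of a family of functions, regarded as derivatives. -/
def sobSq (k : ℕ) (H : (Fin 2 → ℕ) → Plane → ℝ) : ℝ≥0∞ :=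
  ∑ β ∈ multiIdx k, ∫⁻ x, ‖H β x‖ₑ ^ 2

theorem lintegral_sq_le_sobSq {k : ℕ} (H : (Fin 2 → ℕ) → Plane → ℝ) {β : Fin 2 → ℕ}
    (hβ : multiLength β ≤ k) : ∫⁻ x, ‖H β x‖ₑ ^ 2 ≤ sobSq k H :=
  Finset.single_le_sum (f := fun β => ∫⁻ x, ‖H β x‖ₑ ^ 2) (fun _ _ => bot_le) (by simpa using hβ)

theorem enorm_fderiv_le (f : Plane → ℝ) (x : Plane) :
    ‖fderiv ℝ f x‖ₑ ≤ ‖dirDeriv (xDir 0) f x‖ₑ + ‖dirDeriv (xDir 1) f x‖ₑ := by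
  rw [← enorm_norm, ← enorm_norm (dirDeriv _ _ _), ← enorm_norm (dirDeriv (xDir 1) _ _),
    Real.enorm_eq_ofReal (norm_nonneg _), Real.enorm_eq_ofReal (norm_nonneg _),
    Real.enorm_eq_ofReal (norm_nonneg _), ← ENNReal.ofReal_add (norm_nonneg _) (norm_nonneg _)]
  apply ENNReal.ofReal_le_ofReal
  apply ContinuousLinearMap.opNorm_le_bound _ (by positivity)
  intro v
  have hv : v = v 0 • xDir 0 + v 1 • xDir 1 := by
    ext i; fin_cases i <;> simp [xDir]
  have h0 : ‖v 0‖ ≤ ‖v‖ := PiLp.norm_apply_le v 0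
  have h1 : ‖v 1‖ ≤ ‖v‖ := PiLp.norm_apply_le v 1
  calc ‖fderiv ℝ f x v‖ = ‖v 0 • dirDeriv (xDir 0) f x + v 1 • dirDeriv (xDir 1) f x‖ := by
        conv_lhs => rw [hv]
        simp [dirDeriv]
    _ ≤ ‖v 0‖ * ‖dirDeriv (xDir 0) f x‖ + ‖v 1‖ * ‖dirDeriv (xDir 1) f x‖ := by
        refine (norm_add_le _ _).trans ?_
        rw [norm_smul, norm_smul]
    _ ≤ ‖v‖ * ‖dirDeriv (xDir 0) f x‖ + ‖v‖ * ‖dirDeriv (xDir 1) f x‖ := by gcongr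
    _ = _ := by ring

theorem lintegral_enorm_fderiv_sq_le (f : Plane → ℝ) (hf : ContDiff ℝ ∞ f) :
    ∫⁻ x, ‖fderiv ℝ f x‖ₑ ^ 2 ≤ 2 * sobSq 1 (fun β => multiDeriv xDir β f) := by
  have hd : ∀ j, dirDeriv (xDir j) f = multiDeriv xDir (Pi.single j 1) f := by
    intro j
    have := multiDeriv_add_single xDir 0 j hf
    simpa using this.symm
  calc ∫⁻ x, ‖fderiv ℝ f x‖ₑ ^ 2
      ≤ ∫⁻ x, 2 * (‖dirDeriv (xDir 0) f x‖ₑ ^ 2 + ‖dirDeriv (xDir 1) f x‖ₑ ^ 2) := by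
        apply lintegral_mono
        intro x
        refine (pow_le_pow_left' (enorm_fderiv_le f x) 2).trans ?_
        have := enorm_add_sq_le |dirDeriv (xDir 0) f x| |dirDeriv (xDir 1) f x|
        simp only [Real.enorm_eq_ofReal_abs, abs_abs] at this ⊢
        rwa [abs_of_nonneg (by positivity), ENNReal.ofReal_add (abs_nonneg _) (abs_nonneg _)]
          at this
    _ = 2 * (∫⁻ x, ‖dirDeriv (xDir 0) f x‖ₑ ^ 2) + 2 * ∫⁻ x, ‖dirDeriv (xDir 1) f x‖ₑ ^ 2 := by
        have hm : Measurable fun x => ‖dirDeriv (xDir 0) f x‖ₑ ^ 2 :=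
          (contDiff_dirDeriv (xDir 0) hf).continuous.measurable.enorm.pow_const 2
        rw [lintegral_const_mul' _ _ (by simp), lintegral_add_left hm, mul_add]
    _ ≤ _ := by
        rw [← mul_add, hd, hd]
        gcongr
        have hne : (Pi.single 0 1 : Fin 2 → ℕ) ≠ Pi.single 1 1 := by
          intro h; have := congrFun h 0; simp at this
        rw [← Finset.sum_pair (f := fun β => ∫⁻ x, ‖multiDeriv xDir β f x‖ₑ ^ 2) hne]
        apply Finset.sum_le_sum_of_subset
        intro β hβ
        simp only [Finset.mem_insert, Finset.mem_singleton] at hβ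
        rcases hβ with rfl | rfl <;> simp

/-- The planar inequality ‖g‖_{L²} ≲ ‖∇g‖_{L¹} is applied to g = f^{m+2}. Since ∇g = (m+2) f^{m+1}
∇f, Cauchy-Schwarz bounds ‖∇g‖_{L¹}² by the previous power integral times ‖∇f‖_{L²}², which is an
induction on m. -/
theorem exists_lintegral_pow_le_test (m : ℕ) : ∃ C : ℝ≥0, ∀ f : Plane → ℝ, ContDiff ℝ ∞ f →
    HasCompactSupport f → ∫⁻ x, ‖f x‖ₑ ^ (2 * (m + 1)) ≤
      C * sobSq 1 (fun β => multiDeriv xDir β f) ^ (m + 1) := by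
  induction m with
  | zero =>
    refine ⟨1, fun f hf hc => ?_⟩
    have := lintegral_sq_le_sobSq (k := 1) (fun β => multiDeriv xDir β f) (β := 0) (by simp)
    simpa using this
  | succ m ih =>
    obtain ⟨C, hC⟩ := ih
    set K := lintegralPowLePowLIntegralFDerivConst (volume : Measure Plane) 2
    refine ⟨K * ((m + 2 : ℕ) ^ 2 * (C * 2)), fun f hf hc => ?_⟩
    set N := sobSq 1 (fun β => multiDeriv xDir β f)
    have hp : Real.HolderConjugate (Module.finrank ℝ Plane) 2 := by
      simpa using Real.HolderConjugate.two_two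
    have hpow : ContDiff ℝ 1 (fun x => f x ^ (m + 2)) := (hf.pow (m + 2)).of_le (by simp)
    have hpc : HasCompactSupport (fun x => f x ^ (m + 2)) :=
      hc.comp_left (g := fun y : ℝ => y ^ (m + 2)) (by simp)
    have hs := lintegral_pow_le_pow_lintegral_fderiv (volume : Measure Plane) hpow hpc hp
    have hder : ∀ x, ‖fderiv ℝ (fun x => f x ^ (m + 2)) x‖ₑ =
        ((m + 2 : ℕ) : ℝ≥0∞) * (‖f x‖ₑ ^ (m + 1) * ‖fderiv ℝ f x‖ₑ) := by
      intro x
      have h1 := ((hf.differentiable (by simp) x).hasFDerivAt.pow (m + 2)).fderiv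
      rw [h1, enorm_smul]
      simp only [nsmul_eq_mul, enorm_mul, enorm_pow]
      rw [mul_assoc]
      simp [← ofReal_norm]
      congr
      norm_cast
    calc ∫⁻ x, ‖f x‖ₑ ^ (2 * (m + 1 + 1)) = ∫⁻ x, ‖f x ^ (m + 2)‖ₑ ^ (2 : ℝ) := by
          congr 1; ext x
          rw [enorm_pow, ENNReal.rpow_two, ← pow_mul]; ring_nf
      _ ≤ K * (∫⁻ x, ((m + 2 : ℕ) : ℝ≥0∞) * (‖f x‖ₑ ^ (m + 1) * ‖fderiv ℝ f x‖ₑ)) ^ 2 := by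
          rw [← ENNReal.rpow_two]; simpa only [hder] using hs
      _ = K * (((m + 2 : ℕ) : ℝ≥0∞) ^ 2 * (∫⁻ x, ‖f x‖ₑ ^ (m + 1) * ‖fderiv ℝ f x‖ₑ) ^ 2) := by
          rw [lintegral_const_mul' _ _ (by simp), mul_pow]
      _ ≤ K * (((m + 2 : ℕ) : ℝ≥0∞) ^ 2 * ((∫⁻ x, ‖f x‖ₑ ^ (2 * (m + 1))) *
            ∫⁻ x, ‖fderiv ℝ f x‖ₑ ^ 2)) := by
          gcongr
          refine (sq_lintegral_mul_le (hf.continuous.measurable.enorm.pow_const _).aemeasurable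
            (hf.continuous_fderiv (by simp)).measurable.enorm.aemeasurable).trans (le_of_eq ?_)
          simp only [← pow_mul, mul_comm 2 (m + 1)]
      _ ≤ K * (((m + 2 : ℕ) : ℝ≥0∞) ^ 2 * ((C * N ^ (m + 1)) * (2 * N))) := by
          gcongr
          · exact hC f hf hc
          · exact lintegral_enorm_fderiv_sq_le f hf
      _ = _ := by push_cast; ring

/-! ### Families that are limits of test functions -/

theorem ae_tendsto_of_lintegral_sq_le {α : Type*} [MeasurableSpace α] {μ : Measure α}
    {u : ℕ → α → ℝ} {v : α → ℝ} (hu : ∀ n, AEStronglyMeasurable (u n) μ)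
    (hv : AEStronglyMeasurable v μ)
    (h : ∀ n, ∫⁻ x, ‖u n x - v x‖ₑ ^ 2 ∂μ ≤ (2⁻¹ : ℝ≥0∞) ^ n) :
    ∀ᵐ x ∂μ, Tendsto (fun n => u n x) atTop (𝓝 (v x)) := by
  have hm : ∀ n, AEMeasurable (fun x => ‖u n x - v x‖ₑ ^ 2) μ := fun n =>
    ((hu n).sub hv).enorm.pow_const 2
  have hfin : ∫⁻ x, ∑' n, ‖u n x - v x‖ₑ ^ 2 ∂μ ≠ ⊤ := by
    rw [lintegral_tsum hm]
    refine ne_top_of_le_ne_top ?_ (ENNReal.tsum_le_tsum h)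
    rw [ENNReal.tsum_geometric]
    simp
  filter_upwards [ae_lt_top' (AEMeasurable.tsum hm) hfin] with x hx
  have h0 := ENNReal.tendsto_atTop_zero_of_tsum_ne_top hx.ne
  have h1 : Tendsto (fun n => (‖u n x - v x‖ₑ ^ 2) ^ (1 / 2 : ℝ)) atTop (𝓝 0) := by
    have := ((ENNReal.continuous_rpow_const (y := 1 / 2)).tendsto 0).comp h0
    simpa [Function.comp_def] using this
  have h2 : ∀ n, (‖u n x - v x‖ₑ ^ 2) ^ (1 / 2 : ℝ) = ‖u n x - v x‖ₑ := by
    intro n; rw [← ENNReal.rpow_two, ← ENNReal.rpow_mul]; simp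
  simp only [h2] at h1
  rw [tendsto_iff_edist_tendsto_0]
  simpa [edist_eq_enorm_sub] using h1

theorem IsTestLimit.exists_seq {k : ℕ} {H : (Fin 2 → ℕ) → Plane → ℝ} (h : IsTestLimit xDir k H) :
    ∃ f : ℕ → Plane → ℝ, (∀ n, ContDiff ℝ ∞ (f n)) ∧ (∀ n, HasCompactSupport (f n)) ∧
      ∀ n β, multiLength β ≤ k →
        ∫⁻ p, ‖multiDeriv xDir β (f n) p - H β p‖ₑ ^ 2 ≤ (2⁻¹ : ℝ≥0∞) ^ n := by
  choose! f hf hfc hfe using fun n : ℕ => h ((2⁻¹ : ℝ≥0∞) ^ n) (by simp)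
  exact ⟨f, hf, hfc, hfe⟩

theorem lintegral_enorm_sq_le {α : Type*} [MeasurableSpace α] {μ : Measure α} {f g : α → ℝ}
    (hf : AEStronglyMeasurable f μ) (hg : AEStronglyMeasurable g μ) :
    ∫⁻ x, ‖f x‖ₑ ^ 2 ∂μ ≤ 2 * (∫⁻ x, ‖f x - g x‖ₑ ^ 2 ∂μ + ∫⁻ x, ‖g x‖ₑ ^ 2 ∂μ) := by
  simpa using lintegral_enorm_sub_sq_le (h := fun _ => 0) hf hg

theorem tendsto_inv_two_pow : Tendsto (fun n : ℕ => (2⁻¹ : ℝ≥0∞) ^ n) atTop (𝓝 0) :=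
  ENNReal.tendsto_pow_atTop_nhds_zero_of_lt_one (by simp)

theorem multiDeriv_multiDeriv {V : Type*} [NormedAddCommGroup V] [NormedSpace ℝ V]
    (b : Fin 2 → V) (α β : Fin 2 → ℕ) {f : V → ℝ} (hf : ContDiff ℝ ∞ f) :
    multiDeriv b α (multiDeriv b β f) = multiDeriv b (β + α) f := by
  induction α using multiIndex_induction with
  | zero => rfl
  | succ α j ih =>
    rw [multiDeriv_add_single _ _ _ (contDiff_multiDeriv b β hf), ih, ← add_assoc,
      multiDeriv_add_single _ _ _ hf]

/-- The inequality for test functions passes to the limit by Fatou along an almost everywhere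
convergent sequence. One order of differentiability is kept in reserve because `H β` itself must be
in H¹. -/
theorem exists_lintegral_pow_le (m k : ℕ) : ∃ C : ℝ≥0, ∀ H : (Fin 2 → ℕ) → Plane → ℝ,
    (∀ β, AEStronglyMeasurable (H β)) → IsTestLimit xDir k H →
    ∀ β, multiLength β + 1 ≤ k →
      ∫⁻ x, ‖H β x‖ₑ ^ (2 * (m + 1)) ≤ C * sobSq k H ^ (m + 1) := by
  obtain ⟨C, hC⟩ := exists_lintegral_pow_le_test m
  set c := (multiIdx 1).card
  -- The 2 comes from splitting ‖∂f_n‖² around its limit, c from bounding each of the terms of the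
  -- H¹ norm by the whole H^k norm.
  refine ⟨C * (2 * c) ^ (m + 1), fun H hm hH β hβ => ?_⟩
  obtain ⟨f, hf, hfc, hfe⟩ := hH.exists_seq
  have hfm : ∀ n β, AEStronglyMeasurable (multiDeriv xDir β (f n)) volume := fun n β =>
    (contDiff_multiDeriv xDir β (hf n)).continuous.aestronglyMeasurable
  have hlim := ae_tendsto_of_lintegral_sq_le (fun n => hfm n β) (hm β)
    (fun n => hfe n β (by omega))
  have hN : ∀ n, sobSq 1 (fun γ => multiDeriv xDir γ (multiDeriv xDir β (f n))) ≤
      2 * c * ((2⁻¹ : ℝ≥0∞) ^ n + sobSq k H) := by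
    intro n
    calc sobSq 1 (fun γ => multiDeriv xDir γ (multiDeriv xDir β (f n)))
        ≤ ∑ γ ∈ multiIdx 1, 2 * ((2⁻¹ : ℝ≥0∞) ^ n + sobSq k H) := by
          apply Finset.sum_le_sum
          intro γ hγ
          have hγ' : multiLength (β + γ) ≤ k := by
            rw [multiLength_add]; simp at hγ; omega
          simp only [multiDeriv_multiDeriv _ _ _ (hf n)]
          refine (lintegral_enorm_sq_le (hfm n _) (hm (β + γ))).trans ?_
          gcongr
          · exact hfe n _ hγ'
          · exact lintegral_sq_le_sobSq H hγ'
      _ = _ := by rw [Finset.sum_const, nsmul_eq_mul]; ring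
  calc ∫⁻ x, ‖H β x‖ₑ ^ (2 * (m + 1))
      = ∫⁻ x, liminf (fun n => ‖multiDeriv xDir β (f n) x‖ₑ ^ (2 * (m + 1))) atTop := by
        apply lintegral_congr_ae
        filter_upwards [hlim] with x hx
        exact ((((ENNReal.continuous_pow _).tendsto _).comp hx.enorm).liminf_eq).symm
    _ ≤ liminf (fun n => ∫⁻ x, ‖multiDeriv xDir β (f n) x‖ₑ ^ (2 * (m + 1))) atTop :=
        lintegral_liminf_le' fun n => (hfm n β).enorm.pow_const _
    _ ≤ liminf (fun n => C * (2 * c * ((2⁻¹ : ℝ≥0∞) ^ n + sobSq k H)) ^ (m + 1)) atTop := by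
        refine liminf_le_liminf (Eventually.of_forall fun n => ?_)
        refine (hC _ (contDiff_multiDeriv xDir β (hf n))
          (hasCompactSupport_multiDeriv xDir β (hfc n))).trans ?_
        gcongr
        exact hN n
    _ = C * (2 * c * (0 + sobSq k H)) ^ (m + 1) := by
        apply Tendsto.liminf_eq
        apply ENNReal.Tendsto.const_mul _ (Or.inr (by simp))
        apply ((ENNReal.continuous_pow _).tendsto _).comp
        exact ENNReal.Tendsto.const_mul (tendsto_inv_two_pow.add_const _)
          (Or.inr (ENNReal.mul_ne_top (by simp) (by simp)))
    _ = _ := by push_cast; ring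

/-- Products of `L²`-convergent sequences converge in `L¹`. -/
theorem tendsto_lintegral_mul_sub_mul {α : Type*} [MeasurableSpace α] {μ : Measure α}
    {u w : ℕ → α → ℝ} {v z : α → ℝ} (hu : ∀ n, AEStronglyMeasurable (u n) μ)
    (hw : ∀ n, AEStronglyMeasurable (w n) μ)
    (hv : AEStronglyMeasurable v μ) (hz : AEStronglyMeasurable z μ)
    (hv2 : ∫⁻ x, ‖v x‖ₑ ^ 2 ∂μ ≠ ⊤) (hz2 : ∫⁻ x, ‖z x‖ₑ ^ 2 ∂μ ≠ ⊤)
    (huv : Tendsto (fun n => ∫⁻ x, ‖u n x - v x‖ₑ ^ 2 ∂μ) atTop (𝓝 0))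
    (hwz : Tendsto (fun n => ∫⁻ x, ‖w n x - z x‖ₑ ^ 2 ∂μ) atTop (𝓝 0)) :
    Tendsto (fun n => ∫⁻ x, ‖u n x * w n x - v x * z x‖ₑ ∂μ) atTop (𝓝 0) := by
  have hol : ∀ f g : α → ℝ, AEStronglyMeasurable f μ → AEStronglyMeasurable g μ →
      ∫⁻ x, ‖f x‖ₑ * ‖g x‖ₑ ∂μ ≤
        (∫⁻ x, ‖f x‖ₑ ^ 2 ∂μ) ^ (1 / 2 : ℝ) * (∫⁻ x, ‖g x‖ₑ ^ 2 ∂μ) ^ (1 / 2 : ℝ) := by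
    intro f g hf hg
    have := ENNReal.lintegral_mul_le_Lp_mul_Lq μ Real.HolderConjugate.two_two hf.enorm hg.enorm
    simpa using this
  have hs : ∀ {a : ℕ → ℝ≥0∞}, Tendsto a atTop (𝓝 0) →
      Tendsto (fun n => a n ^ (1 / 2 : ℝ)) atTop (𝓝 0) := by
    intro a ha
    have := ((ENNReal.continuous_rpow_const (y := 1 / 2)).tendsto 0).comp ha
    simpa [Function.comp_def] using this
  have hbound : ∀ n, ∫⁻ x, ‖u n x * w n x - v x * z x‖ₑ ∂μ ≤
      (∫⁻ x, ‖u n x - v x‖ₑ ^ 2 ∂μ) ^ (1 / 2 : ℝ) *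
        (∫⁻ x, ‖w n x - z x‖ₑ ^ 2 ∂μ) ^ (1 / 2 : ℝ) +
      (∫⁻ x, ‖u n x - v x‖ₑ ^ 2 ∂μ) ^ (1 / 2 : ℝ) * (∫⁻ x, ‖z x‖ₑ ^ 2 ∂μ) ^ (1 / 2 : ℝ) +
      (∫⁻ x, ‖v x‖ₑ ^ 2 ∂μ) ^ (1 / 2 : ℝ) * (∫⁻ x, ‖w n x - z x‖ₑ ^ 2 ∂μ) ^ (1 / 2 : ℝ) := by
    intro n
    calc ∫⁻ x, ‖u n x * w n x - v x * z x‖ₑ ∂μ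
        ≤ ∫⁻ x, (‖u n x - v x‖ₑ * ‖w n x - z x‖ₑ + ‖u n x - v x‖ₑ * ‖z x‖ₑ +
            ‖v x‖ₑ * ‖w n x - z x‖ₑ) ∂μ := by
          apply lintegral_mono
          intro x
          simp only [← enorm_mul]
          -- Expanding around the limits leaves only terms with at least one factor that tends to 0.
          have : u n x * w n x - v x * z x = (u n x - v x) * (w n x - z x) +
            (u n x - v x) * z x + v x * (w n x - z x) := by ring
          rw [this]
          exact (enorm_add_le _ _).trans (add_le_add_left (enorm_add_le _ _) _)
      _ = ∫⁻ x, ‖u n x - v x‖ₑ * ‖w n x - z x‖ₑ ∂μ + ∫⁻ x, ‖u n x - v x‖ₑ * ‖z x‖ₑ ∂μ +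
            ∫⁻ x, ‖v x‖ₑ * ‖w n x - z x‖ₑ ∂μ := by
          have h1 : AEMeasurable (fun x => ‖u n x - v x‖ₑ * ‖w n x - z x‖ₑ) μ :=
            ((hu n).sub hv).enorm.mul ((hw n).sub hz).enorm
          have h2 : AEMeasurable (fun x => ‖u n x - v x‖ₑ * ‖z x‖ₑ) μ :=
            ((hu n).sub hv).enorm.mul hz.enorm
          rw [← lintegral_add_left' h1, ← lintegral_add_left' (h1.fun_add h2)]
      _ ≤ _ := by
          gcongr
          · exact hol _ _ ((hu n).sub hv) ((hw n).sub hz)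
          · exact hol _ _ ((hu n).sub hv) hz
          · exact hol _ _ hv ((hw n).sub hz)
  refine tendsto_of_tendsto_of_tendsto_of_le_of_le tendsto_const_nhds ?_ (fun _ => bot_le) hbound
  have h1 := ENNReal.Tendsto.mul (hs huv) (Or.inr (by simp)) (hs hwz) (Or.inr (by simp))
  have h2 := ENNReal.Tendsto.mul_const (b := (∫⁻ x, ‖z x‖ₑ ^ 2 ∂μ) ^ (1 / 2 : ℝ)) (hs huv)
    (Or.inr (ENNReal.rpow_ne_top_of_nonneg (by norm_num) hz2))
  have h3 := ENNReal.Tendsto.const_mul (a := (∫⁻ x, ‖v x‖ₑ ^ 2 ∂μ) ^ (1 / 2 : ℝ)) (hs hwz)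
    (Or.inr (ENNReal.rpow_ne_top_of_nonneg (by norm_num) hv2))
  simpa using (h1.add h2).add h3

theorem integrable_mul_of_sq {α : Type*} [MeasurableSpace α] {μ : Measure α} {f g : α → ℝ}
    (hf : AEStronglyMeasurable f μ) (hg : AEStronglyMeasurable g μ)
    (hf2 : ∫⁻ x, ‖f x‖ₑ ^ 2 ∂μ ≠ ⊤) (hg2 : ∫⁻ x, ‖g x‖ₑ ^ 2 ∂μ ≠ ⊤) :
    Integrable (fun x => f x * g x) μ := by
  have key : ∀ h : α → ℝ, AEStronglyMeasurable h μ → ∫⁻ x, ‖h x‖ₑ ^ 2 ∂μ ≠ ⊤ → MemLp h 2 μ := by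
    intro h hm h2
    refine ⟨hm, ?_⟩
    rw [← eLpNorm_two_sq] at h2
    by_contra hcon
    rw [not_lt, top_le_iff] at hcon
    simp [hcon] at h2
  exact (key f hf hf2).integrable_mul (key g hg hg2)

theorem integrable_list_sum {ι : Type*} {α : Type*} [MeasurableSpace α] {μ : Measure α}
    (s : List ι) (f : ι → α → ℝ) (h : ∀ i ∈ s, Integrable (f i) μ) :
    Integrable (fun x => (s.map fun i => f i x).sum) μ := by
  simp only [← memLp_one_iff_integrable] at h ⊢
  exact memLp_list_sum s f h

theorem integral_list_sum {ι : Type*} {α : Type*} [MeasurableSpace α] {μ : Measure α}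
    (s : List ι) (f : ι → α → ℝ) (h : ∀ i ∈ s, Integrable (f i) μ) :
    ∫ x, (s.map fun i => f i x).sum ∂μ = (s.map fun i => ∫ x, f i x ∂μ).sum := by
  induction s with
  | nil => simp
  | cons i s ih =>
    simp only [List.map_cons, List.sum_cons]
    rw [integral_add (h i (by simp)) (integrable_list_sum s f fun i hi => h i (by simp [hi])),
      ih fun i hi => h i (by simp [hi])]

/-- The weak Leibniz rule for the square of a limit of test functions. -/
theorem IsTestLimit.integral_sq_mul_multiDeriv {k : ℕ} {H : (Fin 2 → ℕ) → Plane → ℝ}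
    (hH : IsTestLimit xDir k H) (hm : ∀ β, AEStronglyMeasurable (H β))
    (hfin : sobSq k H ≠ ⊤) {β : Fin 2 → ℕ} (hβ : multiLength β ≤ k)
    {s : List ((Fin 2 → ℕ) × (Fin 2 → ℕ))} (hs : ∀ p ∈ s, p.1 + p.2 = β)
    (hleib : ∀ f g : Plane → ℝ, ContDiff ℝ ∞ f → ContDiff ℝ ∞ g →
      multiDeriv xDir β (fun x => f x * g x) =
        fun x => (s.map fun p => multiDeriv xDir p.1 f x * multiDeriv xDir p.2 g x).sum)
    {ψ : Plane → ℝ} (hψ : ContDiff ℝ ∞ ψ) (hc : HasCompactSupport ψ) :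
    ∫ x, H 0 x ^ 2 * multiDeriv xDir β ψ x =
      (-1) ^ multiLength β * ∫ x, (s.map fun p => H p.1 x * H p.2 x).sum * ψ x := by
  obtain ⟨f, hf, hfc, hfe⟩ := hH.exists_seq
  have hfm : ∀ n β, AEStronglyMeasurable (multiDeriv xDir β (f n)) volume := fun n β =>
    (contDiff_multiDeriv xDir β (hf n)).continuous.aestronglyMeasurable
  have h2 : ∀ γ, multiLength γ ≤ k → ∫⁻ x, ‖H γ x‖ₑ ^ 2 ≠ ⊤ := fun γ hγ =>
    ne_top_of_le_ne_top hfin (lintegral_sq_le_sobSq H hγ)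
  have hconv : ∀ γ, multiLength γ ≤ k →
      Tendsto (fun n => ∫⁻ x, ‖multiDeriv xDir γ (f n) x - H γ x‖ₑ ^ 2) atTop (𝓝 0) := fun γ hγ =>
    tendsto_of_tendsto_of_tendsto_of_le_of_le tendsto_const_nhds tendsto_inv_two_pow
      (fun _ => bot_le) fun n => hfe n γ hγ
  have hs1 : ∀ p ∈ s, multiLength p.1 ≤ k := by
    intro p hp
    have := congrArg multiLength (hs p hp)
    rw [multiLength_add] at this
    omega
  have hs2 : ∀ p ∈ s, multiLength p.2 ≤ k := by
    intro p hp
    have := congrArg multiLength (hs p hp)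
    rw [multiLength_add] at this
    omega
  -- L² convergence of both factors gives L¹ convergence of the product, which may be tested against
  -- a bounded function.
  have key : ∀ γ γ' : Fin 2 → ℕ, multiLength γ ≤ k → multiLength γ' ≤ k → ∀ χ : Plane → ℝ,
      Continuous χ → HasCompactSupport χ →
      Tendsto (fun n => ∫ x, multiDeriv xDir γ (f n) x * multiDeriv xDir γ' (f n) x * χ x) atTop
        (𝓝 (∫ x, H γ x * H γ' x * χ x)) := by
    intro γ γ' hγ hγ' χ hχ hχc
    obtain ⟨M, hM⟩ := hχc.exists_bound_of_continuous hχ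
    apply tendsto_integral_of_L1
    · exact ((hm γ).mul (hm γ')).mul hχ.aestronglyMeasurable
    · refine Eventually.of_forall fun n => ?_
      exact (((contDiff_multiDeriv xDir γ (hf n)).continuous.mul
        (contDiff_multiDeriv xDir γ' (hf n)).continuous).mul
          hχ).integrable_of_hasCompactSupport hχc.mul_left
    · have hl := tendsto_lintegral_mul_sub_mul (fun n => hfm n γ) (fun n => hfm n γ') (hm γ)
        (hm γ') (h2 γ hγ) (h2 γ' hγ') (hconv γ hγ) (hconv γ' hγ')
      have hl' := ENNReal.Tendsto.mul_const (b := ENNReal.ofReal M) hl (Or.inr (by simp))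
      rw [zero_mul] at hl'
      refine tendsto_of_tendsto_of_tendsto_of_le_of_le tendsto_const_nhds hl' (fun _ => bot_le) ?_
      intro n
      simp only
      rw [← lintegral_mul_const' _ _ (by simp)]
      apply lintegral_mono
      intro x
      simp only
      rw [← sub_mul, enorm_mul]
      gcongr
      rw [← ofReal_norm]
      exact ENNReal.ofReal_le_ofReal (hM x)
  have hL := key 0 0 (by simp) (by simp) (multiDeriv xDir β ψ)
    (contDiff_multiDeriv xDir β hψ).continuous (hasCompactSupport_multiDeriv xDir β hc)
  have hR : Tendsto (fun n => (-1) ^ multiLength β * (s.map fun p => ∫ x,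
      multiDeriv xDir p.1 (f n) x * multiDeriv xDir p.2 (f n) x * ψ x).sum) atTop
      (𝓝 ((-1) ^ multiLength β * (s.map fun p => ∫ x, H p.1 x * H p.2 x * ψ x).sum)) := by
    apply Tendsto.const_mul
    clear hleib hs
    induction s with
    | nil => simp
    | cons p s ih =>
      simp only [List.map_cons, List.sum_cons]
      exact (key p.1 p.2 (hs1 p (by simp)) (hs2 p (by simp)) ψ hψ.continuous hc).add
        (ih (fun p hp => hs1 p (by simp [hp])) (fun p hp => hs2 p (by simp [hp])))
  have heq : ∀ n, ∫ x, multiDeriv xDir 0 (f n) x * multiDeriv xDir 0 (f n) x *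
      multiDeriv xDir β ψ x = (-1) ^ multiLength β * (s.map fun p => ∫ x,
      multiDeriv xDir p.1 (f n) x * multiDeriv xDir p.2 (f n) x * ψ x).sum := by
    intro n
    have h1 := integral_mul_multiDeriv xDir β ((hf n).mul (hf n)) hψ hc
    simp only [multiDeriv_zero]
    rw [h1, hleib _ _ (hf n) (hf n)]
    congr 1
    simp only [← List.sum_map_mul_right]
    apply integral_list_sum s
      (fun p x => multiDeriv xDir p.1 (f n) x * multiDeriv xDir p.2 (f n) x * ψ x)
    intro p _
    exact (((contDiff_multiDeriv xDir p.1 (hf n)).continuous.mul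
        (contDiff_multiDeriv xDir p.2 (hf n)).continuous).mul
          hψ.continuous).integrable_of_hasCompactSupport hc.mul_left
  simp only [heq] at hL
  have := tendsto_nhds_unique hL hR
  simp only [sq]
  rw [this]
  congr 1
  simp only [← List.sum_map_mul_right]
  symm
  apply integral_list_sum s (fun p x => H p.1 x * H p.2 x * ψ x)
  intro p hp
  obtain ⟨M, hM⟩ := hc.exists_bound_of_continuous hψ.continuous
  exact (integrable_mul_of_sq (hm p.1) (hm p.2) (h2 _ (hs1 p hp)) (h2 _ (hs2 p hp))).mul_bdd (c := M)
    hψ.continuous.aestronglyMeasurable (Eventually.of_forall hM)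

end

end ScreenedVP

namespace ScreenedVP

noncomputable section

open Filter Topology

/-! ### A Hölder estimate for squares of `H²` functions in the plane -/

/-- The point with `i`-th coordinate `s` and other coordinate `r`. -/
def coordPt (i : Fin 2) (s r : ℝ) : Plane := s • xDir i + r • xDir (i + 1)

theorem measurePreserving_coordPt (i : Fin 2) :
    MeasurePreserving (fun q : ℝ × ℝ => coordPt i q.1 q.2) := by
  have h1 : MeasurePreserving (fun q : ℝ × ℝ => coordPt 0 q.1 q.2) := by
    have h := (PiLp.volume_preserving_toLp (Fin 2)).comp
      (volume_preserving_finTwoArrow ℝ).symm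
    have h3 : (fun q : ℝ × ℝ => coordPt 0 q.1 q.2) =
        (WithLp.toLp 2 ∘ ⇑(MeasurableEquiv.finTwoArrow (α := ℝ)).symm) := by
      funext q
      ext j
      fin_cases j <;> simp [coordPt, xDir, MeasurableEquiv.finTwoArrow]
    exact h3 ▸ h
  fin_cases i
  · exact h1
  · have h2 := h1.comp (Measure.measurePreserving_swap (μ := (volume : Measure ℝ))
      (ν := (volume : Measure ℝ)))
    have h3 : (fun q : ℝ × ℝ => coordPt 1 q.1 q.2) =
        (fun q : ℝ × ℝ => coordPt 0 q.1 q.2) ∘ Prod.swap := by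
      funext q
      simp [coordPt, add_comm]
    exact h3 ▸ h2

theorem lintegral_coordPt (i : Fin 2) {g : Plane → ℝ≥0∞} (hg : Measurable g) :
    ∫⁻ x, g x = ∫⁻ s, ∫⁻ r, g (coordPt i s r) := by
  rw [← (measurePreserving_coordPt i).lintegral_comp hg]
  exact lintegral_prod _ (hg.comp (measurePreserving_coordPt i).measurable).aemeasurable

theorem norm_xDir (i : Fin 2) : ‖xDir i‖ = 1 := by simp [xDir]

theorem hasDerivAt_line {w : Plane → ℝ} (hw : ContDiff ℝ ∞ w) (p e : Plane) (s : ℝ) :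
    HasDerivAt (fun s : ℝ => w (p + s • e)) (dirDeriv e w (p + s • e)) s := by
  have h1 : HasDerivAt (fun s : ℝ => p + s • e) e s := by
    simpa using ((hasDerivAt_id s).smul_const e).const_add p
  exact (hw.differentiable (by simp) (p + s • e)).hasFDerivAt.comp_hasDerivAt s h1

theorem enorm_le_lintegral_line {w : Plane → ℝ} (hw : ContDiff ℝ ∞ w) (hc : HasCompactSupport w)
    (p : Plane) {e : Plane} (he : ‖e‖ = 1) (s : ℝ) :
    ‖w (p + s • e)‖ₑ ≤ ∫⁻ s' : ℝ, ‖dirDeriv e w (p + s' • e)‖ₑ := by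
  have hiso : Isometry (fun s : ℝ => p + s • e) := by
    refine Isometry.of_dist_eq fun s s' => ?_
    rw [dist_add_left, dist_eq_norm, ← sub_smul, norm_smul, he, mul_one, Real.dist_eq,
      Real.norm_eq_abs]
  have hsm : ContDiff ℝ 1 (fun s : ℝ => w (p + s • e)) :=
    (hw.of_le (by simp)).comp (by fun_prop : ContDiff ℝ 1 fun s : ℝ => p + s • e)
  have h := HasCompactSupport.enorm_le_lintegral_Ici_deriv hsm
    (hc.comp_isClosedEmbedding hiso.isClosedEmbedding) s
  refine h.trans ((setLIntegral_le_lintegral _ _).trans (le_of_eq ?_))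
  congr 1; ext s'
  rw [(hasDerivAt_line hw p e s').deriv]

theorem enorm_sub_le_lintegral_line {w : Plane → ℝ} (hw : ContDiff ℝ ∞ w) (p e : Plane)
    (a c : ℝ) :
    ‖w (p + a • e) - w (p + c • e)‖ₑ ≤ ∫⁻ s in uIoc c a, ‖dirDeriv e w (p + s • e)‖ₑ := by
  have hcont : Continuous fun s : ℝ => dirDeriv e w (p + s • e) :=
    (contDiff_dirDeriv e hw).continuous.comp (by fun_prop)
  rw [← intervalIntegral.integral_eq_sub_of_hasDerivAt
    (fun s _ => hasDerivAt_line hw p e s) (hcont.intervalIntegrable _ _),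
    ← enorm_norm, intervalIntegral.norm_intervalIntegral_eq, enorm_norm]
  exact enorm_integral_le_lintegral_enorm _

theorem lintegral_mul_le_sqrt {α : Type*} [MeasurableSpace α] {μ : Measure α} {f g : α → ℝ≥0∞}
    (hf : AEMeasurable f μ) (hg : AEMeasurable g μ) :
    ∫⁻ x, f x * g x ∂μ ≤
      (∫⁻ x, f x ^ 2 ∂μ) ^ (1 / 2 : ℝ) * (∫⁻ x, g x ^ 2 ∂μ) ^ (1 / 2 : ℝ) := by
  simpa using ENNReal.lintegral_mul_le_Lp_mul_Lq μ Real.HolderConjugate.two_two hf hg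

theorem coordPt_eq_left (i : Fin 2) (s r : ℝ) : coordPt i s r = r • xDir (i + 1) + s • xDir i :=
  add_comm _ _

/-- On a line in direction i, u² is at most the integral of |∂_i(u²)| = 2|u ∂_i u|. Integrating over
the transverse variable and applying Cauchy-Schwarz bounds the mass of u² on each cross-section
uniformly; the width of the strip is the remaining factor. -/
theorem lintegral_strip_sq_le {u : Plane → ℝ} (hu : ContDiff ℝ ∞ u) (hc : HasCompactSupport u)
    (i : Fin 2) (I : Set ℝ) :
    ∫⁻ s in I, ∫⁻ r, ‖u (coordPt i s r)‖ₑ ^ 2 ≤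
      2 * ((∫⁻ x, ‖u x‖ₑ ^ 2) ^ (1 / 2 : ℝ) *
        (∫⁻ x, ‖dirDeriv (xDir i) u x‖ₑ ^ 2) ^ (1 / 2 : ℝ)) * volume I := by
  have hdm : Measurable (dirDeriv (xDir i) u) := (contDiff_dirDeriv (xDir i) hu).continuous.measurable
  have hum : Measurable u := hu.continuous.measurable
  have hd : ∀ x, dirDeriv (xDir i) (fun x => u x * u x) x = 2 * (u x * dirDeriv (xDir i) u x) := by
    intro x; rw [dirDeriv_mul _ hu hu]; ring
  rw [← setLIntegral_const]
  apply lintegral_mono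
  intro s
  have hm1 : Measurable fun x => 2 * (‖u x‖ₑ * ‖dirDeriv (xDir i) u x‖ₑ) :=
    (hum.enorm.mul hdm.enorm).const_mul 2
  calc ∫⁻ r, ‖u (coordPt i s r)‖ₑ ^ 2
      ≤ ∫⁻ r, ∫⁻ s', 2 * (‖u (coordPt i s' r)‖ₑ * ‖dirDeriv (xDir i) u (coordPt i s' r)‖ₑ) := by
        apply lintegral_mono
        intro r
        have h := enorm_le_lintegral_line (hu.mul hu) hc.mul_left (r • xDir (i + 1))
          (norm_xDir i) s
        simp only [hd, ← coordPt_eq_left, enorm_mul] at h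
        simpa [sq, ← ofReal_norm] using h
    _ = ∫⁻ x, 2 * (‖u x‖ₑ * ‖dirDeriv (xDir i) u x‖ₑ) := by
        rw [lintegral_coordPt i hm1]
        symm
        apply lintegral_lintegral_swap
        exact (hm1.comp (measurePreserving_coordPt i).measurable).aemeasurable
    _ ≤ _ := by
        rw [lintegral_const_mul' _ _ (by simp)]
        beta_reduce
        gcongr
        exact lintegral_mul_le_sqrt hum.enorm.aemeasurable hdm.enorm.aemeasurable

/-- Interpolation by parts: ∫ |∂u|² = -∫ u ∂²u, followed by Cauchy-Schwarz. -/
theorem lintegral_dirDeriv_sq_le {u : Plane → ℝ} (hu : ContDiff ℝ ∞ u) (hc : HasCompactSupport u)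
    (e : Plane) :
    ∫⁻ x, ‖dirDeriv e u x‖ₑ ^ 2 ≤ (∫⁻ x, ‖u x‖ₑ ^ 2) ^ (1 / 2 : ℝ) *
      (∫⁻ x, ‖dirDeriv e (dirDeriv e u) x‖ₑ ^ 2) ^ (1 / 2 : ℝ) := by
  have hd := contDiff_dirDeriv e hu
  have hdd := contDiff_dirDeriv e hd
  have h := integral_mul_dirDeriv e hd hu hc
  have hint : Integrable fun x => dirDeriv e u x * dirDeriv e u x :=
    (hd.continuous.mul hd.continuous).integrable_of_hasCompactSupport
      (hasCompactSupport_dirDeriv e hc).mul_left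
  calc ∫⁻ x, ‖dirDeriv e u x‖ₑ ^ 2
      = ∫⁻ x, ENNReal.ofReal (dirDeriv e u x * dirDeriv e u x) := by
        congr 1; ext x
        rw [Real.enorm_eq_ofReal_abs, ← ENNReal.ofReal_pow (abs_nonneg _), sq_abs, sq]
    _ = ENNReal.ofReal (∫ x, dirDeriv e u x * dirDeriv e u x) := by
        rw [ofReal_integral_eq_lintegral_ofReal hint
          (Eventually.of_forall fun x => mul_self_nonneg _)]
    _ ≤ ‖∫ x, dirDeriv e (dirDeriv e u) x * u x‖ₑ := by
        rw [h, Real.enorm_eq_ofReal_abs]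
        exact ENNReal.ofReal_le_ofReal (neg_le_abs _)
    _ ≤ ∫⁻ x, ‖dirDeriv e (dirDeriv e u) x * u x‖ₑ := enorm_integral_le_lintegral_enorm _
    _ = ∫⁻ x, ‖u x‖ₑ * ‖dirDeriv e (dirDeriv e u) x‖ₑ := by
        congr 1; ext x; rw [enorm_mul, mul_comm]
    _ ≤ _ := lintegral_mul_le_sqrt hu.continuous.measurable.enorm.aemeasurable
        hdd.continuous.measurable.enorm.aemeasurable

theorem dirDeriv_eq_multiDeriv (j : Fin 2) {f : Plane → ℝ} (hf : ContDiff ℝ ∞ f) :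
    dirDeriv (xDir j) f = multiDeriv xDir (Pi.single j 1) f := by
  simpa using (multiDeriv_add_single xDir 0 j hf).symm

theorem dirDeriv_dirDeriv_eq_multiDeriv (i j : Fin 2) {f : Plane → ℝ} (hf : ContDiff ℝ ∞ f) :
    dirDeriv (xDir i) (dirDeriv (xDir j) f) =
      multiDeriv xDir (Pi.single j 1 + Pi.single i 1) f := by
  rw [dirDeriv_eq_multiDeriv j hf, ← multiDeriv_add_single _ _ _ hf]

/-- The increment of f² along a segment I in direction i is the integral of ∂_i(f²), and each value
of ∂_i(f²) is bounded by the integral of its j-derivative over a full transverse line. So ∂_j∂_i(f²)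
= 2(f ∂_j∂_i f + ∂_j f ∂_i f) is integrated over the strip I × ℝ, and the smallness |I|^{1/2} comes
from Cauchy-Schwarz and the strip estimate. -/
theorem enorm_sq_sub_sq_coordPt_le {f : Plane → ℝ} (hf : ContDiff ℝ ∞ f)
    (hc : HasCompactSupport f) (i : Fin 2) (a c r : ℝ) :
    ‖f (coordPt i a r) ^ 2 - f (coordPt i c r) ^ 2‖ₑ ≤
      8 * (‖a - c‖ₑ ^ (1 / 2 : ℝ) * (∫⁻ x, ‖f x‖ₑ ^ 2) ^ (1 / 4 : ℝ) *
        sobSq 2 (fun β => multiDeriv xDir β f) ^ (3 / 4 : ℝ)) := by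
  set A := ∫⁻ x, ‖f x‖ₑ ^ 2
  set N := sobSq 2 (fun β => multiDeriv xDir β f)
  set d := ‖a - c‖ₑ
  set ei := xDir i
  set ej := xDir (i + 1)
  set I := uIoc c a
  have hvol : volume I = d := by
    simp only [I, d, uIoc, Real.volume_Ioc, max_sub_min_eq_abs, Real.enorm_eq_ofReal_abs]
  have hfm : Measurable f := hf.continuous.measurable
  have hi := contDiff_dirDeriv ei hf
  have hj := contDiff_dirDeriv ej hf
  have hji := contDiff_dirDeriv ej hi
  have hNf : ∫⁻ x, ‖f x‖ₑ ^ 2 ≤ N :=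
    lintegral_sq_le_sobSq (k := 2) (fun β => multiDeriv xDir β f) (β := 0) (by simp)
  have hN1 : ∀ l, ∫⁻ x, ‖dirDeriv (xDir l) f x‖ₑ ^ 2 ≤ N := by
    intro l
    rw [dirDeriv_eq_multiDeriv l hf]
    exact lintegral_sq_le_sobSq (fun β => multiDeriv xDir β f) (by simp)
  have hN2 : ∀ l m, ∫⁻ x, ‖dirDeriv (xDir l) (dirDeriv (xDir m) f) x‖ₑ ^ 2 ≤ N := by
    intro l m
    rw [dirDeriv_dirDeriv_eq_multiDeriv l m hf]
    exact lintegral_sq_le_sobSq (fun β => multiDeriv xDir β f) (by simp [multiLength_add])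
  set μ := (volume.restrict I).prod (volume : Measure ℝ)
  set P : ℝ × ℝ → Plane := fun q => coordPt i q.1 q.2
  have hPm : Measurable P := (measurePreserving_coordPt i).measurable
  have hμ : ∀ g : Plane → ℝ≥0∞, Measurable g →
      ∫⁻ q, g (P q) ∂μ = ∫⁻ s in I, ∫⁻ r, g (coordPt i s r) := fun g hg =>
    lintegral_prod _ (hg.comp hPm).aemeasurable
  have hfull : ∀ g : Plane → ℝ≥0∞, Measurable g → ∫⁻ q, g (P q) ∂μ ≤ ∫⁻ x, g x := by
    intro g hg
    rw [hμ g hg, lintegral_coordPt i hg]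
    exact setLIntegral_le_lintegral _ _
  have hdd : ∀ x, dirDeriv ej (dirDeriv ei (fun x => f x * f x)) x =
      2 * (f x * dirDeriv ej (dirDeriv ei f) x + dirDeriv ej f x * dirDeriv ei f x) := by
    intro x
    have h1 : dirDeriv ei (fun x => f x * f x) =
        fun x => f x * dirDeriv ei f x + f x * dirDeriv ei f x := by
      ext x; rw [dirDeriv_mul _ hf hf]; ring
    have h2 : dirDeriv ej (fun x => f x * dirDeriv ei f x + f x * dirDeriv ei f x) x =
        dirDeriv ej (fun x => f x * dirDeriv ei f x) x +
          dirDeriv ej (fun x => f x * dirDeriv ei f x) x := by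
      simp only [dirDeriv]
      have := (hf.mul hi).differentiable (by simp) x
      exact DFunLike.congr_fun (fderiv_fun_add this this) ej
    rw [h1, h2, dirDeriv_mul _ hf hi]
    ring
  -- The strip estimate for f yields d^{1/2} (‖f‖ ‖∂_i f‖)^{1/2}; the second derivative is
  -- integrated over the whole plane.
  have hterm1 : ∫⁻ q, ‖f (P q)‖ₑ * ‖dirDeriv ej (dirDeriv ei f) (P q)‖ₑ ∂μ ≤
      2 * (d ^ (1 / 2 : ℝ) * A ^ (1 / 4 : ℝ) * N ^ (3 / 4 : ℝ)) := by
    calc ∫⁻ q, ‖f (P q)‖ₑ * ‖dirDeriv ej (dirDeriv ei f) (P q)‖ₑ ∂μ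
        ≤ (∫⁻ q, ‖f (P q)‖ₑ ^ 2 ∂μ) ^ (1 / 2 : ℝ) *
            (∫⁻ q, ‖dirDeriv ej (dirDeriv ei f) (P q)‖ₑ ^ 2 ∂μ) ^ (1 / 2 : ℝ) :=
          lintegral_mul_le_sqrt (hfm.comp hPm).enorm.aemeasurable
            (hji.continuous.measurable.comp hPm).enorm.aemeasurable
      _ ≤ (2 * (A ^ (1 / 2 : ℝ) * N ^ (1 / 2 : ℝ)) * d) ^ (1 / 2 : ℝ) * N ^ (1 / 2 : ℝ) := by
          gcongr
          · rw [hμ (fun x => ‖f x‖ₑ ^ 2) (hfm.enorm.pow_const 2), ← hvol]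
            refine (lintegral_strip_sq_le hf hc i I).trans ?_
            gcongr
            exact hN1 i
          · exact (hfull (fun x => ‖dirDeriv ej (dirDeriv ei f) x‖ₑ ^ 2)
              (hji.continuous.measurable.enorm.pow_const 2)).trans (hN2 _ _)
      _ = 2 ^ (1 / 2 : ℝ) * (d ^ (1 / 2 : ℝ) * A ^ (1 / 4 : ℝ) *
            (N ^ (1 / 4 : ℝ) * N ^ (1 / 2 : ℝ))) := by
          simp only [ENNReal.mul_rpow_of_nonneg _ _ (show (0 : ℝ) ≤ 1 / 2 by norm_num),
            ← ENNReal.rpow_mul]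
          norm_num
          ring
      _ ≤ 2 ^ (1 : ℝ) * (d ^ (1 / 2 : ℝ) * A ^ (1 / 4 : ℝ) *
            (N ^ (1 / 4 : ℝ) * N ^ (1 / 2 : ℝ))) := by
          gcongr <;> norm_num
      _ = _ := by
          rw [← ENNReal.rpow_add_of_nonneg _ _ (by norm_num) (by norm_num)]
          norm_num
  -- The strip estimate is now spent on ∂_j f; the power of ‖f‖ is recovered from ∂_i f by
  -- interpolation between f and ∂_i² f.
  have hterm2 : ∫⁻ q, ‖dirDeriv ej f (P q)‖ₑ * ‖dirDeriv ei f (P q)‖ₑ ∂μ ≤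
      2 * (d ^ (1 / 2 : ℝ) * A ^ (1 / 4 : ℝ) * N ^ (3 / 4 : ℝ)) := by
    calc ∫⁻ q, ‖dirDeriv ej f (P q)‖ₑ * ‖dirDeriv ei f (P q)‖ₑ ∂μ
        ≤ (∫⁻ q, ‖dirDeriv ej f (P q)‖ₑ ^ 2 ∂μ) ^ (1 / 2 : ℝ) *
            (∫⁻ q, ‖dirDeriv ei f (P q)‖ₑ ^ 2 ∂μ) ^ (1 / 2 : ℝ) :=
          lintegral_mul_le_sqrt (hj.continuous.measurable.comp hPm).enorm.aemeasurable
            (hi.continuous.measurable.comp hPm).enorm.aemeasurable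
      _ ≤ (2 * (N ^ (1 / 2 : ℝ) * N ^ (1 / 2 : ℝ)) * d) ^ (1 / 2 : ℝ) *
            (A ^ (1 / 2 : ℝ) * N ^ (1 / 2 : ℝ)) ^ (1 / 2 : ℝ) := by
          gcongr
          · rw [hμ (fun x => ‖dirDeriv ej f x‖ₑ ^ 2) (hj.continuous.measurable.enorm.pow_const 2),
              ← hvol]
            refine (lintegral_strip_sq_le hj (hasCompactSupport_dirDeriv ej hc) i I).trans ?_
            gcongr
            · exact hN1 _
            · exact hN2 _ _
          · refine (hfull (fun x => ‖dirDeriv ei f x‖ₑ ^ 2)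
              (hi.continuous.measurable.enorm.pow_const 2)).trans ?_
            refine (lintegral_dirDeriv_sq_le hf hc ei).trans ?_
            gcongr
            exact hN2 _ _
      _ = 2 ^ (1 / 2 : ℝ) * (d ^ (1 / 2 : ℝ) * A ^ (1 / 4 : ℝ) *
            (N ^ (1 / 4 : ℝ) * N ^ (1 / 4 : ℝ) * N ^ (1 / 4 : ℝ))) := by
          simp only [ENNReal.mul_rpow_of_nonneg _ _ (show (0 : ℝ) ≤ 1 / 2 by norm_num),
            ← ENNReal.rpow_mul]
          norm_num
          ring
      _ ≤ 2 ^ (1 : ℝ) * (d ^ (1 / 2 : ℝ) * A ^ (1 / 4 : ℝ) *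
            (N ^ (1 / 4 : ℝ) * N ^ (1 / 4 : ℝ) * N ^ (1 / 4 : ℝ))) := by
          gcongr <;> norm_num
      _ = _ := by
          rw [← ENNReal.rpow_add_of_nonneg _ _ (by norm_num) (by norm_num),
            ← ENNReal.rpow_add_of_nonneg _ _ (by norm_num) (by norm_num)]
          norm_num
  calc ‖f (coordPt i a r) ^ 2 - f (coordPt i c r) ^ 2‖ₑ
      ≤ ∫⁻ s in I, ‖dirDeriv ei (fun x => f x * f x) (coordPt i s r)‖ₑ := by
        have := enorm_sub_le_lintegral_line (hf.mul hf) (r • xDir (i + 1)) ei a c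
        simpa only [sq, coordPt_eq_left] using this
    _ ≤ ∫⁻ s in I, ∫⁻ r', ‖dirDeriv ej (dirDeriv ei (fun x => f x * f x)) (coordPt i s r')‖ₑ := by
        apply lintegral_mono
        intro s
        exact enorm_le_lintegral_line (contDiff_dirDeriv ei (hf.mul hf))
          (hasCompactSupport_dirDeriv ei hc.mul_left) (s • xDir i) (norm_xDir (i + 1)) r
    _ = ∫⁻ q, ‖dirDeriv ej (dirDeriv ei (fun x => f x * f x)) (P q)‖ₑ ∂μ :=
        (hμ (fun x => ‖dirDeriv ej (dirDeriv ei (fun x => f x * f x)) x‖ₑ)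
          (contDiff_dirDeriv ej (contDiff_dirDeriv ei (hf.mul hf))).continuous.measurable.enorm).symm
    _ ≤ ∫⁻ q, 2 * (‖f (P q)‖ₑ * ‖dirDeriv ej (dirDeriv ei f) (P q)‖ₑ +
          ‖dirDeriv ej f (P q)‖ₑ * ‖dirDeriv ei f (P q)‖ₑ) ∂μ := by
        apply lintegral_mono
        intro q
        simp only [hdd]
        have h2 : ‖(2 : ℝ)‖ₑ = 2 := by simp [← ofReal_norm]
        rw [enorm_mul, h2]
        gcongr
        refine (enorm_add_le _ _).trans ?_
        rw [enorm_mul, enorm_mul]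
    _ = 2 * (∫⁻ q, ‖f (P q)‖ₑ * ‖dirDeriv ej (dirDeriv ei f) (P q)‖ₑ ∂μ +
          ∫⁻ q, ‖dirDeriv ej f (P q)‖ₑ * ‖dirDeriv ei f (P q)‖ₑ ∂μ) := by
        rw [lintegral_const_mul' _ _ (by simp), lintegral_add_left]
        exact (hfm.comp hPm).enorm.mul (hji.continuous.measurable.comp hPm).enorm
    _ ≤ 2 * (2 * (d ^ (1 / 2 : ℝ) * A ^ (1 / 4 : ℝ) * N ^ (3 / 4 : ℝ)) +
          2 * (d ^ (1 / 2 : ℝ) * A ^ (1 / 4 : ℝ) * N ^ (3 / 4 : ℝ))) := by gcongr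
    _ = _ := by ring

/-- The two points are joined through a corner by two segments parallel to the axes. -/
theorem enorm_sq_sub_sq_le_test {f : Plane → ℝ} (hf : ContDiff ℝ ∞ f)
    (hc : HasCompactSupport f) (a c : Plane) :
    ‖f a ^ 2 - f c ^ 2‖ₑ ≤
      16 * (‖a - c‖ₑ ^ (1 / 2 : ℝ) * (∫⁻ x, ‖f x‖ₑ ^ 2) ^ (1 / 4 : ℝ) *
        sobSq 2 (fun β => multiDeriv xDir β f) ^ (3 / 4 : ℝ)) := by
  have ha : a = coordPt 0 (a 0) (a 1) := by ext i; fin_cases i <;> simp [coordPt, xDir]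
  have hcc : c = coordPt 1 (c 1) (c 0) := by ext i; fin_cases i <;> simp [coordPt, xDir]
  have hmid : coordPt 0 (c 0) (a 1) = coordPt 1 (a 1) (c 0) := by simp [coordPt, add_comm]
  have hle : ∀ i, ‖a i - c i‖ₑ ≤ ‖a - c‖ₑ := by
    intro i
    rw [← ofReal_norm, ← ofReal_norm]
    exact ENNReal.ofReal_le_ofReal (PiLp.norm_apply_le (a - c) i)
  have h0 := enorm_sq_sub_sq_coordPt_le hf hc 0 (a 0) (c 0) (a 1)
  have h1 := enorm_sq_sub_sq_coordPt_le hf hc 1 (a 1) (c 1) (c 0)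
  rw [← ha] at h0
  rw [← hcc, ← hmid] at h1
  calc ‖f a ^ 2 - f c ^ 2‖ₑ = ‖(f a ^ 2 - f (coordPt 0 (c 0) (a 1)) ^ 2) +
        (f (coordPt 0 (c 0) (a 1)) ^ 2 - f c ^ 2)‖ₑ := by congr 1; ring
    _ ≤ _ := enorm_add_le _ _
    _ ≤ _ := add_le_add h0 h1
    _ ≤ 8 * (‖a - c‖ₑ ^ (1 / 2 : ℝ) * (∫⁻ x, ‖f x‖ₑ ^ 2) ^ (1 / 4 : ℝ) *
          sobSq 2 (fun β => multiDeriv xDir β f) ^ (3 / 4 : ℝ)) +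
        8 * (‖a - c‖ₑ ^ (1 / 2 : ℝ) * (∫⁻ x, ‖f x‖ₑ ^ 2) ^ (1 / 4 : ℝ) *
          sobSq 2 (fun β => multiDeriv xDir β f) ^ (3 / 4 : ℝ)) := by
        gcongr
        · exact hle 0
        · exact hle 1
    _ = _ := by ring

/-- A limit is only defined almost everywhere, so the inequality is claimed on the set E where the
approximating test functions converge to `H 0`. -/
theorem exists_enorm_sq_sub_sq_le : ∃ C : ℝ≥0, ∀ H : (Fin 2 → ℕ) → Plane → ℝ,
    (∀ β, AEStronglyMeasurable (H β)) → IsTestLimit xDir 2 H → sobSq 2 H ≠ ⊤ →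
    ∃ E : Set Plane, (∀ᵐ x, x ∈ E) ∧ ∀ a ∈ E, ∀ c ∈ E,
      ‖H 0 a ^ 2 - H 0 c ^ 2‖ₑ ≤ C * (‖a - c‖ₑ ^ (1 / 2 : ℝ) *
        (∫⁻ x, ‖H 0 x‖ₑ ^ 2) ^ (1 / 4 : ℝ) * sobSq 2 H ^ (3 / 4 : ℝ)) := by
  set m := (multiIdx 2).card
  -- The 2's come from splitting squares around the limit, m from estimating each term of the H²
  -- norm of f_n separately.
  refine ⟨16 * (2 ^ (1 / 4 : ℝ) * (2 * m) ^ (3 / 4 : ℝ)), fun H hm hH hfin => ?_⟩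
  obtain ⟨f, hf, hfc, hfe⟩ := hH.exists_seq
  have hfm : ∀ n β, AEStronglyMeasurable (multiDeriv xDir β (f n)) volume := fun n β =>
    (contDiff_multiDeriv xDir β (hf n)).continuous.aestronglyMeasurable
  refine ⟨{x | Tendsto (fun n => f n x) atTop (𝓝 (H 0 x))}, ?_, ?_⟩
  · exact ae_tendsto_of_lintegral_sq_le (fun n => hfm n 0) (hm 0) (fun n => hfe n 0 (by simp))
  intro a ha c hc
  set A := ∫⁻ x, ‖H 0 x‖ₑ ^ 2
  have hA : A ≠ ⊤ := ne_top_of_le_ne_top hfin (lintegral_sq_le_sobSq H (by simp))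
  have hterm : ∀ n β, multiLength β ≤ 2 → ∫⁻ x, ‖multiDeriv xDir β (f n) x‖ₑ ^ 2 ≤
      2 * ((2⁻¹ : ℝ≥0∞) ^ n + ∫⁻ x, ‖H β x‖ₑ ^ 2) := by
    intro n β hβ
    refine (lintegral_enorm_sq_le (hfm n _) (hm β)).trans ?_
    gcongr
    exact hfe n _ hβ
  have hN : ∀ n, sobSq 2 (fun β => multiDeriv xDir β (f n)) ≤
      2 * m * ((2⁻¹ : ℝ≥0∞) ^ n + sobSq 2 H) := by
    intro n
    calc sobSq 2 (fun β => multiDeriv xDir β (f n))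
        ≤ ∑ β ∈ multiIdx 2, 2 * ((2⁻¹ : ℝ≥0∞) ^ n + sobSq 2 H) := by
          apply Finset.sum_le_sum
          intro β hβ
          have hβ' : multiLength β ≤ 2 := by simpa using hβ
          refine (hterm n β hβ').trans ?_
          gcongr
          exact lintegral_sq_le_sobSq H hβ'
      _ = _ := by rw [Finset.sum_const, nsmul_eq_mul]; ring
  have hle : ∀ n, ‖f n a ^ 2 - f n c ^ 2‖ₑ ≤ 16 * (‖a - c‖ₑ ^ (1 / 2 : ℝ) *
      (2 * ((2⁻¹ : ℝ≥0∞) ^ n + A)) ^ (1 / 4 : ℝ) *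
        (2 * m * ((2⁻¹ : ℝ≥0∞) ^ n + sobSq 2 H)) ^ (3 / 4 : ℝ)) := by
    intro n
    refine (enorm_sq_sub_sq_le_test (hf n) (hfc n) a c).trans ?_
    gcongr
    · exact hterm n 0 (by simp)
    · exact hN n
  have hlim1 : Tendsto (fun n => ‖f n a ^ 2 - f n c ^ 2‖ₑ) atTop
      (𝓝 ‖H 0 a ^ 2 - H 0 c ^ 2‖ₑ) := ((ha.pow 2).sub (hc.pow 2)).enorm
  have hlim2 : Tendsto (fun n : ℕ => 16 * (‖a - c‖ₑ ^ (1 / 2 : ℝ) *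
      (2 * ((2⁻¹ : ℝ≥0∞) ^ n + A)) ^ (1 / 4 : ℝ) *
        (2 * m * ((2⁻¹ : ℝ≥0∞) ^ n + sobSq 2 H)) ^ (3 / 4 : ℝ))) atTop
      (𝓝 (16 * (‖a - c‖ₑ ^ (1 / 2 : ℝ) * (2 * (0 + A)) ^ (1 / 4 : ℝ) *
        (2 * m * (0 + sobSq 2 H)) ^ (3 / 4 : ℝ)))) := by
    have hd : ‖a - c‖ₑ ^ (1 / 2 : ℝ) ≠ ⊤ := ENNReal.rpow_ne_top_of_nonneg (by norm_num) (by simp)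
    have h1 : Tendsto (fun n : ℕ => (2 * ((2⁻¹ : ℝ≥0∞) ^ n + A)) ^ (1 / 4 : ℝ)) atTop
        (𝓝 ((2 * (0 + A)) ^ (1 / 4 : ℝ))) :=
      (ENNReal.continuous_rpow_const.tendsto _).comp
        (ENNReal.Tendsto.const_mul (tendsto_inv_two_pow.add_const _) (Or.inr (by simp)))
    have h2 : Tendsto (fun n : ℕ => (2 * m * ((2⁻¹ : ℝ≥0∞) ^ n + sobSq 2 H)) ^ (3 / 4 : ℝ)) atTop
        (𝓝 ((2 * m * (0 + sobSq 2 H)) ^ (3 / 4 : ℝ))) :=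
      (ENNReal.continuous_rpow_const.tendsto _).comp
        (ENNReal.Tendsto.const_mul (tendsto_inv_two_pow.add_const _)
          (Or.inr (ENNReal.mul_ne_top (by simp) (by simp))))
    have hA' : (2 * (0 + A)) ^ (1 / 4 : ℝ) ≠ ⊤ :=
      ENNReal.rpow_ne_top_of_nonneg (by norm_num) (ENNReal.mul_ne_top (by simp) (by simpa using hA))
    have hN' : (2 * m * (0 + sobSq 2 H)) ^ (3 / 4 : ℝ) ≠ ⊤ :=
      ENNReal.rpow_ne_top_of_nonneg (by norm_num)
        (ENNReal.mul_ne_top (ENNReal.mul_ne_top (by simp) (by simp)) (by simpa using hfin))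
    have h3 := ENNReal.Tendsto.const_mul (a := ‖a - c‖ₑ ^ (1 / 2 : ℝ)) h1 (Or.inr hd)
    exact ENNReal.Tendsto.const_mul (ENNReal.Tendsto.mul h3 (Or.inr hN') h2
      (Or.inr (ENNReal.mul_ne_top hd hA'))) (Or.inr (by simp))
  refine (le_of_tendsto_of_tendsto' hlim1 hlim2 hle).trans (le_of_eq ?_)
  simp only [zero_add]
  rw [ENNReal.mul_rpow_of_nonneg _ _ (by norm_num), ENNReal.mul_rpow_of_nonneg _ _ (by norm_num)]
  push_cast
  rw [ENNReal.coe_rpow_of_nonneg _ (by norm_num), ENNReal.coe_rpow_of_nonneg _ (by norm_num)]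
  push_cast
  ring

end

end ScreenedVP

namespace ScreenedVP

noncomputable section

open Filter Topology

/-! ### The Green function and its gradient -/

/-- A kernel `k R x`, `R > 0`, which is dominated by products of an integrable function of `R` and
a power `‖x‖ ^ (-b)`, for every `b > 1`. -/
structure KernelBound (k : ℝ → Plane → ℝ) : Prop where
  measurable : Measurable fun q : ℝ × Plane => k q.1 q.2
  bound : ∀ b : ℝ, 1 < b → ∃ C s : ℝ, 0 ≤ C ∧ 0 < s ∧ ∀ R : ℝ, 0 < R → ∀ x : Plane, x ≠ 0 →
    |k R x| ≤ C * (Real.exp (-R) * R ^ (s - 1)) * ‖x‖ ^ (-b)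

/-- The superposition `∫_0^∞ k R x dR`. -/
def superpose (k : ℝ → Plane → ℝ) (x : Plane) : ℝ := ∫ R in Ioi (0 : ℝ), k R x

theorem KernelBound.measurable_superpose {k : ℝ → Plane → ℝ} (hk : KernelBound k) :
    Measurable (superpose k) := by
  have h : Measurable fun q : Plane × ℝ => k q.2 q.1 := hk.measurable.comp measurable_swap
  exact h.stronglyMeasurable.integral_prod_right.measurable

theorem KernelBound.superpose_le {k : ℝ → Plane → ℝ} (hk : KernelBound k) {b : ℝ} (hb : 1 < b) :
    ∃ C : ℝ, 0 ≤ C ∧ ∀ x : Plane, x ≠ 0 → |superpose k x| ≤ C * ‖x‖ ^ (-b) := by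
  obtain ⟨C, s, hC, hs, h⟩ := hk.bound b hb
  refine ⟨C * ∫ R in Ioi (0 : ℝ), Real.exp (-R) * R ^ (s - 1), ?_, fun x hx => ?_⟩
  · apply mul_nonneg hC
    apply setIntegral_nonneg measurableSet_Ioi
    intro R hR
    have : (0 : ℝ) < R := hR
    positivity
  have hint : IntegrableOn (fun R => C * (Real.exp (-R) * R ^ (s - 1)) * ‖x‖ ^ (-b)) (Ioi 0) :=
    ((Real.GammaIntegral_convergent hs).const_mul C).mul_const _
  have := norm_integral_le_of_norm_le (f := fun R => k R x) hint
    ((ae_restrict_iff' measurableSet_Ioi).2 (Eventually.of_forall fun R hR => h R hR x hx))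
  rw [integral_mul_const, integral_const_mul] at this
  exact this

/-- Integrating the bound over R leaves a Gamma integral, so the superposition is at most a multiple
of ‖x‖^{-b} for each b > 1: b near 1 serves at the origin and b = 3 at infinity. -/
theorem KernelBound.lintegral_superpose_lt_top {k : ℝ → Plane → ℝ} (hk : KernelBound k) {p : ℝ}
    (h1 : 1 ≤ p) (h2 : p < 2) : ∫⁻ x, ‖superpose k x‖ₑ ^ p < ⊤ := by
  have hp : 0 < p := by linarith
  -- The midpoint of 1 and 2/p, so that b > 1 and bp < 2.
  set b := (1 + 2 / p) / 2 with hb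
  have hb1 : 1 < b := by
    have : 1 < 2 / p := by rw [lt_div_iff₀ hp]; linarith
    rw [hb]; linarith
  have hbp : b * p < 2 := by
    rw [hb]; field_simp; linarith
  obtain ⟨C, hC, hin⟩ := hk.superpose_le hb1
  obtain ⟨D, hD, hout⟩ := hk.superpose_le (b := 3) (by norm_num)
  set f : Plane → ℝ := fun x => |superpose k x| ^ p with hf
  have hfm : Measurable f := (hk.measurable_superpose.norm).pow_const p
  have hpos : ∀ x : Plane, x ≠ 0 → 0 < ‖x‖ := fun x hx => norm_pos_iff.2 hx
  have hbound : ∀ c e : ℝ, 0 ≤ c → ∀ x : Plane, x ≠ 0 → |superpose k x| ≤ c * ‖x‖ ^ (-e) →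
      ‖f x‖ ≤ c ^ p * ‖x‖ ^ (-(e * p)) := by
    intro c e hc x hx hle
    rw [hf, Real.norm_of_nonneg (by positivity)]
    refine (Real.rpow_le_rpow (abs_nonneg _) hle hp.le).trans (le_of_eq ?_)
    rw [Real.mul_rpow hc (by positivity), ← Real.rpow_mul (hpos x hx).le]
    ring_nf
  have hball : IntegrableOn f (Metric.ball 0 1) := by
    apply integrableOn_ball_of_norm_le_rpow (C := C ^ p) (α := b * p) (by simp) (by simpa using hbp)
      _ hfm.aestronglyMeasurable
    apply ae_restrict_of_ae
    filter_upwards [compl_mem_ae_iff.2 (measure_singleton (0 : Plane))] with x hx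
    exact hbound C b hC x hx (hin x hx)
  have hcompl : IntegrableOn f (Metric.ball 0 1)ᶜ := by
    -- The factor 8 = 2³ comes from (1 + ‖x‖)/2 ≤ ‖x‖ outside the unit ball.
    have hint : Integrable fun x : Plane => D ^ p * (8 * (1 + ‖x‖) ^ (-3 : ℝ)) :=
      ((integrable_one_add_norm (by simp; norm_num)).const_mul 8).const_mul _
    refine Integrable.mono' hint.integrableOn hfm.aestronglyMeasurable.restrict ?_
    rw [ae_restrict_iff' Metric.isOpen_ball.measurableSet.compl]
    refine Eventually.of_forall fun x hx => ?_
    have hx1 : 1 ≤ ‖x‖ := by simpa using hx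
    have hx0 : x ≠ 0 := by rintro rfl; norm_num at hx1
    refine (hbound D 3 hD x hx0 (hout x hx0)).trans ?_
    gcongr
    calc ‖x‖ ^ (-(3 * p)) ≤ ‖x‖ ^ (-3 : ℝ) :=
          Real.rpow_le_rpow_of_exponent_le hx1 (by linarith)
      _ ≤ ((1 + ‖x‖) / 2) ^ (-3 : ℝ) :=
          Real.rpow_le_rpow_of_nonpos (by positivity) (by linarith) (by norm_num)
      _ = 8 * (1 + ‖x‖) ^ (-3 : ℝ) := by
          rw [Real.div_rpow (by positivity) (by norm_num), Real.rpow_neg (by norm_num : (0:ℝ) ≤ 2)]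
          norm_num
          ring
  have hall : Integrable f := by
    rw [← integrableOn_univ, ← union_compl_self (Metric.ball (0 : Plane) 1)]
    exact hball.union hcompl
  refine lt_of_le_of_lt (le_of_eq ?_) hall.2
  apply lintegral_congr
  intro x
  have hfx : 0 ≤ f x := Real.rpow_nonneg (abs_nonneg _) _
  rw [Real.enorm_of_nonneg hfx, Real.enorm_eq_ofReal_abs,
    ENNReal.ofReal_rpow_of_nonneg (abs_nonneg _) hp.le]

theorem KernelBound.integrable_superpose {k : ℝ → Plane → ℝ} (hk : KernelBound k) :
    Integrable (superpose k) :=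
  ⟨hk.measurable_superpose.aestronglyMeasurable, by
    simpa [HasFiniteIntegral] using hk.lintegral_superpose_lt_top le_rfl one_lt_two⟩

/-- Fubini, justified with the exponent 3/2: larger than 1 as the kernel bound requires, and smaller
than 2 so that the singularity is locally integrable in the plane. -/
theorem KernelBound.integral_superpose_mul {k : ℝ → Plane → ℝ} (hk : KernelBound k)
    {ψ : Plane → ℝ} (hψ : Continuous ψ) (hc : HasCompactSupport ψ) :
    ∫ x, superpose k x * ψ x = ∫ R in Ioi (0 : ℝ), ∫ x, k R x * ψ x := by
  obtain ⟨C, s, hC, hs, h⟩ := hk.bound (3 / 2) (by norm_num)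
  have hloc : LocallyIntegrable fun x : Plane => ‖x‖ ^ (-(3 / 2) : ℝ) := by
    apply locallyIntegrable_of_norm_le_rpow (C := 1) (α := 3 / 2) (by simp) (by simp; norm_num)
    · refine Eventually.of_forall fun x => ?_
      rw [one_mul, Real.norm_of_nonneg (by positivity)]
    · exact (measurable_norm.pow_const _).aestronglyMeasurable
  have h1 : Integrable fun x : Plane => ψ x • ‖x‖ ^ (-(3 / 2) : ℝ) :=
    hloc.integrable_smul_left_of_hasCompactSupport hψ hc
  have h2 := h1.norm.mul_prod ((Real.GammaIntegral_convergent hs).const_mul C)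
  have hint : Integrable (fun q : Plane × ℝ => k q.2 q.1 * ψ q.1)
      (volume.prod (volume.restrict (Ioi 0))) := by
    refine h2.mono' ?_ ?_
    · exact ((hk.measurable.comp measurable_swap).mul
        (hψ.measurable.comp measurable_fst)).aestronglyMeasurable
    · have hR : ∀ᵐ q : Plane × ℝ ∂(volume.prod (volume.restrict (Ioi 0))), 0 < q.2 :=
        Measure.quasiMeasurePreserving_snd.ae (ae_restrict_mem measurableSet_Ioi)
      have hx : ∀ᵐ q : Plane × ℝ ∂(volume.prod (volume.restrict (Ioi 0))), q.1 ≠ 0 :=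
        Measure.quasiMeasurePreserving_fst.ae
          (compl_mem_ae_iff.2 (measure_singleton (0 : Plane)))
      filter_upwards [hR, hx] with q hq1 hq2
      rw [norm_mul, norm_smul,
        Real.norm_of_nonneg (by positivity : (0 : ℝ) ≤ ‖q.1‖ ^ (-(3 / 2) : ℝ))]
      calc ‖k q.2 q.1‖ * ‖ψ q.1‖
          ≤ C * (Real.exp (-q.2) * q.2 ^ (s - 1)) * ‖q.1‖ ^ (-(3 / 2) : ℝ) * ‖ψ q.1‖ := by
            gcongr; exact h q.2 hq1 q.1 hq2
        _ = _ := by ring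
  simp only [superpose, ← integral_mul_const]
  exact integral_integral_swap hint

/-- The heat kernel part of the Green function. -/
def heatTerm (R : ℝ) (x : Plane) : ℝ := Real.exp (-(‖x‖ ^ 2 / (4 * R))) * (Real.exp (-R) / R)

/-- The derivative of `heatTerm R` in the `j`-th direction. -/
def heatGradTerm (j : Fin 2) (R : ℝ) (x : Plane) : ℝ := -(x j / (2 * R)) * heatTerm R x

theorem green_eq (x : Plane) : green x = (4 * Real.pi)⁻¹ * superpose heatTerm x := by
  rw [green, superpose]
  congr 1
  apply setIntegral_congr_fun measurableSet_Ioi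
  intro R hR
  have hR0 : (0 : ℝ) < R := hR
  have h1 : (R ^ (-(1 / 2) : ℝ)) ^ 2 = R⁻¹ := by
    rw [← Real.rpow_natCast, ← Real.rpow_mul hR0.le, ← Real.rpow_neg_one]; norm_num
  simp only [heatTerm]
  rw [norm_smul, mul_pow, Real.norm_of_nonneg (by positivity), h1, mul_div_assoc]
  congr 2
  field_simp

/-- The gradient of the Green function. -/
def greenGrad (j : Fin 2) (x : Plane) : ℝ := (4 * Real.pi)⁻¹ * superpose (heatGradTerm j) x

/-- Raise s/a ≤ e^{s/a} to the power a. With s = ‖x‖²/(4R) this trades the Gaussian for a negative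
power of ‖x‖ and a positive power of R. -/
theorem exp_neg_le_rpow {a s : ℝ} (ha : 0 < a) (hs : 0 < s) : Real.exp (-s) ≤ a ^ a * s ^ (-a) := by
  have h1 : s / a ≤ Real.exp (s / a) := by linarith [Real.add_one_le_exp (s / a)]
  have h2 : (s / a) ^ a ≤ Real.exp s := by
    calc (s / a) ^ a ≤ Real.exp (s / a) ^ a := Real.rpow_le_rpow (by positivity) h1 ha.le
      _ = Real.exp s := by rw [← Real.exp_mul]; congr 1; field_simp
  rw [Real.exp_neg, Real.rpow_neg hs.le, ← div_eq_mul_inv, ← inv_div, ← Real.div_rpow hs.le ha.le]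
  exact inv_anti₀ (by positivity) h2

theorem heatTerm_le {a R : ℝ} (ha : 0 < a) (hR : 0 < R) {x : Plane} (hx : x ≠ 0) :
    |heatTerm R x| ≤ a ^ a * 4 ^ a * (Real.exp (-R) * R ^ (a - 1)) * ‖x‖ ^ (-(2 * a)) := by
  have hx0 : 0 < ‖x‖ := norm_pos_iff.2 hx
  rw [heatTerm, abs_of_nonneg (by positivity)]
  calc Real.exp (-(‖x‖ ^ 2 / (4 * R))) * (Real.exp (-R) / R)
      ≤ (a ^ a * (‖x‖ ^ 2 / (4 * R)) ^ (-a)) * (Real.exp (-R) / R) := by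
        gcongr
        exact exp_neg_le_rpow ha (by positivity)
    _ = _ := by
        rw [Real.div_rpow (by positivity) (by positivity), Real.mul_rpow (by norm_num) hR.le,
          Real.rpow_sub hR, Real.rpow_one, Real.rpow_neg (by norm_num : (0 : ℝ) ≤ 4),
          Real.rpow_neg hR.le, ← Real.rpow_natCast, ← Real.rpow_mul hx0.le]
        have : ((2 : ℕ) : ℝ) * -a = -(2 * a) := by push_cast; ring
        rw [this]
        field_simp

theorem kernelBound_heatTerm : KernelBound heatTerm where
  measurable := by
    unfold heatTerm
    fun_prop
  bound b hb := by
    refine ⟨(b / 2) ^ (b / 2) * 4 ^ (b / 2), b / 2, by positivity, by positivity,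
      fun R hR x hx => ?_⟩
    have := heatTerm_le (a := b / 2) (by positivity) hR hx
    rwa [mul_div_cancel₀ b two_ne_zero] at this

/-- The gradient costs an extra ‖x‖/R, so the Gaussian is spent with a = (b+1)/2. The remaining
power of R is integrable at 0 exactly when a > 1, that is b > 1. -/
theorem kernelBound_heatGradTerm (j : Fin 2) : KernelBound (heatGradTerm j) where
  measurable := by
    unfold heatGradTerm heatTerm
    fun_prop
  bound b hb := by
    set a := (b + 1) / 2 with ha
    have ha0 : 0 < a := by rw [ha]; linarith
    refine ⟨a ^ a * 4 ^ a, a - 1, by positivity, by rw [ha]; linarith, fun R hR x hx => ?_⟩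
    have hx0 : 0 < ‖x‖ := norm_pos_iff.2 hx
    rw [heatGradTerm, abs_mul, abs_neg, abs_div, abs_of_pos (by positivity : 0 < 2 * R)]
    calc |x j| / (2 * R) * |heatTerm R x|
        ≤ ‖x‖ / R * (a ^ a * 4 ^ a * (Real.exp (-R) * R ^ (a - 1)) * ‖x‖ ^ (-(2 * a))) := by
          gcongr
          · exact PiLp.norm_apply_le x j
          · linarith
          · exact heatTerm_le ha0 hR hx
      _ = a ^ a * 4 ^ a * (Real.exp (-R) * R ^ (a - 1 - 1)) * (‖x‖ * ‖x‖ ^ (-(2 * a))) := by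
          rw [Real.rpow_sub_one hR.ne' (a - 1)]
          field_simp
      _ = _ := by
          congr 1
          nth_rewrite 1 [← Real.rpow_one ‖x‖]
          rw [← Real.rpow_add hx0]
          congr 1
          rw [ha]; ring

theorem contDiff_heatTerm (R : ℝ) : ContDiff ℝ ∞ (heatTerm R) := by
  unfold heatTerm
  exact (((contDiff_norm_sq ℝ).div_const _).neg.exp).mul contDiff_const

theorem dirDeriv_heatTerm (j : Fin 2) (R : ℝ) (x : Plane) :
    dirDeriv (xDir j) (heatTerm R) x = heatGradTerm j R x := by
  have h1 : HasFDerivAt (fun x : Plane => ‖x‖ ^ 2) (2 • innerSL ℝ x) x :=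
    (hasStrictFDerivAt_norm_sq x).hasFDerivAt
  have h2 : HasFDerivAt (fun x : Plane => -(‖x‖ ^ 2 * (4 * R)⁻¹)) (-((4 * R)⁻¹ • (2 • innerSL ℝ x)))
    x := (h1.mul_const _).neg
  have h3 := (h2.exp).mul_const (Real.exp (-R) / R)
  have h4 : heatTerm R = fun x : Plane =>
      Real.exp (-(‖x‖ ^ 2 * (4 * R)⁻¹)) * (Real.exp (-R) / R) := by
    ext x; simp [heatTerm, div_eq_mul_inv]
  rw [dirDeriv, h4, h3.fderiv, heatGradTerm, h4]
  simp [xDir, EuclideanSpace.inner_single_right]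
  ring

/-- For each fixed R the heat kernel is smooth and can be integrated by parts; superposing
afterwards avoids any discussion of the singularity of G at the origin. -/
theorem integral_green_mul_dirDeriv (j : Fin 2) {ψ : Plane → ℝ} (hψ : ContDiff ℝ ∞ ψ)
    (hc : HasCompactSupport ψ) :
    ∫ x, green x * dirDeriv (xDir j) ψ x = - ∫ x, greenGrad j x * ψ x := by
  simp only [green_eq, greenGrad, mul_assoc, integral_const_mul]
  rw [kernelBound_heatTerm.integral_superpose_mul (contDiff_dirDeriv _ hψ).continuous
    (hasCompactSupport_dirDeriv _ hc), (kernelBound_heatGradTerm j).integral_superpose_mul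
    hψ.continuous hc, ← mul_neg, ← integral_neg]
  congr 2
  ext R
  rw [integral_mul_dirDeriv _ (contDiff_heatTerm R) hψ hc]
  simp only [dirDeriv_heatTerm]

theorem measurable_green : Measurable green := by
  rw [funext green_eq]
  exact kernelBound_heatTerm.measurable_superpose.const_mul _

theorem measurable_greenGrad (j : Fin 2) : Measurable (greenGrad j) :=
  (kernelBound_heatGradTerm j).measurable_superpose.const_mul _

theorem integrable_green : Integrable green := by
  rw [funext green_eq]
  exact kernelBound_heatTerm.integrable_superpose.const_mul _

theorem integrable_greenGrad (j : Fin 2) : Integrable (greenGrad j) :=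
  (kernelBound_heatGradTerm j).integrable_superpose.const_mul _

theorem lintegral_green_rpow_lt_top {p : ℝ} (h1 : 1 ≤ p) (h2 : p < 2) :
    ∫⁻ x, ‖green x‖ₑ ^ p < ⊤ := by
  simp only [green_eq, enorm_mul, ENNReal.mul_rpow_of_nonneg _ _ (by linarith : 0 ≤ p)]
  rw [lintegral_const_mul' _ _ (ENNReal.rpow_ne_top_of_nonneg (by linarith) enorm_ne_top)]
  exact ENNReal.mul_lt_top (ENNReal.rpow_lt_top_of_nonneg (by linarith) enorm_ne_top)
    (kernelBound_heatTerm.lintegral_superpose_lt_top h1 h2)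

theorem lintegral_greenGrad_rpow_lt_top (j : Fin 2) {p : ℝ} (h1 : 1 ≤ p) (h2 : p < 2) :
    ∫⁻ x, ‖greenGrad j x‖ₑ ^ p < ⊤ := by
  simp only [greenGrad, enorm_mul, ENNReal.mul_rpow_of_nonneg _ _ (by linarith : 0 ≤ p)]
  rw [lintegral_const_mul' _ _ (ENNReal.rpow_ne_top_of_nonneg (by linarith) enorm_ne_top)]
  exact ENNReal.mul_lt_top (ENNReal.rpow_lt_top_of_nonneg (by linarith) enorm_ne_top)
    ((kernelBound_heatGradTerm j).lintegral_superpose_lt_top h1 h2)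

end

end ScreenedVP

namespace ScreenedVP

noncomputable section

open Filter Topology

/-! ### Free transport and weak derivatives of the density and the potential -/

/-- A family `H β` on `ℝ²_x × ℝ²_v` that represents the `v`-derivatives of a function in
`L²_x H^k_v`, in the sense that almost all slices are limits of test functions. -/
structure SliceFamily (k : ℕ) (H : (Fin 2 → ℕ) → Plane × Plane → ℝ) : Prop where
  measurable : ∀ β, StronglyMeasurable (H β)
  slice : ∀ᵐ y : Plane, IsTestLimit xDir k (fun β v => H β (y, v))
  finite : ∫⁻ y, sobSq k (fun β v => H β (y, v)) ≠ ⊤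

theorem measurable_sobSq_slice {H : (Fin 2 → ℕ) → Plane × Plane → ℝ}
    (hm : ∀ β, StronglyMeasurable (H β)) (k : ℕ) :
    Measurable fun y : Plane => sobSq k (fun β v => H β (y, v)) :=
  Finset.measurable_fun_sum _ fun β _ =>
    ((hm β).measurable.enorm.pow_const 2).lintegral_prod_right'

instance : (volume : Measure (Plane × Plane)).IsAddHaarMeasure :=
  inferInstanceAs ((volume : Measure Plane).prod (volume : Measure Plane)).IsAddHaarMeasure

theorem exists_sliceFamily {k : ℕ} {h : Plane × Plane → ℝ} (hk : normL2xHv k h < ⊤) :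
    ∃ H : (Fin 2 → ℕ) → Plane × Plane → ℝ, SliceFamily k H ∧ H 0 =ᵐ[volume] h ∧
      ∫⁻ y, sobSq k (fun β v => H β (y, v)) ≤ (multiIdx k).card * normL2xHv k h ^ 2 := by
  obtain ⟨H, hm, h0, hH⟩ := exists_weakDerivs hk
  have hle : ∫⁻ y, sobSq k (fun β v => H β (y, v)) ≤
      (multiIdx k).card * normL2xHv k h ^ 2 := by
    simp only [sobSq]
    rw [lintegral_finsetSum _ fun β _ =>
      ((hm β).measurable.enorm.pow_const 2).lintegral_prod_right']
    calc ∑ β ∈ multiIdx k, ∫⁻ y, ∫⁻ v, ‖H β (y, v)‖ₑ ^ 2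
        ≤ ∑ β ∈ multiIdx k, normL2xHv k h ^ 2 := by
          apply Finset.sum_le_sum
          intro β hβ
          rw [← lintegral_prod _ ((hm β).measurable.enorm.pow_const 2).aemeasurable]
          exact (hH β (by simpa using hβ)).2.2
      _ = _ := by rw [Finset.sum_const, nsmul_eq_mul]
  refine ⟨H, ⟨hm, ?_, ?_⟩, h0, hle⟩
  · exact ae_isTestLimit_slice hm
      (isTestLimit_of_isWeakDeriv (fun β hβ => (hH β hβ).1) fun β hβ => (hH β hβ).2.1)
  · exact ne_top_of_le_ne_top (ENNReal.mul_ne_top (by simp) (ENNReal.pow_ne_top hk.ne)) hle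

theorem SliceFamily.lintegral_sq_ne_top {k : ℕ} {H : (Fin 2 → ℕ) → Plane × Plane → ℝ}
    (hH : SliceFamily k H) {β : Fin 2 → ℕ} (hβ : multiLength β ≤ k) :
    ∫⁻ p, ‖H β p‖ₑ ^ 2 ≠ ⊤ := by
  refine ne_top_of_le_ne_top hH.finite ?_
  rw [Measure.volume_eq_prod,
    lintegral_prod _ ((hH.measurable β).measurable.enorm.pow_const 2).aemeasurable]
  exact lintegral_mono fun y => lintegral_sq_le_sobSq (fun β v => H β (y, v)) hβ

/-- The list sum `∑ H_{p₁} H_{p₂}` of the Leibniz rule. -/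
def leibnizSum {X : Type*} (s : List ((Fin 2 → ℕ) × (Fin 2 → ℕ))) (H : (Fin 2 → ℕ) → X → ℝ)
    (x : X) : ℝ :=
  (s.map fun p => H p.1 x * H p.2 x).sum

theorem multiLength_le_of_add_eq {p : (Fin 2 → ℕ) × (Fin 2 → ℕ)} {β : Fin 2 → ℕ}
    (h : p.1 + p.2 = β) : multiLength p.1 ≤ multiLength β ∧ multiLength p.2 ≤ multiLength β := by
  have := congrArg multiLength h
  rw [multiLength_add] at this
  omega

theorem SliceFamily.integrable_leibnizSum {k : ℕ} {H : (Fin 2 → ℕ) → Plane × Plane → ℝ}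
    (hH : SliceFamily k H) {β : Fin 2 → ℕ} (hβ : multiLength β ≤ k)
    {s : List ((Fin 2 → ℕ) × (Fin 2 → ℕ))} (hs : ∀ p ∈ s, p.1 + p.2 = β) :
    Integrable (leibnizSum s H) := by
  refine integrable_list_sum s (fun p x => H p.1 x * H p.2 x) fun p hp => ?_
  have := multiLength_le_of_add_eq (hs p hp)
  exact integrable_mul_of_sq (hH.measurable _).aestronglyMeasurable
    (hH.measurable _).aestronglyMeasurable (hH.lintegral_sq_ne_top (by omega))
    (hH.lintegral_sq_ne_top (by omega))

/-! ### The shear (x, w) ↦ (x - tw, w) and velocity averages. -/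

theorem measurePreserving_shear (t : ℝ) :
    MeasurePreserving (fun q : Plane × Plane => (q.1 - t • q.2, q.2)) := by
  have h1 : MeasurePreserving (fun q : Plane × Plane => (q.1, q.2 - t • q.1))
      (volume.prod volume) (volume.prod volume) := by
    refine MeasurePreserving.skew_product (MeasurePreserving.id volume)
      (g := fun w x => x - t • w) (by fun_prop) ?_
    exact Eventually.of_forall fun w => (measurePreserving_sub_right volume (t • w)).map_eq
  exact (Measure.measurePreserving_swap.comp h1).comp Measure.measurePreserving_swap

theorem lintegral_shear (t : ℝ) {Φ : Plane × Plane → ℝ≥0∞} (hΦ : Measurable Φ) :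
    ∫⁻ x, ∫⁻ w, Φ (x - t • w, w) = ∫⁻ p, Φ p := by
  rw [← (measurePreserving_shear t).lintegral_comp hΦ]
  exact (lintegral_prod _ (hΦ.comp (measurePreserving_shear t).measurable).aemeasurable).symm

/-- The velocity average `∫ g(x - t w, w) dw` of a freely transported function. -/
def transport (t : ℝ) (g : Plane × Plane → ℝ) (x : Plane) : ℝ := ∫ w, g (x - t • w, w)

theorem integrable_shear {g : Plane × Plane → ℝ} (hg : Integrable g) (t : ℝ) :
    Integrable fun q : Plane × Plane => g (q.1 - t • q.2, q.2) :=
  (measurePreserving_shear t).integrable_comp_of_integrable hg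

theorem integrable_transport {g : Plane × Plane → ℝ} (hg : Integrable g) (t : ℝ) :
    Integrable (transport t g) :=
  (integrable_shear hg t).integral_prod_left

theorem transport_congr_ae {g g' : Plane × Plane → ℝ} (h : g =ᵐ[volume] g') (t : ℝ) :
    transport t g =ᵐ[volume] transport t g' := by
  have h1 := (measurePreserving_shear t).quasiMeasurePreserving.ae h
  filter_upwards [Measure.ae_ae_of_ae_prod h1] with x hx
  exact integral_congr_ae hx

theorem integral_transport_mul {g : Plane × Plane → ℝ} (hg : Integrable g) (t : ℝ)
    {ψ : Plane → ℝ} (hψ : Continuous ψ) {M : ℝ} (hM : ∀ x, ‖ψ x‖ ≤ M) :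
    ∫ x, transport t g x * ψ x = ∫ p : Plane × Plane, g p * ψ (p.1 + t • p.2) := by
  have hint : Integrable fun p : Plane × Plane => g p * ψ (p.1 + t • p.2) :=
    hg.mul_bdd (c := M) (hψ.comp (by fun_prop)).aestronglyMeasurable
      (Eventually.of_forall fun _ => hM _)
  have h1 := integral_prod _ (integrable_shear hint t)
  simp only [sub_add_cancel] at h1
  have hemb : MeasurableEmbedding (fun q : Plane × Plane => (q.1 - t • q.2, q.2)) := by
    have : IsClosedEmbedding (fun q : Plane × Plane => (q.1 - t • q.2, q.2)) := by
      let e : Plane × Plane ≃ₜ Plane × Plane :=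
        { toFun := fun q => (q.1 - t • q.2, q.2)
          invFun := fun q => (q.1 + t • q.2, q.2)
          left_inv := fun q => by simp
          right_inv := fun q => by simp
          continuous_toFun := by fun_prop
          continuous_invFun := by fun_prop }
      exact e.isClosedEmbedding
    exact this.measurableEmbedding
  have h2 := (measurePreserving_shear t).integral_comp hemb
    (fun p : Plane × Plane => g p * ψ (p.1 + t • p.2))
  simp only [sub_add_cancel] at h2
  rw [← h2]
  simp only [transport, ← integral_mul_const]
  exact h1.symm

theorem exists_bound_multiDeriv (b : Fin 2 → Plane) (β : Fin 2 → ℕ) {ψ : Plane → ℝ}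
    (hψ : ContDiff ℝ ∞ ψ) (hc : HasCompactSupport ψ) : ∃ M : ℝ, ∀ x, ‖multiDeriv b β ψ x‖ ≤ M :=
  (hasCompactSupport_multiDeriv b β hc).exists_bound_of_continuous
    (contDiff_multiDeriv b β hψ).continuous

theorem SliceFamily.integrable_sq {k : ℕ} {H : (Fin 2 → ℕ) → Plane × Plane → ℝ}
    (hH : SliceFamily k H) : Integrable fun p => H 0 p ^ 2 := by
  simp only [sq]
  exact integrable_mul_of_sq (hH.measurable _).aestronglyMeasurable
    (hH.measurable _).aestronglyMeasurable (hH.lintegral_sq_ne_top (by simp))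
    (hH.lintegral_sq_ne_top (by simp))

/-- Paired with ∂^βψ, the velocity average becomes ∫∫ h²(y,v) (∂^βψ)(y + tv) dv dy. Since (∂^βψ)(y +
tv) is t^{-|β|} ∂_v^β[ψ(y + tv)], the weak Leibniz rule in v on each slice moves the derivatives
onto h². This is the source of the decay t^{-|β|}. -/
theorem SliceFamily.isWeakDeriv_transport {k : ℕ} {H : (Fin 2 → ℕ) → Plane × Plane → ℝ}
    (hH : SliceFamily k H) {β : Fin 2 → ℕ} (hβ : multiLength β ≤ k)
    {s : List ((Fin 2 → ℕ) × (Fin 2 → ℕ))} (hs : ∀ p ∈ s, p.1 + p.2 = β)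
    (hleib : ∀ f g : Plane → ℝ, ContDiff ℝ ∞ f → ContDiff ℝ ∞ g →
      multiDeriv xDir β (fun x => f x * g x) =
        fun x => (s.map fun p => multiDeriv xDir p.1 f x * multiDeriv xDir p.2 g x).sum)
    {t : ℝ} (ht : t ≠ 0) :
    IsWeakDeriv xDir β (transport t fun p => H 0 p ^ 2)
      (fun x => (t ^ multiLength β)⁻¹ * transport t (leibnizSum s H) x) := by
  have hsq := hH.integrable_sq
  have hls := hH.integrable_leibnizSum hβ hs
  refine ⟨(integrable_transport hsq t).locallyIntegrable,
    ((integrable_transport hls t).const_mul _).locallyIntegrable, fun ψ hψ hc => ?_⟩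
  obtain ⟨M, hM⟩ := exists_bound_multiDeriv xDir β hψ hc
  obtain ⟨M', hM'⟩ := hc.exists_bound_of_continuous hψ.continuous
  have hint : ∀ g : Plane × Plane → ℝ, Integrable g → ∀ χ : Plane → ℝ, Continuous χ →
      (∃ M, ∀ x, ‖χ x‖ ≤ M) → Integrable fun p : Plane × Plane => g p * χ (p.1 + t • p.2) :=
    fun g hg χ hχ ⟨M, hM⟩ => hg.mul_bdd (c := M) (hχ.comp (by fun_prop)).aestronglyMeasurable
      (Eventually.of_forall fun _ => hM _)
  simp only [mul_assoc, integral_const_mul]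
  rw [integral_transport_mul hsq t (contDiff_multiDeriv xDir β hψ).continuous hM,
    integral_transport_mul hls t hψ.continuous hM', Measure.volume_eq_prod,
    integral_prod _ (hint _ hsq _ (contDiff_multiDeriv xDir β hψ).continuous ⟨M, hM⟩),
    integral_prod _ (hint _ hls _ hψ.continuous ⟨M', hM'⟩), ← integral_const_mul,
    ← integral_const_mul]
  -- The identity is proved for almost every fixed y; for t ≠ 0 the function v ↦ ψ(y + tv) is again
  -- a test function.
  apply integral_congr_ae
  filter_upwards [hH.slice, ae_lt_top (measurable_sobSq_slice hH.measurable k) hH.finite]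
    with y hy hfin
  have hχ : ContDiff ℝ ∞ fun v : Plane => ψ (y + t • v) :=
    hψ.comp (contDiff_const.add (contDiff_const_smul t))
  have hχc : HasCompactSupport fun v : Plane => ψ (y + t • v) :=
    hc.comp_homeomorph ((Homeomorph.smulOfNeZero t ht).trans (Homeomorph.addLeft y))
  have hder : ∀ v, multiDeriv xDir β (fun v : Plane => ψ (y + t • v)) v =
      t ^ multiLength β * multiDeriv xDir β ψ (y + t • v) := by
    intro v
    have h := multiDeriv_comp_affine xDir (t • ContinuousLinearMap.id ℝ Plane) y β hψ
    simp only [FunLike.coe_smul, Pi.smul_apply, ContinuousLinearMap.coe_id', id_eq] at h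
    rw [h]
    exact multiDeriv_const_smul_dir xDir t β hψ (y + t • v)
  have hmain := hy.integral_sq_mul_multiDeriv
    (fun β => ((hH.measurable β).comp_measurable measurable_prodMk_left).aestronglyMeasurable)
    hfin.ne hβ hs hleib hχ hχc
  simp only [hder] at hmain
  have htn : t ^ multiLength β ≠ 0 := pow_ne_zero _ ht
  calc ∫ v, H 0 (y, v) ^ 2 * multiDeriv xDir β ψ (y + t • v)
      = (t ^ multiLength β)⁻¹ * ∫ v, H 0 (y, v) ^ 2 *
          (t ^ multiLength β * multiDeriv xDir β ψ (y + t • v)) := by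
        rw [← integral_const_mul]
        congr 1; ext v
        field_simp
    _ = _ := by
        rw [hmain]
        simp only [leibnizSum]
        ring

/-! #### Convolution with the Green function -/

/-- The convolution `f * g`. -/
def conv (f g : Plane → ℝ) (x : Plane) : ℝ := ∫ y, f (x - y) * g y

theorem conv_eq_transport (f g : Plane → ℝ) :
    conv f g = transport 1 fun p => f p.1 * g p.2 := by
  ext x; simp [conv, transport]

theorem integrable_conv {f g : Plane → ℝ} (hf : Integrable f) (hg : Integrable g) :
    Integrable (conv f g) := by
  rw [conv_eq_transport]
  exact integrable_transport (hf.mul_prod hg) 1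

theorem integral_conv_mul {f g : Plane → ℝ} (hf : Integrable f) (hg : Integrable g)
    {ψ : Plane → ℝ} (hψ : Continuous ψ) {M : ℝ} (hM : ∀ x, ‖ψ x‖ ≤ M) :
    ∫ x, conv f g x * ψ x = ∫ z, f z * ∫ y, g y * ψ (z + y) := by
  have hfg : Integrable fun p : Plane × Plane => f p.1 * g p.2 := hf.mul_prod hg
  have hint : Integrable fun p : Plane × Plane => f p.1 * g p.2 * ψ (p.1 + p.2) :=
    hfg.mul_bdd (c := M) (hψ.comp (by fun_prop)).aestronglyMeasurable
      (Eventually.of_forall fun _ => hM _)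
  rw [conv_eq_transport, integral_transport_mul hfg 1 hψ hM]
  simp only [one_smul]
  rw [Measure.volume_eq_prod, integral_prod _ hint]
  simp only [mul_assoc, integral_const_mul]

/-- Of the two orders of integration, this one isolates f, so that a derivative can be moved to the
kernel; `integral_conv_mul` isolates g and serves for derivatives of the density. -/
theorem integral_conv_mul' {f g : Plane → ℝ} (hf : Integrable f) (hg : Integrable g)
    {ψ : Plane → ℝ} (hψ : Continuous ψ) {M : ℝ} (hM : ∀ x, ‖ψ x‖ ≤ M) :
    ∫ x, conv f g x * ψ x = ∫ y, g y * ∫ z, f z * ψ (y + z) := by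
  have hfg : Integrable fun p : Plane × Plane => f p.1 * g p.2 := hf.mul_prod hg
  have hint : Integrable fun p : Plane × Plane => f p.1 * g p.2 * ψ (p.1 + p.2) :=
    hfg.mul_bdd (c := M) (hψ.comp (by fun_prop)).aestronglyMeasurable
      (Eventually.of_forall fun _ => hM _)
  rw [conv_eq_transport, integral_transport_mul hfg 1 hψ hM]
  simp only [one_smul]
  rw [Measure.volume_eq_prod, integral_prod_symm _ hint]
  congr 1; ext y
  rw [← integral_const_mul]
  congr 1; ext z
  rw [add_comm z y]; ring

theorem multiDeriv_comp_const_add (b : Fin 2 → Plane) (β : Fin 2 → ℕ) {ψ : Plane → ℝ}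
    (hψ : ContDiff ℝ ∞ ψ) (z : Plane) :
    multiDeriv b β (fun y => ψ (z + y)) = fun y => multiDeriv b β ψ (z + y) := by
  simpa using multiDeriv_comp_affine b (ContinuousLinearMap.id ℝ Plane) z β hψ

theorem IsWeakDeriv.conv_right {f g g' : Plane → ℝ} {β : Fin 2 → ℕ} (hf : Integrable f)
    (hg : Integrable g) (hg' : Integrable g') (h : IsWeakDeriv xDir β g g') :
    IsWeakDeriv xDir β (conv f g) (conv f g') := by
  refine ⟨(integrable_conv hf hg).locallyIntegrable, (integrable_conv hf hg').locallyIntegrable,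
    fun ψ hψ hc => ?_⟩
  obtain ⟨M, hM⟩ := exists_bound_multiDeriv xDir β hψ hc
  obtain ⟨M', hM'⟩ := hc.exists_bound_of_continuous hψ.continuous
  rw [integral_conv_mul hf hg (contDiff_multiDeriv xDir β hψ).continuous hM,
    integral_conv_mul hf hg' hψ.continuous hM', ← integral_const_mul]
  congr 1; ext z
  have hχ : ContDiff ℝ ∞ fun y : Plane => ψ (z + y) := hψ.comp (contDiff_const.add contDiff_id)
  have := h.2.2 _ hχ (hc.comp_homeomorph (Homeomorph.addLeft z))
  rw [multiDeriv_comp_const_add xDir β hψ z] at this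
  rw [this]
  ring

theorem isWeakDeriv_conv_green {g : Plane → ℝ} (hg : Integrable g) (j : Fin 2) :
    IsWeakDeriv xDir (Pi.single j 1) (conv green g) (conv (greenGrad j) g) := by
  have hG := integrable_green
  have hK := integrable_greenGrad j
  refine ⟨(integrable_conv hG hg).locallyIntegrable, (integrable_conv hK hg).locallyIntegrable,
    fun ψ hψ hc => ?_⟩
  obtain ⟨M, hM⟩ := exists_bound_multiDeriv xDir (Pi.single j 1) hψ hc
  obtain ⟨M', hM'⟩ := hc.exists_bound_of_continuous hψ.continuous
  rw [integral_conv_mul' hG hg (contDiff_multiDeriv xDir _ hψ).continuous hM,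
    integral_conv_mul' hK hg hψ.continuous hM', ← integral_const_mul]
  congr 1; ext z
  have hχ : ContDiff ℝ ∞ fun y : Plane => ψ (z + y) := hψ.comp (contDiff_const.add contDiff_id)
  have := integral_green_mul_dirDeriv j hχ (hc.comp_homeomorph (Homeomorph.addLeft z))
  rw [dirDeriv_eq_multiDeriv j hχ, multiDeriv_comp_const_add xDir _ hψ z] at this
  rw [this]
  simp

theorem IsWeakDeriv.trans_single {u v w : Plane → ℝ} {α : Fin 2 → ℕ} {j : Fin 2}
    (h1 : IsWeakDeriv xDir α u v) (h2 : IsWeakDeriv xDir (Pi.single j 1) v w) :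
    IsWeakDeriv xDir (α + Pi.single j 1) u w := by
  refine ⟨h1.1, h2.2.1, fun ψ hψ hc => ?_⟩
  rw [multiDeriv_add_single _ _ _ hψ, ← multiDeriv_dirDeriv _ _ _ hψ,
    h1.2.2 _ (contDiff_dirDeriv _ hψ) (hasCompactSupport_dirDeriv _ hc),
    dirDeriv_eq_multiDeriv j hψ, h2.2.2 _ hψ hc, multiLength_add, pow_add, mul_assoc]

/-- A change of h on a null set changes the density only on a null set, which the convolution
integral does not see; the equality therefore holds at every point. -/
theorem potential_eq_conv {h : Plane × Plane → ℝ} {H₀ : Plane × Plane → ℝ}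
    (h0 : H₀ =ᵐ[volume] h) (t : ℝ) :
    potential h t = conv green (transport t fun p => H₀ p ^ 2) := by
  ext x
  have : transport t (fun p => H₀ p ^ 2) =ᵐ[volume] density h t :=
    transport_congr_ae (g' := fun p => h p ^ 2) (h0.fun_comp (· ^ 2)) t
  apply integral_congr_ae
  filter_upwards [this] with y hy
  rw [hy]

end

end ScreenedVP

namespace ScreenedVP

noncomputable section

open Filter Topology

/-! ### Integral bounds for Leibniz sums -/

/-- `ProductBound k q p` bounds the `L^q` norm of the product `H_{p₁} H_{p₂}` by the square of the
`H^k` norm, uniformly in all limits `H` of test functions in `H^k`. -/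
def ProductBound (k : ℕ) (q : ℝ) (p : (Fin 2 → ℕ) × (Fin 2 → ℕ)) : Prop :=
  ∃ C : ℝ≥0, ∀ H : (Fin 2 → ℕ) → Plane → ℝ, (∀ β, AEStronglyMeasurable (H β)) →
    IsTestLimit xDir k H → ∫⁻ x, (‖H p.1 x‖ₑ * ‖H p.2 x‖ₑ) ^ q ≤ C * sobSq k H ^ q

/-- Both factors are in H¹, hence in L^{2q}, and Cauchy-Schwarz bounds the product in L^q. -/
theorem productBound_of_lt (m : ℕ) {k : ℕ} {p : (Fin 2 → ℕ) × (Fin 2 → ℕ)}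
    (h1 : multiLength p.1 + 1 ≤ k) (h2 : multiLength p.2 + 1 ≤ k) :
    ProductBound k ((m + 1 : ℕ) : ℝ) p := by
  obtain ⟨C, hC⟩ := exists_lintegral_pow_le m k
  refine ⟨C, fun H hm hH => ?_⟩
  simp only [ENNReal.rpow_natCast, mul_pow]
  have hp1 := hC H hm hH p.1 h1
  have hp2 := hC H hm hH p.2 h2
  refine (lintegral_mul_le_sqrt ((hm p.1).enorm.pow_const _)
    ((hm p.2).enorm.pow_const _)).trans ?_
  simp only [← pow_mul, mul_comm _ 2]
  calc (∫⁻ x, ‖H p.1 x‖ₑ ^ (2 * (m + 1))) ^ (1 / 2 : ℝ) *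
        (∫⁻ x, ‖H p.2 x‖ₑ ^ (2 * (m + 1))) ^ (1 / 2 : ℝ)
      ≤ (C * sobSq k H ^ (m + 1)) ^ (1 / 2 : ℝ) * (C * sobSq k H ^ (m + 1)) ^ (1 / 2 : ℝ) := by
        gcongr
    _ = _ := by
        rw [← ENNReal.rpow_add_of_nonneg _ _ (by norm_num) (by norm_num)]
        norm_num

/-- One factor may be of top order and merely in L²; the other is in H¹ and hence in L⁴, and 1/2 +
1/4 = 3/4. -/
theorem productBound_four_thirds {k : ℕ} {p : (Fin 2 → ℕ) × (Fin 2 → ℕ)}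
    (h1 : multiLength p.1 + 1 ≤ k) (h2 : multiLength p.2 ≤ k) :
    ProductBound k (4 / 3) p := by
  obtain ⟨C, hC⟩ := exists_lintegral_pow_le 1 k
  refine ⟨C ^ (1 / 3 : ℝ), fun H hm hH => ?_⟩
  simp only [ENNReal.mul_rpow_of_nonneg _ _ (show (0 : ℝ) ≤ 4 / 3 by norm_num)]
  -- The exponents 3 and 3/2 raise the powers 4/3 to 4 and 2.
  have hconj : Real.HolderConjugate 3 (3 / 2) := by
    rw [Real.holderConjugate_iff]; norm_num
  refine (ENNReal.lintegral_mul_le_Lp_mul_Lq volume hconj ((hm p.1).enorm.pow_const (4 / 3 : ℝ))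
    ((hm p.2).enorm.pow_const (4 / 3 : ℝ))).trans ?_
  have e1 : ∀ x, (‖H p.1 x‖ₑ ^ (4 / 3 : ℝ)) ^ (3 : ℝ) = ‖H p.1 x‖ₑ ^ (2 * (1 + 1)) := by
    intro x; rw [← ENNReal.rpow_mul, ← ENNReal.rpow_natCast]; norm_num
  have e2 : ∀ x, (‖H p.2 x‖ₑ ^ (4 / 3 : ℝ)) ^ (3 / 2 : ℝ) = ‖H p.2 x‖ₑ ^ 2 := by
    intro x; rw [← ENNReal.rpow_mul, ← ENNReal.rpow_natCast]; norm_num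
  simp only [e1, e2]
  calc (∫⁻ x, ‖H p.1 x‖ₑ ^ (2 * (1 + 1))) ^ (1 / 3 : ℝ) *
        (∫⁻ x, ‖H p.2 x‖ₑ ^ 2) ^ (1 / (3 / 2) : ℝ)
      ≤ (C * sobSq k H ^ (1 + 1)) ^ (1 / 3 : ℝ) * sobSq k H ^ (1 / (3 / 2) : ℝ) := by
        gcongr
        · exact hC H hm hH p.1 h1
        · exact lintegral_sq_le_sobSq H h2
    _ = C ^ (1 / 3 : ℝ) * (sobSq k H ^ (2 / 3 : ℝ) * sobSq k H ^ (2 / 3 : ℝ)) := by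
        rw [ENNReal.mul_rpow_of_nonneg _ _ (by norm_num), ← ENNReal.rpow_natCast,
          ← ENNReal.rpow_mul]
        norm_num
        ring
    _ = _ := by
        rw [← ENNReal.rpow_add_of_nonneg _ _ (by norm_num) (by norm_num),
          ENNReal.coe_rpow_of_nonneg _ (by norm_num)]
        norm_num

theorem ProductBound.symm {k : ℕ} {q : ℝ} {p : (Fin 2 → ℕ) × (Fin 2 → ℕ)}
    (h : ProductBound k q p.swap) : ProductBound k q p := by
  obtain ⟨C, hC⟩ := h
  refine ⟨C, fun H hm hH => ?_⟩
  simpa [mul_comm] using hC H hm hH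

/-- The sum `∑ |H_{p₁}| |H_{p₂}|`, which dominates the Leibniz sum. -/
def absLeibnizSum {X : Type*} (s : List ((Fin 2 → ℕ) × (Fin 2 → ℕ))) (H : (Fin 2 → ℕ) → X → ℝ)
    (x : X) : ℝ≥0∞ :=
  (s.map fun p => ‖H p.1 x‖ₑ * ‖H p.2 x‖ₑ).sum

theorem enorm_leibnizSum_le {X : Type*} (s : List ((Fin 2 → ℕ) × (Fin 2 → ℕ)))
    (H : (Fin 2 → ℕ) → X → ℝ) (x : X) : ‖leibnizSum s H x‖ₑ ≤ absLeibnizSum s H x := by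
  induction s with
  | nil => simp [leibnizSum, absLeibnizSum]
  | cons p s ih =>
    simp only [leibnizSum, absLeibnizSum, List.map_cons, List.sum_cons] at ih ⊢
    refine (enorm_add_le _ _).trans ?_
    rw [enorm_mul]
    gcongr

theorem measurable_absLeibnizSum {X : Type*} [MeasurableSpace X]
    (s : List ((Fin 2 → ℕ) × (Fin 2 → ℕ))) {H : (Fin 2 → ℕ) → X → ℝ}
    (hm : ∀ β, Measurable (H β)) : Measurable (absLeibnizSum s H) := by
  unfold absLeibnizSum
  induction s with
  | nil => simp
  | cons p s ih =>
    simp only [List.map_cons, List.sum_cons]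
    exact ((hm p.1).enorm.mul (hm p.2).enorm).add ih

theorem exists_lintegral_absLeibnizSum_le {k : ℕ} {q : ℝ} (hq : 1 ≤ q)
    (s : List ((Fin 2 → ℕ) × (Fin 2 → ℕ))) (hs : ∀ p ∈ s, ProductBound k q p) :
    ∃ C : ℝ≥0, ∀ H : (Fin 2 → ℕ) → Plane → ℝ, (∀ β, Measurable (H β)) →
      IsTestLimit xDir k H → ∫⁻ x, absLeibnizSum s H x ^ q ≤ C * sobSq k H ^ q := by
  have hq0 : 0 < q := by linarith
  induction s with
  | nil => exact ⟨0, fun H _ _ => by simp [absLeibnizSum, hq0]⟩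
  | cons p s ih =>
    obtain ⟨C, hC⟩ := ih fun p hp => hs p (by simp [hp])
    obtain ⟨D, hD⟩ := hs p (by simp)
    refine ⟨2 ^ (q - 1) * (D + C), fun H hm hH => ?_⟩
    have hm1 : Measurable fun x => (‖H p.1 x‖ₑ * ‖H p.2 x‖ₑ) ^ q :=
      ((hm p.1).enorm.mul (hm p.2).enorm).pow_const q
    calc ∫⁻ x, absLeibnizSum (p :: s) H x ^ q
        ≤ ∫⁻ x, 2 ^ (q - 1) * ((‖H p.1 x‖ₑ * ‖H p.2 x‖ₑ) ^ q + absLeibnizSum s H x ^ q) := by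
          apply lintegral_mono
          intro x
          simp only [absLeibnizSum, List.map_cons, List.sum_cons]
          exact ENNReal.rpow_add_le_mul_rpow_add_rpow _ _ hq
      _ = 2 ^ (q - 1) * ((∫⁻ x, (‖H p.1 x‖ₑ * ‖H p.2 x‖ₑ) ^ q) +
            ∫⁻ x, absLeibnizSum s H x ^ q) := by
          rw [lintegral_const_mul' _ _ (ENNReal.rpow_ne_top_of_nonneg (by linarith) (by simp)),
            lintegral_add_left hm1]
      _ ≤ 2 ^ (q - 1) * (D * sobSq k H ^ q + C * sobSq k H ^ q) := by
          gcongr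
          · exact hD H (fun β => (hm β).aestronglyMeasurable) hH
          · exact hC H hm hH
      _ = _ := by
          push_cast
          rw [ENNReal.coe_rpow_of_nonneg _ (by linarith)]
          push_cast
          ring

/-! ### Bounds for convolutions with transported functions -/

theorem lintegral_comp_sub_smul {t : ℝ} (ht : t ≠ 0) (c : Plane) {f : Plane → ℝ≥0∞}
    (hf : Measurable f) :
    ∫⁻ w, f (c - t • w) = ENNReal.ofReal (|t| ^ (-2 : ℝ)) * ∫⁻ x, f x := by
  have h1 : ∫⁻ w, f (c - t • w) = ∫⁻ u, f (c - u) ∂(Measure.map (t • ·) volume) := by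
    have hcm : Measurable fun u => f (c - u) := hf.comp (measurable_const.sub measurable_id)
    rw [lintegral_map hcm (measurable_const_smul t)]
  have h2 : |(t ^ 2)⁻¹| = |t| ^ (-2 : ℝ) := by
    rw [Real.rpow_neg (abs_nonneg t), abs_inv, abs_pow]
    norm_num
  rw [h1, Measure.map_addHaar_smul _ ht, lintegral_smul_measure, lintegral_sub_left_eq_self]
  simp [h2]

/-- The upper bound `∫∫ κ(x - y - t w) Q(y, w) dw dy` for the convolution with a kernel. -/
def kernelBoundIntegral (κ : Plane → ℝ≥0∞) (Q : Plane × Plane → ℝ≥0∞) (t : ℝ) (x : Plane) : ℝ≥0∞ :=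
  ∫⁻ y, ∫⁻ w, κ (x - y - t • w) * Q (y, w)

/-- Undoing the shear by y ↦ y + tw moves t from the transported function to the kernel, where a
rescaling in w can exploit it. -/
theorem enorm_conv_transport_le {K : Plane → ℝ} (hK : Measurable K) {g : Plane × Plane → ℝ}
    {Q : Plane × Plane → ℝ≥0∞} (hQ : Measurable Q) (hgQ : ∀ p, ‖g p‖ₑ ≤ Q p) (t c : ℝ)
    (x : Plane) :
    ‖conv K (fun y => c * transport t g y) x‖ₑ ≤
      ‖c‖ₑ * kernelBoundIntegral (fun z => ‖K z‖ₑ) Q t x := by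
  have hm : Measurable fun p : Plane × Plane => ‖K (x - p.1 - t • p.2)‖ₑ * Q p :=
    (hK.comp (by fun_prop)).enorm.mul hQ
  calc ‖conv K (fun y => c * transport t g y) x‖ₑ
      ≤ ∫⁻ y, ‖K (x - y) * (c * transport t g y)‖ₑ := enorm_integral_le_lintegral_enorm _
    _ ≤ ∫⁻ y, ‖c‖ₑ * ∫⁻ w, ‖K (x - y)‖ₑ * Q (y - t • w, w) := by
        apply lintegral_mono
        intro y
        simp only [enorm_mul]
        rw [mul_left_comm, lintegral_const_mul' _ _ enorm_ne_top]
        gcongr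
        exact (enorm_integral_le_lintegral_enorm _).trans (lintegral_mono fun w => hgQ _)
    _ = ‖c‖ₑ * ∫⁻ y, ∫⁻ w, ‖K (x - (y - t • w) - t • w)‖ₑ * Q (y - t • w, w) := by
        rw [lintegral_const_mul' _ _ enorm_ne_top]
        simp [sub_sub]
    _ = ‖c‖ₑ * ∫⁻ p : Plane × Plane, ‖K (x - p.1 - t • p.2)‖ₑ * Q p := by
        rw [lintegral_shear t hm]
    _ = _ := by
        rw [kernelBoundIntegral, Measure.volume_eq_prod, lintegral_prod _ hm.aemeasurable]

/-- Hölder's inequality in w on each slice: the norm of κ(x - y - tw) in L^p_w is |t|^{-2/p} times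
that of κ, since the Jacobian in the plane is |t|^{-2}. The bound is uniform in x, and y is
integrated last. -/
theorem kernelBoundIntegral_le {κ : Plane → ℝ≥0∞} (hκ : Measurable κ) {Q : Plane × Plane → ℝ≥0∞}
    (hQ : Measurable Q) {p q : ℝ} (hpq : p.HolderConjugate q) {C : ℝ≥0} {n : Plane → ℝ≥0∞}
    (hnm : Measurable n) (hn : ∀ᵐ y, ∫⁻ w, Q (y, w) ^ q ≤ C * n y ^ q) {t : ℝ} (ht : t ≠ 0) (x : Plane) :
    kernelBoundIntegral κ Q t x ≤ ENNReal.ofReal (|t| ^ (-2 / p)) *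
      ((∫⁻ z, κ z ^ p) ^ (1 / p) * (C : ℝ≥0∞) ^ (1 / q)) * ∫⁻ y, n y := by
  have hp := hpq.pos
  have hq := hpq.symm.pos
  calc kernelBoundIntegral κ Q t x
      ≤ ∫⁻ y, ENNReal.ofReal (|t| ^ (-2 / p)) *
          ((∫⁻ z, κ z ^ p) ^ (1 / p) * (C : ℝ≥0∞) ^ (1 / q)) * n y := by
        apply lintegral_mono_ae
        filter_upwards [hn] with y hy
        have hκx : Measurable fun w => κ (x - y - t • w) := hκ.comp (by fun_prop)
        have hQy : Measurable fun w => Q (y, w) := hQ.comp measurable_prodMk_left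
        refine (ENNReal.lintegral_mul_le_Lp_mul_Lq volume hpq hκx.aemeasurable
          hQy.aemeasurable).trans ?_
        rw [lintegral_comp_sub_smul ht (x - y) (f := fun z => κ z ^ p) (hκ.pow_const p),
          ENNReal.mul_rpow_of_nonneg _ _ (by positivity : (0 : ℝ) ≤ 1 / p),
          ENNReal.ofReal_rpow_of_nonneg (by positivity) (by positivity), ← Real.rpow_mul
          (abs_nonneg t), mul_one_div]
        calc ENNReal.ofReal (|t| ^ (-2 / p)) * (∫⁻ z, κ z ^ p) ^ (1 / p) *
              (∫⁻ w, Q (y, w) ^ q) ^ (1 / q)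
            ≤ ENNReal.ofReal (|t| ^ (-2 / p)) * (∫⁻ z, κ z ^ p) ^ (1 / p) *
              (C * n y ^ q) ^ (1 / q) := by gcongr
          _ = _ := by
              rw [ENNReal.mul_rpow_of_nonneg _ _ (by positivity : (0 : ℝ) ≤ 1 / q),
                ← ENNReal.rpow_mul, mul_one_div_cancel hq.ne', ENNReal.rpow_one]
              ring
    _ = _ := lintegral_const_mul _ hnm

/-- Minkowski's integral inequality in `L²`. -/
theorem lintegral_sq_lintegral_le {α γ : Type*} [MeasurableSpace α] [MeasurableSpace γ]
    {μ : Measure α} {ν : Measure γ} [SFinite μ] [SFinite ν] {f : α → γ → ℝ≥0∞}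
    (hf : Measurable (Function.uncurry f)) :
    ∫⁻ x, (∫⁻ y, f x y ∂ν) ^ 2 ∂μ ≤ (∫⁻ y, (∫⁻ x, f x y ^ 2 ∂μ) ^ (1 / 2 : ℝ) ∂ν) ^ 2 := by
  have hfx : ∀ x, Measurable (f x) := fun x => hf.comp measurable_prodMk_left
  have hfy : ∀ y, Measurable fun x => f x y := fun y => hf.comp measurable_prodMk_right
  set N : γ → ℝ≥0∞ := fun y => (∫⁻ x, f x y ^ 2 ∂μ) ^ (1 / 2 : ℝ) with hN
  have hNm : Measurable N := (Measurable.lintegral_prod_left' (hf.pow_const 2)).pow_const _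
  -- The square is written as a double integral so that Cauchy-Schwarz in x applies to each pair (y,
  -- y').
  have hsq : ∀ x, (∫⁻ y, f x y ∂ν) ^ 2 = ∫⁻ y, ∫⁻ y', f x y * f x y' ∂ν ∂ν := by
    intro x
    rw [sq, ← lintegral_mul_const _ (hfx x)]
    congr 1; ext y
    rw [lintegral_const_mul _ (hfx x)]
  have hm3 : Measurable fun q : (α × γ) × γ => f q.1.1 q.1.2 * f q.1.1 q.2 :=
    (hf.comp measurable_fst).mul
      (hf.comp (f := fun q : (α × γ) × γ => (q.1.1, q.2)) (by fun_prop))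
  calc ∫⁻ x, (∫⁻ y, f x y ∂ν) ^ 2 ∂μ
      = ∫⁻ x, ∫⁻ y, ∫⁻ y', f x y * f x y' ∂ν ∂ν ∂μ := by simp only [hsq]
    _ = ∫⁻ y, ∫⁻ x, ∫⁻ y', f x y * f x y' ∂ν ∂μ ∂ν :=
        lintegral_lintegral_swap (Measurable.lintegral_prod_right' hm3).aemeasurable
    _ = ∫⁻ y, ∫⁻ y', ∫⁻ x, f x y * f x y' ∂μ ∂ν ∂ν := by
        congr 1; ext y
        refine lintegral_lintegral_swap (Measurable.aemeasurable ?_)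
        exact ((hfy y).comp measurable_fst).mul hf
    _ ≤ ∫⁻ y, ∫⁻ y', N y * N y' ∂ν ∂ν := by
        apply lintegral_mono
        intro y
        apply lintegral_mono
        intro y'
        exact lintegral_mul_le_sqrt (hfy y).aemeasurable (hfy y').aemeasurable
    _ = (∫⁻ y, N y ∂ν) ^ 2 := by
        rw [sq, ← lintegral_mul_const _ hNm]
        congr 1; ext y
        rw [lintegral_const_mul _ hNm]

/-- Young's inequality `L^{4/3} * L^{4/3} → L²` for a rescaled kernel. -/
theorem lintegral_sq_kernel_le {κ Q : Plane → ℝ≥0∞} (hκ : Measurable κ) (hQ : Measurable Q)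
    {t : ℝ} (ht : t ≠ 0) (y : Plane) :
    ∫⁻ x, (∫⁻ w, κ (x - y - t • w) * Q w) ^ 2 ≤ ENNReal.ofReal (|t| ^ (-1 : ℝ)) *
      (∫⁻ z, κ z ^ (4 / 3 : ℝ)) ^ (3 / 2 : ℝ) * (∫⁻ w, Q w ^ (4 / 3 : ℝ)) ^ (3 / 2 : ℝ) := by
  set A := ∫⁻ z, κ z ^ (4 / 3 : ℝ)
  set B := ∫⁻ w, Q w ^ (4 / 3 : ℝ)
  have hκx : ∀ x, Measurable fun w => κ (x - y - t • w) := fun x => hκ.comp (by fun_prop)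
  have hcs : ∀ x, (∫⁻ w, κ (x - y - t • w) * Q w) ^ 2 ≤
      (∫⁻ w, κ (x - y - t • w) ^ (4 / 3 : ℝ) * Q w ^ (4 / 3 : ℝ)) *
        (ENNReal.ofReal (|t| ^ (-1 : ℝ)) * (A ^ (1 / 2 : ℝ) * B ^ (1 / 2 : ℝ))) := by
    intro x
    set a : Plane → ℝ≥0∞ := fun w => κ (x - y - t • w)
    have ha : Measurable a := hκx x
    -- After Cauchy-Schwarz the first group gives a^{4/3} Q^{4/3}, whose x-integral factorises by
    -- translation. The second gives a^{2/3} Q^{2/3}, and one more Cauchy-Schwarz in w bounds it by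
    -- |t|^{-1} A^{1/2} B^{1/2}.
    have hsplit : ∀ w, a w * Q w = (a w ^ (2 / 3 : ℝ) * Q w ^ (2 / 3 : ℝ)) *
        (a w ^ (1 / 3 : ℝ) * Q w ^ (1 / 3 : ℝ)) := by
      intro w
      rw [mul_mul_mul_comm, ← ENNReal.rpow_add_of_nonneg _ _ (by norm_num) (by norm_num),
        ← ENNReal.rpow_add_of_nonneg _ _ (by norm_num) (by norm_num)]
      norm_num
    have e1 : ∀ b c : ℝ≥0∞, (b ^ (2 / 3 : ℝ) * c ^ (2 / 3 : ℝ)) ^ 2 =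
        b ^ (4 / 3 : ℝ) * c ^ (4 / 3 : ℝ) := by
      intro b c
      rw [mul_pow, ← ENNReal.rpow_natCast, ← ENNReal.rpow_mul, ← ENNReal.rpow_natCast,
        ← ENNReal.rpow_mul]
      norm_num
    have e2 : ∀ b c : ℝ≥0∞, (b ^ (1 / 3 : ℝ) * c ^ (1 / 3 : ℝ)) ^ 2 =
        b ^ (2 / 3 : ℝ) * c ^ (2 / 3 : ℝ) := by
      intro b c
      rw [mul_pow, ← ENNReal.rpow_natCast, ← ENNReal.rpow_mul, ← ENNReal.rpow_natCast,
        ← ENNReal.rpow_mul]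
      norm_num
    have e3 : ∀ b : ℝ≥0∞, (b ^ (2 / 3 : ℝ)) ^ 2 = b ^ (4 / 3 : ℝ) := by
      intro b
      rw [← ENNReal.rpow_natCast, ← ENNReal.rpow_mul]
      norm_num
    calc (∫⁻ w, a w * Q w) ^ 2
        = (∫⁻ w, (a w ^ (2 / 3 : ℝ) * Q w ^ (2 / 3 : ℝ)) *
            (a w ^ (1 / 3 : ℝ) * Q w ^ (1 / 3 : ℝ))) ^ 2 := by simp only [← hsplit]
      _ ≤ (∫⁻ w, a w ^ (4 / 3 : ℝ) * Q w ^ (4 / 3 : ℝ)) *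
            ∫⁻ w, a w ^ (2 / 3 : ℝ) * Q w ^ (2 / 3 : ℝ) := by
          have hm1 : Measurable fun w => a w ^ (2 / 3 : ℝ) * Q w ^ (2 / 3 : ℝ) :=
            (ha.pow_const _).mul (hQ.pow_const _)
          have hm2 : Measurable fun w => a w ^ (1 / 3 : ℝ) * Q w ^ (1 / 3 : ℝ) :=
            (ha.pow_const _).mul (hQ.pow_const _)
          simpa only [e1, e2] using sq_lintegral_mul_le hm1.aemeasurable hm2.aemeasurable
      _ ≤ _ := by
          gcongr
          refine (lintegral_mul_le_sqrt (ha.pow_const (2 / 3 : ℝ)).aemeasurable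
            (hQ.pow_const (2 / 3 : ℝ)).aemeasurable).trans (le_of_eq ?_)
          simp only [e3]
          rw [lintegral_comp_sub_smul ht (x - y) (f := fun z => κ z ^ (4 / 3 : ℝ))
            (hκ.pow_const _), ENNReal.mul_rpow_of_nonneg _ _ (by norm_num),
            ENNReal.ofReal_rpow_of_nonneg (by positivity) (by norm_num),
            ← Real.rpow_mul (abs_nonneg t), mul_assoc]
          norm_num [A, B]
  have hm : Measurable fun q : Plane × Plane =>
      κ (q.1 - y - t • q.2) ^ (4 / 3 : ℝ) * Q q.2 ^ (4 / 3 : ℝ) :=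
    ((hκ.comp (by fun_prop)).pow_const _).mul ((hQ.comp measurable_snd).pow_const _)
  calc ∫⁻ x, (∫⁻ w, κ (x - y - t • w) * Q w) ^ 2
      ≤ ∫⁻ x, (∫⁻ w, κ (x - y - t • w) ^ (4 / 3 : ℝ) * Q w ^ (4 / 3 : ℝ)) *
        (ENNReal.ofReal (|t| ^ (-1 : ℝ)) * (A ^ (1 / 2 : ℝ) * B ^ (1 / 2 : ℝ))) :=
        lintegral_mono hcs
    _ = (∫⁻ x, ∫⁻ w, κ (x - y - t • w) ^ (4 / 3 : ℝ) * Q w ^ (4 / 3 : ℝ)) *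
        (ENNReal.ofReal (|t| ^ (-1 : ℝ)) * (A ^ (1 / 2 : ℝ) * B ^ (1 / 2 : ℝ))) :=
        lintegral_mul_const _ (Measurable.lintegral_prod_right' hm)
    _ = (A * B) * (ENNReal.ofReal (|t| ^ (-1 : ℝ)) * (A ^ (1 / 2 : ℝ) * B ^ (1 / 2 : ℝ))) := by
        rw [lintegral_lintegral_swap hm.aemeasurable]
        congr 1
        rw [← lintegral_const_mul _ (hQ.pow_const _)]
        congr 1; ext w
        have hκw : Measurable fun x : Plane => κ (x - y - t • w) ^ (4 / 3 : ℝ) :=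
          (hκ.comp (by fun_prop)).pow_const _
        rw [lintegral_mul_const _ hκw]
        congr 1
        simp only [sub_sub]
        exact lintegral_sub_right_eq_self (fun x => κ x ^ (4 / 3 : ℝ)) _
    _ = ENNReal.ofReal (|t| ^ (-1 : ℝ)) * (A * A ^ (1 / 2 : ℝ)) * (B * B ^ (1 / 2 : ℝ)) := by ring
    _ = _ := by
        have : ∀ b : ℝ≥0∞, b * b ^ (1 / 2 : ℝ) = b ^ (3 / 2 : ℝ) := by
          intro b
          nth_rewrite 1 [← ENNReal.rpow_one b]
          rw [← ENNReal.rpow_add_of_nonneg _ _ (by norm_num) (by norm_num)]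
          norm_num
        rw [this, this]

/-- Minkowski takes the L² norm in x inside the integral over y, and Young's inequality is applied
on each slice. -/
theorem lintegral_sq_kernelBoundIntegral_le {κ : Plane → ℝ≥0∞} (hκ : Measurable κ)
    {Q : Plane × Plane → ℝ≥0∞} (hQ : Measurable Q) {C : ℝ≥0} {n : Plane → ℝ≥0∞}
    (hnm : Measurable n) (hn : ∀ᵐ y, ∫⁻ w, Q (y, w) ^ (4 / 3 : ℝ) ≤ C * n y ^ (4 / 3 : ℝ)) {t : ℝ} (ht : t ≠ 0) :
    ∫⁻ x, kernelBoundIntegral κ Q t x ^ 2 ≤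
      (ENNReal.ofReal (|t| ^ (-(1 / 2) : ℝ)) *
        ((∫⁻ z, κ z ^ (4 / 3 : ℝ)) ^ (3 / 4 : ℝ) * (C : ℝ≥0∞) ^ (3 / 4 : ℝ)) * ∫⁻ y, n y) ^ 2 := by
  have hm : Measurable (Function.uncurry fun x y : Plane => ∫⁻ w, κ (x - y - t • w) * Q (y, w)) := by
    have : Measurable fun q : (Plane × Plane) × Plane =>
        κ (q.1.1 - q.1.2 - t • q.2) * Q (q.1.2, q.2) :=
      (hκ.comp (by fun_prop)).mul (hQ.comp (by fun_prop))
    exact Measurable.lintegral_prod_right' this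
  refine (lintegral_sq_lintegral_le hm).trans ?_
  gcongr
  rw [← lintegral_const_mul _ hnm]
  apply lintegral_mono_ae
  filter_upwards [hn] with y hy
  calc (∫⁻ x, (∫⁻ w, κ (x - y - t • w) * Q (y, w)) ^ 2) ^ (1 / 2 : ℝ)
      ≤ (ENNReal.ofReal (|t| ^ (-1 : ℝ)) * (∫⁻ z, κ z ^ (4 / 3 : ℝ)) ^ (3 / 2 : ℝ) *
          (C * n y ^ (4 / 3 : ℝ)) ^ (3 / 2 : ℝ)) ^ (1 / 2 : ℝ) := by
        gcongr
        refine (lintegral_sq_kernel_le hκ (hQ.comp measurable_prodMk_left) ht y).trans ?_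
        gcongr
        exact hy
    _ = _ := by
        simp only [ENNReal.mul_rpow_of_nonneg _ _ (show (0 : ℝ) ≤ 1 / 2 by norm_num),
          ENNReal.mul_rpow_of_nonneg _ _ (show (0 : ℝ) ≤ 3 / 2 by norm_num), ← ENNReal.rpow_mul]
        rw [ENNReal.ofReal_rpow_of_nonneg (by positivity) (by norm_num),
          ← Real.rpow_mul (abs_nonneg t)]
        norm_num
        ring

end

end ScreenedVP

namespace ScreenedVP

noncomputable section

open Filter Topology

/-! ### Estimates for the gradient of the potential -/

theorem one_le_japaneseBracket (t : ℝ) : 1 ≤ japaneseBracket t := by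
  rw [japaneseBracket, Real.one_le_sqrt]
  nlinarith [sq_nonneg t]

theorem japaneseBracket_le {τ t : ℝ} (hτ : 0 < τ) (ht : τ ≤ |t|) :
    japaneseBracket t ≤ (1 / τ + 1) * |t| := by
  have h1 : 1 ≤ 1 / τ * |t| := by
    rw [one_div, inv_mul_eq_div, one_le_div hτ]; exact ht
  rw [japaneseBracket]
  apply Real.sqrt_le_iff.2
  refine ⟨by positivity, ?_⟩
  rw [← sq_abs t]
  nlinarith [abs_nonneg t]

/-- For |t| ≥ τ the bracket is at most (1/τ + 1)|t|, so powers of |t| and of the bracket are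
interchangeable. As the bracket is at least 1, any exponent r above the sharp one is admissible too.
-/
theorem exists_enorm_inv_pow_mul_le {τ : ℝ} (hτ : 0 < τ) (m : ℕ) {e r : ℝ} (he : 0 ≤ e)
    (hr : -(m + e) ≤ r) :
    ∃ C : ℝ≥0, ∀ t : ℝ, τ ≤ |t| → ‖(t ^ m)⁻¹‖ₑ * ENNReal.ofReal (|t| ^ (-e)) ≤
      C * ENNReal.ofReal (japaneseBracket t ^ r) := by
  refine ⟨((1 / τ + 1) ^ (m + e)).toNNReal, fun t ht => ?_⟩
  have ht0 : 0 < |t| := hτ.trans_le ht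
  have hj := one_le_japaneseBracket t
  have hκ : 0 < 1 / τ + 1 := by positivity
  rw [← ofReal_norm, ← ENNReal.ofReal_mul (norm_nonneg _), ENNReal.ofNNReal_toNNReal,
    ← ENNReal.ofReal_mul (by positivity)]
  apply ENNReal.ofReal_le_ofReal
  calc ‖(t ^ m)⁻¹‖ * |t| ^ (-e) = |t| ^ (-(m + e)) := by
        rw [norm_inv, norm_pow, Real.norm_eq_abs, ← Real.rpow_natCast, ← Real.rpow_neg ht0.le,
          ← Real.rpow_add ht0]
        ring_nf
    _ ≤ (japaneseBracket t / (1 / τ + 1)) ^ (-(m + e)) := by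
        apply Real.rpow_le_rpow_of_nonpos (by positivity)
        · rw [div_le_iff₀ hκ, mul_comm]
          exact japaneseBracket_le hτ ht
        · have : (0 : ℝ) ≤ m := m.cast_nonneg
          linarith
    _ = (1 / τ + 1) ^ (m + e) * japaneseBracket t ^ (-(m + e)) := by
        rw [Real.div_rpow (by positivity) hκ.le, Real.rpow_neg hκ.le, div_inv_eq_mul, mul_comm]
    _ ≤ (1 / τ + 1) ^ (m + e) * japaneseBracket t ^ r := by
        gcongr

theorem eLpNorm_toLp_le {p : ℝ≥0∞} (hp : 1 ≤ p) {f : Fin 2 → Plane → ℝ}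
    (hf : ∀ j, AEStronglyMeasurable (f j)) :
    eLpNorm (fun x => (WithLp.toLp 2 fun j => f j x : Plane)) p volume ≤
      ∑ j, eLpNorm (f j) p volume := by
  have hb : ∀ x, ‖(WithLp.toLp 2 fun j => f j x : Plane)‖ ≤ ‖‖f 0 x‖ + ‖f 1 x‖‖ := by
    intro x
    rw [EuclideanSpace.norm_eq, Fin.sum_univ_two, Real.norm_of_nonneg (by positivity : (0 : ℝ) ≤
      ‖f 0 x‖ + ‖f 1 x‖)]
    apply Real.sqrt_le_iff.2
    refine ⟨by positivity, ?_⟩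
    nlinarith [norm_nonneg (f 0 x), norm_nonneg (f 1 x)]
  refine (eLpNorm_mono hb).trans ((eLpNorm_add_le (hf 0).norm (hf 1).norm hp).trans ?_)
  rw [Fin.sum_univ_two, eLpNorm_norm, eLpNorm_norm]

/-- Componentwise bounds by the sliced Sobolev norm yield a bound for the whole gradient. -/
theorem exists_gradient_bound {τ : ℝ} {p : ℝ≥0∞} (hp : 1 ≤ p) {α : Fin 2 → ℕ} {k : ℕ} {r : ℝ}
    (hj : ∀ j : Fin 2, ∃ C : ℝ≥0, ∀ t : ℝ, τ ≤ |t| → ∀ (h : Plane × Plane → ℝ) H,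
      SliceFamily k H → H 0 =ᵐ[volume] h → ∃ f : Plane → ℝ,
        IsWeakDeriv xDir (α + Pi.single j 1) (potential h t) f ∧
        eLpNorm f p volume ≤ C * ENNReal.ofReal (japaneseBracket t ^ r) *
          ∫⁻ y, sobSq k (fun β v => H β (y, v))) :
    ∃ C : ℝ≥0, ∀ t : ℝ, τ ≤ |t| → ∀ h : Plane × Plane → ℝ, normL2xHv k h < ⊤ →
      ∃ F : Plane → Plane, IsWeakDerivGrad α (potential h t) F ∧
        eLpNorm F p volume ≤ C * ENNReal.ofReal (japaneseBracket t ^ r) * normL2xHv k h ^ 2 := by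
  choose C hC using hj
  refine ⟨(∑ j, C j) * (multiIdx k).card, fun t ht h hk => ?_⟩
  obtain ⟨H, hH, h0, hn⟩ := exists_sliceFamily hk
  choose f hf hfC using fun j => hC j t ht h H hH h0
  refine ⟨fun x => WithLp.toLp 2 fun j => f j x, hf, ?_⟩
  calc eLpNorm (fun x => (WithLp.toLp 2 fun j => f j x : Plane)) p volume
      ≤ ∑ j, eLpNorm (f j) p volume :=
        eLpNorm_toLp_le hp fun j => (hf j).2.1.aestronglyMeasurable
    _ ≤ ∑ j, C j * ENNReal.ofReal (japaneseBracket t ^ r) *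
          ∫⁻ y, sobSq k (fun β v => H β (y, v)) := Finset.sum_le_sum fun j _ => hfC j
    _ = (∑ j, C j : ℝ≥0) * ENNReal.ofReal (japaneseBracket t ^ r) *
          ∫⁻ y, sobSq k (fun β v => H β (y, v)) := by
        push_cast
        rw [Finset.sum_mul, Finset.sum_mul]
    _ ≤ (∑ j, C j : ℝ≥0) * ENNReal.ofReal (japaneseBracket t ^ r) *
          ((multiIdx k).card * normL2xHv k h ^ 2) := by gcongr
    _ = _ := by push_cast; ring

theorem SliceFamily.isWeakDeriv_conv_green {k : ℕ} {H : (Fin 2 → ℕ) → Plane × Plane → ℝ}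
    (hH : SliceFamily k H) {h : Plane × Plane → ℝ} (h0 : H 0 =ᵐ[volume] h) {β : Fin 2 → ℕ}
    (hβ : multiLength β ≤ k) {s : List ((Fin 2 → ℕ) × (Fin 2 → ℕ))} (hs : ∀ p ∈ s, p.1 + p.2 = β)
    (hleib : ∀ f g : Plane → ℝ, ContDiff ℝ ∞ f → ContDiff ℝ ∞ g →
      multiDeriv xDir β (fun x => f x * g x) =
        fun x => (s.map fun p => multiDeriv xDir p.1 f x * multiDeriv xDir p.2 g x).sum)
    {t : ℝ} (ht : t ≠ 0) :
    IsWeakDeriv xDir β (potential h t)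
      (conv green fun x => (t ^ multiLength β)⁻¹ * transport t (leibnizSum s H) x) := by
  rw [potential_eq_conv h0]
  exact (hH.isWeakDeriv_transport hβ hs hleib ht).conv_right integrable_green
    (integrable_transport hH.integrable_sq t)
    ((integrable_transport (hH.integrable_leibnizSum hβ hs) t).const_mul _)

theorem SliceFamily.isWeakDeriv_conv_greenGrad {k : ℕ} {H : (Fin 2 → ℕ) → Plane × Plane → ℝ}
    (hH : SliceFamily k H) {h : Plane × Plane → ℝ} (h0 : H 0 =ᵐ[volume] h) {β : Fin 2 → ℕ}
    (hβ : multiLength β ≤ k) {s : List ((Fin 2 → ℕ) × (Fin 2 → ℕ))} (hs : ∀ p ∈ s, p.1 + p.2 = β)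
    (hleib : ∀ f g : Plane → ℝ, ContDiff ℝ ∞ f → ContDiff ℝ ∞ g →
      multiDeriv xDir β (fun x => f x * g x) =
        fun x => (s.map fun p => multiDeriv xDir p.1 f x * multiDeriv xDir p.2 g x).sum)
    {t : ℝ} (ht : t ≠ 0) (j : Fin 2) :
    IsWeakDeriv xDir (β + Pi.single j 1) (potential h t)
      (conv (greenGrad j) fun x => (t ^ multiLength β)⁻¹ * transport t (leibnizSum s H) x) :=
  (hH.isWeakDeriv_conv_green h0 hβ hs hleib ht).trans_single (ScreenedVP.isWeakDeriv_conv_green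
    ((integrable_transport (hH.integrable_leibnizSum hβ hs) t).const_mul _) j)

theorem SliceFamily.ae_lintegral_absLeibnizSum_le {k : ℕ} {q : ℝ} {C : ℝ≥0}
    {s : List ((Fin 2 → ℕ) × (Fin 2 → ℕ))}
    (hC : ∀ H : (Fin 2 → ℕ) → Plane → ℝ, (∀ β, Measurable (H β)) →
      IsTestLimit xDir k H → ∫⁻ x, absLeibnizSum s H x ^ q ≤ C * sobSq k H ^ q)
    {H : (Fin 2 → ℕ) → Plane × Plane → ℝ} (hH : SliceFamily k H) :
    ∀ᵐ y, ∫⁻ w, absLeibnizSum s H (y, w) ^ q ≤ C * sobSq k (fun β v => H β (y, v)) ^ q := by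
  filter_upwards [hH.slice] with y hy
  exact hC _ (fun β => (hH.measurable β).measurable.comp measurable_prodMk_left) hy

/-- Two gains multiply: |t|^{-m} from m differentiations of the velocity average and |t|^{-2/p} from
rescaling the kernel. -/
theorem exists_eLpNorm_top_conv_le {τ : ℝ} (hτ : 0 < τ) {k m : ℕ} {p q r : ℝ}
    (hpq : p.HolderConjugate q) {K : Plane → ℝ} (hK : Measurable K)
    (hKp : ∫⁻ z, ‖K z‖ₑ ^ p < ⊤) {s : List ((Fin 2 → ℕ) × (Fin 2 → ℕ))}
    (hs : ∀ a ∈ s, ProductBound k q a) (hr : -(m + 2 / p) ≤ r) :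
    ∃ C : ℝ≥0, ∀ t : ℝ, τ ≤ |t| → ∀ H, SliceFamily k H →
      eLpNorm (conv K fun x => (t ^ m)⁻¹ * transport t (leibnizSum s H) x) ⊤ volume ≤
        C * ENNReal.ofReal (japaneseBracket t ^ r) *
          ∫⁻ y, sobSq k (fun β v => H β (y, v)) := by
  obtain ⟨C, hC⟩ := exists_lintegral_absLeibnizSum_le hpq.symm.lt.le s hs
  have hp := hpq.pos
  have hq := hpq.symm.pos
  obtain ⟨D, hD⟩ := exists_enorm_inv_pow_mul_le hτ m (e := 2 / p) (by positivity) hr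
  have hfin : (∫⁻ z, ‖K z‖ₑ ^ p) ^ (1 / p) * (C : ℝ≥0∞) ^ (1 / q) ≠ ⊤ :=
    ENNReal.mul_ne_top (ENNReal.rpow_ne_top_of_nonneg (by positivity) hKp.ne)
      (ENNReal.rpow_ne_top_of_nonneg (by positivity) ENNReal.coe_ne_top)
  lift (∫⁻ z, ‖K z‖ₑ ^ p) ^ (1 / p) * (C : ℝ≥0∞) ^ (1 / q) to ℝ≥0 using hfin with A hA
  refine ⟨D * A, fun t ht H hH => ?_⟩
  have ht0 : t ≠ 0 := abs_pos.1 (hτ.trans_le ht)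
  refine (eLpNorm_exponent_top (μ := volume)).le.trans (essSup_le_of_ae_le _ (.of_forall fun x => ?_))
  have hQ : Measurable (absLeibnizSum s H) :=
    measurable_absLeibnizSum s fun β => (hH.measurable β).measurable
  calc ‖conv K (fun x => (t ^ m)⁻¹ * transport t (leibnizSum s H) x) x‖ₑ
      ≤ ‖(t ^ m)⁻¹‖ₑ * kernelBoundIntegral (fun z => ‖K z‖ₑ) (absLeibnizSum s H) t x :=
        enorm_conv_transport_le hK hQ (enorm_leibnizSum_le s H) t _ x
    _ ≤ ‖(t ^ m)⁻¹‖ₑ * (ENNReal.ofReal (|t| ^ (-2 / p)) * A *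
          ∫⁻ y, sobSq k (fun β v => H β (y, v))) := by
        gcongr
        rw [hA]
        exact kernelBoundIntegral_le hK.enorm hQ hpq (measurable_sobSq_slice hH.measurable k)
          (hH.ae_lintegral_absLeibnizSum_le hC) ht0 x
    _ = (‖(t ^ m)⁻¹‖ₑ * ENNReal.ofReal (|t| ^ (-(2 / p)))) * A *
          ∫⁻ y, sobSq k (fun β v => H β (y, v)) := by
        rw [neg_div]; ring
    _ ≤ (D * ENNReal.ofReal (japaneseBracket t ^ r)) * A *
          ∫⁻ y, sobSq k (fun β v => H β (y, v)) := by
        gcongr ?_ * _ * _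
        exact hD t ht
    _ = _ := by push_cast; ring

theorem exists_eLpNorm_two_conv_le {τ : ℝ} (hτ : 0 < τ) {k m : ℕ} {r : ℝ} {K : Plane → ℝ}
    (hK : Measurable K) (hKp : ∫⁻ z, ‖K z‖ₑ ^ (4 / 3 : ℝ) < ⊤)
    {s : List ((Fin 2 → ℕ) × (Fin 2 → ℕ))} (hs : ∀ a ∈ s, ProductBound k (4 / 3) a)
    (hr : -(m + 1 / 2) ≤ r) :
    ∃ C : ℝ≥0, ∀ t : ℝ, τ ≤ |t| → ∀ H, SliceFamily k H →
      eLpNorm (conv K fun x => (t ^ m)⁻¹ * transport t (leibnizSum s H) x) 2 volume ≤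
        C * ENNReal.ofReal (japaneseBracket t ^ r) *
          ∫⁻ y, sobSq k (fun β v => H β (y, v)) := by
  obtain ⟨C, hC⟩ := exists_lintegral_absLeibnizSum_le (by norm_num) s hs
  obtain ⟨D, hD⟩ := exists_enorm_inv_pow_mul_le hτ m (e := 1 / 2) (by positivity) hr
  have hfin : (∫⁻ z, ‖K z‖ₑ ^ (4 / 3 : ℝ)) ^ (3 / 4 : ℝ) * (C : ℝ≥0∞) ^ (3 / 4 : ℝ) ≠ ⊤ :=
    ENNReal.mul_ne_top (ENNReal.rpow_ne_top_of_nonneg (by positivity) hKp.ne)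
      (ENNReal.rpow_ne_top_of_nonneg (by positivity) ENNReal.coe_ne_top)
  lift (∫⁻ z, ‖K z‖ₑ ^ (4 / 3 : ℝ)) ^ (3 / 4 : ℝ) * (C : ℝ≥0∞) ^ (3 / 4 : ℝ) to ℝ≥0 using hfin
    with A hA
  refine ⟨D * A, fun t ht H hH => ?_⟩
  have ht0 : t ≠ 0 := abs_pos.1 (hτ.trans_le ht)
  have hQ : Measurable (absLeibnizSum s H) :=
    measurable_absLeibnizSum s fun β => (hH.measurable β).measurable
  rw [← ENNReal.pow_le_pow_left_iff two_ne_zero, eLpNorm_two_sq]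
  calc ∫⁻ x, ‖conv K (fun x => (t ^ m)⁻¹ * transport t (leibnizSum s H) x) x‖ₑ ^ 2
      ≤ ∫⁻ x, ‖(t ^ m)⁻¹‖ₑ ^ 2 *
          kernelBoundIntegral (fun z => ‖K z‖ₑ) (absLeibnizSum s H) t x ^ 2 := by
        apply lintegral_mono
        intro x
        simp only [← mul_pow]
        gcongr
        exact enorm_conv_transport_le hK hQ (enorm_leibnizSum_le s H) t _ x
    _ = ‖(t ^ m)⁻¹‖ₑ ^ 2 *
          ∫⁻ x, kernelBoundIntegral (fun z => ‖K z‖ₑ) (absLeibnizSum s H) t x ^ 2 :=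
        lintegral_const_mul' _ _ (ENNReal.pow_ne_top enorm_ne_top)
    _ ≤ ‖(t ^ m)⁻¹‖ₑ ^ 2 * (ENNReal.ofReal (|t| ^ (-(1 / 2) : ℝ)) * A *
          ∫⁻ y, sobSq k (fun β v => H β (y, v))) ^ 2 := by
        gcongr
        rw [hA]
        exact lintegral_sq_kernelBoundIntegral_le hK.enorm hQ
          (measurable_sobSq_slice hH.measurable k) (hH.ae_lintegral_absLeibnizSum_le hC) ht0
    _ = ((‖(t ^ m)⁻¹‖ₑ * ENNReal.ofReal (|t| ^ (-(1 / 2) : ℝ))) * A *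
          ∫⁻ y, sobSq k (fun β v => H β (y, v))) ^ 2 := by ring
    _ ≤ ((D * ENNReal.ofReal (japaneseBracket t ^ r)) * A *
          ∫⁻ y, sobSq k (fun β v => H β (y, v))) ^ 2 := by
        gcongr (?_ * _ * _) ^ 2
        exact hD t ht
    _ = _ := by push_cast; ring

/-- Conjugate exponents `p < 2`, `q = m + 1` with `q` so large that `2 / p ≥ 2 - δ`. -/
theorem exists_holderConjugate {δ : ℝ} (hδ : 0 < δ) :
    ∃ (m : ℕ) (p : ℝ), p.HolderConjugate ((m + 1 : ℕ) : ℝ) ∧ 1 ≤ p ∧ p < 2 ∧ 2 - δ ≤ 2 / p := by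
  -- With q = n + 3 and p = (n+3)/(n+2) one has 2/p = 2 - 2/(n+3), and n > 2/δ makes the loss
  -- smaller than δ.
  obtain ⟨n, hn⟩ := exists_nat_gt (2 / δ)
  have hn0 : (0 : ℝ) ≤ n := n.cast_nonneg
  have hpq : ((n + 3 : ℝ) / (n + 2)).HolderConjugate ((n + 2 + 1 : ℕ) : ℝ) := by
    rw [Real.holderConjugate_iff]
    push_cast
    refine ⟨by rw [lt_div_iff₀] <;> linarith, ?_⟩
    field_simp
    ring
  refine ⟨n + 2, (n + 3) / (n + 2), hpq, hpq.lt.le, by rw [div_lt_iff₀] <;> linarith, ?_⟩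
  rw [div_lt_iff₀ hδ] at hn
  rw [div_div_eq_mul_div, le_div_iff₀ (by linarith)]
  nlinarith

/-- The gradient falls on the Green function and ∂^α on the density. The norm carries one derivative
more than |α|, so that every factor of a Leibniz term is in H¹. -/
theorem exists_gradient_bound_top {τ : ℝ} (hτ : 0 < τ) {δ : ℝ} (hδ : 0 < δ) (α : Fin 2 → ℕ) :
    ∃ C : ℝ≥0, ∀ t : ℝ, τ ≤ |t| → ∀ h : Plane × Plane → ℝ,
      normL2xHv (multiLength α + 1) h < ⊤ →
      ∃ F : Plane → Plane, IsWeakDerivGrad α (potential h t) F ∧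
        eLpNorm F ⊤ volume ≤
          C * ENNReal.ofReal (japaneseBracket t ^ (-2 - (multiLength α : ℝ) + δ)) *
            normL2xHv (multiLength α + 1) h ^ 2 := by
  obtain ⟨m, p, hpq, hp1, hp2, hpδ⟩ := exists_holderConjugate hδ
  obtain ⟨s, hs, hleib⟩ := exists_leibniz xDir α
  refine exists_gradient_bound le_top fun j => ?_
  obtain ⟨C, hC⟩ := exists_eLpNorm_top_conv_le hτ (k := multiLength α + 1) (m := multiLength α)
    (r := -2 - (multiLength α : ℝ) + δ) hpq
    (measurable_greenGrad j) (lintegral_greenGrad_rpow_lt_top j hp1 hp2) (s := s)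
    (fun a ha => by
      have := multiLength_le_of_add_eq (hs a ha)
      exact productBound_of_lt m (by omega) (by omega)) (by linarith)
  refine ⟨C, fun t ht h H hH h0 => ⟨_, hH.isWeakDeriv_conv_greenGrad h0 (by omega) hs hleib
    (abs_pos.1 (hτ.trans_le ht)) j, hC t ht H hH⟩⟩

/-- All |α| + 1 derivatives fall on the density: one more power of 1/t for one more v-derivative,
against the undifferentiated Green function. -/
theorem exists_gradient_bound_top' {τ : ℝ} (hτ : 0 < τ) {δ : ℝ} (hδ : 0 < δ) (α : Fin 2 → ℕ) :
    ∃ C : ℝ≥0, ∀ t : ℝ, τ ≤ |t| → ∀ h : Plane × Plane → ℝ,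
      normL2xHv (multiLength α + 2) h < ⊤ →
      ∃ F : Plane → Plane, IsWeakDerivGrad α (potential h t) F ∧
        eLpNorm F ⊤ volume ≤
          C * ENNReal.ofReal (japaneseBracket t ^ (-3 - (multiLength α : ℝ) + δ)) *
            normL2xHv (multiLength α + 2) h ^ 2 := by
  obtain ⟨m, p, hpq, hp1, hp2, hpδ⟩ := exists_holderConjugate hδ
  refine exists_gradient_bound le_top fun j => ?_
  obtain ⟨s, hs, hleib⟩ := exists_leibniz xDir (α + Pi.single j 1)
  have hlen : multiLength (α + Pi.single j 1) = multiLength α + 1 := by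
    rw [multiLength_add, multiLength_single]
  obtain ⟨C, hC⟩ := exists_eLpNorm_top_conv_le hτ (k := multiLength α + 2)
    (m := multiLength (α + Pi.single j 1)) (r := -3 - (multiLength α : ℝ) + δ) hpq
    measurable_green (lintegral_green_rpow_lt_top hp1 hp2) (s := s)
    (fun a ha => by
      have := multiLength_le_of_add_eq (hs a ha)
      exact productBound_of_lt m (by omega) (by omega)) (by rw [hlen]; push_cast; linarith)
  refine ⟨C, fun t ht h H hH h0 => ⟨_, hH.isWeakDeriv_conv_green h0 (by omega) hs hleib
    (abs_pos.1 (hτ.trans_le ht)), hC t ht H hH⟩⟩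

theorem exists_gradient_bound_two {τ : ℝ} (hτ : 0 < τ) {α : Fin 2 → ℕ} (hα : 2 ≤ multiLength α) :
    ∃ C : ℝ≥0, ∀ t : ℝ, τ ≤ |t| → ∀ h : Plane × Plane → ℝ, normL2xHv (multiLength α) h < ⊤ →
      ∃ F : Plane → Plane, IsWeakDerivGrad α (potential h t) F ∧
        eLpNorm F 2 volume ≤
          C * ENNReal.ofReal (japaneseBracket t ^ (-(1 / 2) - (multiLength α : ℝ))) *
            normL2xHv (multiLength α) h ^ 2 := by
  obtain ⟨s, hs, hleib⟩ := exists_leibniz xDir α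
  refine exists_gradient_bound one_le_two fun j => ?_
  obtain ⟨C, hC⟩ := exists_eLpNorm_two_conv_le hτ (k := multiLength α) (m := multiLength α)
    (r := -(1 / 2) - (multiLength α : ℝ)) (measurable_greenGrad j)
    (lintegral_greenGrad_rpow_lt_top j (by norm_num) (by norm_num)) (s := s)
    -- The orders of the two factors add up to |α|, so at most one has top order; the symmetric
    -- bound treats the case in which it is the first.
    (fun a ha => by
      have h1 : multiLength a.1 + multiLength a.2 = multiLength α := by
        rw [← multiLength_add, hs a ha]
      by_cases h2 : multiLength a.1 + 1 ≤ multiLength α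
      · exact productBound_four_thirds h2 (by omega)
      · exact (productBound_four_thirds (p := a.swap) (by simp; omega) (by simp; omega)).symm)
    (by linarith)
  refine ⟨C, fun t ht h H hH h0 => ⟨_, hH.isWeakDeriv_conv_greenGrad h0 le_rfl hs hleib
    (abs_pos.1 (hτ.trans_le ht)) j, hC t ht H hH⟩⟩

end

end ScreenedVP

namespace ScreenedVP

noncomputable section

open Filter Topology

/-! ### The decay of the density -/

/-- Exceptional null sets of velocities pull back to null sets of positions x under x ↦ (x - y)/t.
-/
theorem quasiMeasurePreserving_smul_sub {c : ℝ} (hc : c ≠ 0) (y : Plane) :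
    Measure.QuasiMeasurePreserving (fun x : Plane => c • (x - y)) volume volume := by
  have h1 : Measure.QuasiMeasurePreserving (fun x : Plane => c • x) volume volume := by
    refine ⟨measurable_const_smul c, ?_⟩
    rw [Measure.map_addHaar_smul _ hc]
    exact Measure.smul_absolutelyContinuous
  exact h1.comp (measurePreserving_sub_right volume y).quasiMeasurePreserving

theorem ae_lintegral_sq_le_normZ_sq {h H₀ : Plane × Plane → ℝ} (h0 : H₀ =ᵐ[volume] h) :
    ∀ᵐ v : Plane, ∫⁻ y, ‖H₀ (y, v)‖ₑ ^ 2 ≤ normZ h ^ 2 := by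
  have hsw : ∀ᵐ v : Plane, ∀ᵐ y : Plane, H₀ (y, v) = h (y, v) := by
    have := (Measure.measurePreserving_swap (μ := (volume : Measure Plane))
      (ν := (volume : Measure Plane))).quasiMeasurePreserving.ae h0
    exact Measure.ae_ae_of_ae_prod this
  filter_upwards [hsw, ENNReal.ae_le_essSup
      fun v : Plane => eLpNorm (fun x : Plane => h (x, v)) 2 volume]
    with v hv hle
  rw [← eLpNorm_two_sq, eLpNorm_congr_ae hv]
  gcongr
  exact hle

/-- The velocity (x - y)/t is compared with x/t, which no longer depends on y; only then is the
first integral of the form controlled by the Z norm. -/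
theorem enorm_transport_sq_le {t : ℝ} (ht : t ≠ 0) {H₀ : Plane × Plane → ℝ} (hm : Measurable H₀)
    (x : Plane) :
    ‖transport t (fun p => H₀ p ^ 2) x‖ₑ ≤ ENNReal.ofReal (|t| ^ (-2 : ℝ)) *
      ((∫⁻ y, ‖H₀ (y, t⁻¹ • x)‖ₑ ^ 2) +
        ∫⁻ y, ‖H₀ (y, t⁻¹ • (x - y)) ^ 2 - H₀ (y, t⁻¹ • x) ^ 2‖ₑ) := by
  have hm1 : Measurable fun y => ‖H₀ (y, t⁻¹ • (x - y))‖ₑ ^ 2 :=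
    (hm.comp (f := fun y => (y, t⁻¹ • (x - y))) (by fun_prop)).enorm.pow_const 2
  have hm2 : Measurable fun y => ‖H₀ (y, t⁻¹ • x)‖ₑ ^ 2 :=
    (hm.comp (f := fun y => (y, t⁻¹ • x)) (by fun_prop)).enorm.pow_const 2
  calc ‖transport t (fun p => H₀ p ^ 2) x‖ₑ
      ≤ ∫⁻ w, ‖H₀ (x - t • w, w) ^ 2‖ₑ := enorm_integral_le_lintegral_enorm _
    -- The velocity is rewritten as (x - y)/t with y = x - tw, so that the integrand depends on y
    -- alone.
    _ = ∫⁻ w, ‖H₀ (x - t • w, t⁻¹ • (x - (x - t • w)))‖ₑ ^ 2 := by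
        simp [enorm_pow, smul_smul, ht]
    _ = ENNReal.ofReal (|t| ^ (-2 : ℝ)) * ∫⁻ y, ‖H₀ (y, t⁻¹ • (x - y))‖ₑ ^ 2 :=
        lintegral_comp_sub_smul ht x hm1
    _ ≤ _ := by
        gcongr
        rw [← lintegral_add_left hm2]
        apply lintegral_mono
        intro y
        simp only [← enorm_pow]
        calc ‖H₀ (y, t⁻¹ • (x - y)) ^ 2‖ₑ
            = ‖H₀ (y, t⁻¹ • x) ^ 2 + (H₀ (y, t⁻¹ • (x - y)) ^ 2 - H₀ (y, t⁻¹ • x) ^ 2)‖ₑ := by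
              rw [add_sub_cancel]
          _ ≤ _ := enorm_add_le _ _

/-- The Hölder increment is |y/t|^{1/2}. Its factor |y|^{1/2} combines with ‖h(y,·)‖^{1/2} into the
weighted norm of xh, and |t|^{-1/2} is the gain. -/
theorem exists_ae_lintegral_enorm_sq_sub_sq_le :
    ∃ C : ℝ≥0, ∀ t : ℝ, t ≠ 0 → ∀ H, SliceFamily 2 H → ∀ᵐ x : Plane,
      ∫⁻ y, ‖H 0 (y, t⁻¹ • (x - y)) ^ 2 - H 0 (y, t⁻¹ • x) ^ 2‖ₑ ≤
        C * ENNReal.ofReal (|t| ^ (-(1 / 2) : ℝ)) *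
          ((∫⁻ p : Plane × Plane, (‖p.1‖ₑ * ‖H 0 p‖ₑ) ^ 2) ^ (1 / 4 : ℝ) *
            (∫⁻ y, sobSq 2 (fun β v => H β (y, v))) ^ (3 / 4 : ℝ)) := by
  obtain ⟨C, hC⟩ := exists_enorm_sq_sub_sq_le
  refine ⟨C, fun t ht H hH => ?_⟩
  have hm : Measurable (H 0) := (hH.measurable 0).measurable
  set A : Plane → ℝ≥0∞ := fun y => ∫⁻ v, ‖H 0 (y, v)‖ₑ ^ 2
  set N : Plane → ℝ≥0∞ := fun y => sobSq 2 (fun β v => H β (y, v)) with hN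
  have hAm : Measurable A := (hm.enorm.pow_const 2).lintegral_prod_right'
  have hNm : Measurable N := measurable_sobSq_slice hH.measurable 2
  have hb : ∀ᵐ y : Plane, ∀ᵐ x : Plane,
      ‖H 0 (y, t⁻¹ • (x - y)) ^ 2 - H 0 (y, t⁻¹ • x) ^ 2‖ₑ ≤
        C * (‖t⁻¹ • y‖ₑ ^ (1 / 2 : ℝ) * A y ^ (1 / 4 : ℝ) * N y ^ (3 / 4 : ℝ)) := by
    filter_upwards [hH.slice, ae_lt_top hNm hH.finite] with y hy hfin
    obtain ⟨E, hE, hEb⟩ := hC _ (fun β =>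
      ((hH.measurable β).measurable.comp measurable_prodMk_left).aestronglyMeasurable) hy hfin.ne
    have hq := fun z : Plane => (quasiMeasurePreserving_smul_sub (inv_ne_zero ht) z).ae hE
    filter_upwards [hq y, hq 0] with x hx1 hx2
    rw [sub_zero] at hx2
    refine (hEb _ hx1 _ hx2).trans (le_of_eq ?_)
    rw [← smul_sub, sub_sub_cancel_left, smul_neg, enorm_neg]
    rfl
  have hms : MeasurableSet {q : Plane × Plane |
      ‖H 0 (q.1, t⁻¹ • (q.2 - q.1)) ^ 2 - H 0 (q.1, t⁻¹ • q.2) ^ 2‖ₑ ≤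
        C * (‖t⁻¹ • q.1‖ₑ ^ (1 / 2 : ℝ) * A q.1 ^ (1 / 4 : ℝ) * N q.1 ^ (3 / 4 : ℝ))} := by
    apply measurableSet_le
    · exact (((hm.comp (f := fun q : Plane × Plane => (q.1, t⁻¹ • (q.2 - q.1)))
        (by fun_prop)).pow_const 2).sub ((hm.comp (f := fun q : Plane × Plane =>
        (q.1, t⁻¹ • q.2)) (by fun_prop)).pow_const 2)).enorm
    · exact (((measurable_fst.const_smul t⁻¹).enorm.pow_const _).mul
        ((hAm.comp measurable_fst).pow_const _)).mul
        ((hNm.comp measurable_fst).pow_const _) |>.const_mul _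
  -- The exceptional sets of x depend on y; measurability of the set of good pairs allows the two
  -- quantifiers to be exchanged.
  rw [Measure.ae_ae_comm hms] at hb
  have ht2 : ‖t⁻¹‖ₑ ^ (1 / 2 : ℝ) = ENNReal.ofReal (|t| ^ (-(1 / 2) : ℝ)) := by
    rw [← ofReal_norm, ENNReal.ofReal_rpow_of_nonneg (norm_nonneg _) (by norm_num), norm_inv,
      Real.norm_eq_abs, Real.inv_rpow (abs_nonneg t), Real.rpow_neg (abs_nonneg t)]
  have hmul : ∫⁻ p : Plane × Plane, (‖p.1‖ₑ * ‖H 0 p‖ₑ) ^ 2 = ∫⁻ y, ‖y‖ₑ ^ 2 * A y := by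
    have hmp : Measurable fun p : Plane × Plane => (‖p.1‖ₑ * ‖H 0 p‖ₑ) ^ 2 :=
      (measurable_fst.enorm.mul hm.enorm).pow_const 2
    rw [Measure.volume_eq_prod, lintegral_prod _ hmp.aemeasurable]
    congr 1; ext y
    simp only [mul_pow]
    exact lintegral_const_mul' _ _ (ENNReal.pow_ne_top enorm_ne_top)
  -- The exponents match the powers 1/4 and 3/4 and make both factors integrable.
  have hconj : Real.HolderConjugate 4 (4 / 3) := by
    rw [Real.holderConjugate_iff]; norm_num
  have hm1 : Measurable fun y : Plane => (‖y‖ₑ ^ 2 * A y) ^ (1 / 4 : ℝ) :=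
    ((measurable_id.enorm.pow_const 2).mul hAm).pow_const _
  have hm2 : Measurable fun y : Plane => N y ^ (3 / 4 : ℝ) := hNm.pow_const _
  filter_upwards [hb] with x hx
  calc ∫⁻ y, ‖H 0 (y, t⁻¹ • (x - y)) ^ 2 - H 0 (y, t⁻¹ • x) ^ 2‖ₑ
      ≤ ∫⁻ y, C * (‖t⁻¹ • y‖ₑ ^ (1 / 2 : ℝ) * A y ^ (1 / 4 : ℝ) * N y ^ (3 / 4 : ℝ)) :=
        lintegral_mono_ae hx
    _ = ∫⁻ y, C * ENNReal.ofReal (|t| ^ (-(1 / 2) : ℝ)) *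
          ((‖y‖ₑ ^ 2 * A y) ^ (1 / 4 : ℝ) * N y ^ (3 / 4 : ℝ)) := by
        congr 1; ext y
        rw [enorm_smul, ENNReal.mul_rpow_of_nonneg _ _ (by norm_num : (0 : ℝ) ≤ 1 / 2), ht2,
          ENNReal.mul_rpow_of_nonneg _ _ (by norm_num : (0 : ℝ) ≤ 1 / 4), ← ENNReal.rpow_natCast,
          ← ENNReal.rpow_mul]
        norm_num
        ring
    _ = C * ENNReal.ofReal (|t| ^ (-(1 / 2) : ℝ)) *
          ∫⁻ y, (‖y‖ₑ ^ 2 * A y) ^ (1 / 4 : ℝ) * N y ^ (3 / 4 : ℝ) :=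
        lintegral_const_mul' _ _ (ENNReal.mul_ne_top ENNReal.coe_ne_top ENNReal.ofReal_ne_top)
    _ ≤ _ := by
        gcongr
        rw [hmul]
        refine (ENNReal.lintegral_mul_le_Lp_mul_Lq volume hconj hm1.aemeasurable
          hm2.aemeasurable).trans (le_of_eq ?_)
        simp only [← ENNReal.rpow_mul]
        norm_num

theorem density_ae_eq_transport {h H₀ : Plane × Plane → ℝ} (h0 : H₀ =ᵐ[volume] h) (t : ℝ) :
    density h t =ᵐ[volume] transport t fun p => H₀ p ^ 2 :=
  (transport_congr_ae (h0.fun_comp (· ^ 2)) t).symm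

theorem lintegral_fst_mul_sq {h H₀ : Plane × Plane → ℝ} (h0 : H₀ =ᵐ[volume] h) :
    ∫⁻ p : Plane × Plane, (‖p.1‖ₑ * ‖H₀ p‖ₑ) ^ 2 =
      eLpNorm (fun p : Plane × Plane => ‖p.1‖ * h p) 2 volume ^ 2 := by
  rw [eLpNorm_two_sq]
  apply lintegral_congr_ae
  filter_upwards [h0] with p hp
  rw [enorm_mul, enorm_norm, hp]

theorem exists_eLpNorm_density_le {τ : ℝ} (hτ : 0 < τ) :
    ∃ C : ℝ≥0, ∀ t : ℝ, τ ≤ |t| → ∀ h : Plane × Plane → ℝ,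
      eLpNorm (density h t) ⊤ volume ≤
        C * ENNReal.ofReal (japaneseBracket t ^ (-2 : ℝ)) * normZ' t h ^ 2 := by
  obtain ⟨C, hC⟩ := exists_ae_lintegral_enorm_sq_sub_sq_le
  obtain ⟨D, hD⟩ := exists_enorm_inv_pow_mul_le hτ 0 (e := 2) (r := -2) (by norm_num) (by norm_num)
  obtain ⟨D', hD'⟩ := exists_enorm_inv_pow_mul_le hτ 0 (e := 5 / 2) (r := -(5 / 2)) (by norm_num)
    (by norm_num)
  simp only [pow_zero, inv_one, enorm_one, one_mul] at hD hD'
  set c : ℝ≥0 := ((multiIdx 2).card : ℝ≥0) with hc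
  -- The summand 1 keeps the constant positive, so that the right-hand side is infinite whenever the
  -- Z' norm is.
  refine ⟨1 + D + D' * C * c ^ (3 / 4 : ℝ), fun t ht h => ?_⟩
  have ht0 : t ≠ 0 := abs_pos.1 (hτ.trans_le ht)
  have htpos : 0 < |t| := abs_pos.2 ht0
  have hj : 0 < japaneseBracket t := zero_lt_one.trans_le (one_le_japaneseBracket t)
  by_cases hk : normL2xHv 2 h < ⊤
  swap
  · have hZ : normZ' t h = ⊤ := by
      rw [not_lt, top_le_iff] at hk
      rw [normZ', hk, top_add, ENNReal.mul_top, add_top]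
      exact (ENNReal.ofReal_pos.2 (Real.rpow_pos_of_pos hj _)).ne'
    rw [hZ, ENNReal.top_pow two_ne_zero, ENNReal.mul_top]
    · exact le_top
    · refine mul_ne_zero ?_ ?_
      · rw [ENNReal.coe_ne_zero]
        positivity
      · exact (ENNReal.ofReal_pos.2 (Real.rpow_pos_of_pos hj _)).ne'
  obtain ⟨H, hH, h0, hn⟩ := exists_sliceFamily hk
  set Z := normZ h with hZ
  set n := normL2xHv 2 h
  set X := eLpNorm (fun p : Plane × Plane => ‖p.1‖ * h p) 2 volume
  set a := ENNReal.ofReal (japaneseBracket t ^ (-(1 / 4) : ℝ))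
  have hZv : ∀ᵐ x : Plane, ∫⁻ y, ‖H 0 (y, t⁻¹ • x)‖ₑ ^ 2 ≤ Z ^ 2 := by
    simpa using (quasiMeasurePreserving_smul_sub (inv_ne_zero ht0) 0).ae
      (ae_lintegral_sq_le_normZ_sq h0)
  have hnX : (∫⁻ p : Plane × Plane, (‖p.1‖ₑ * ‖H 0 p‖ₑ) ^ 2) ^ (1 / 4 : ℝ) *
      (∫⁻ y, sobSq 2 (fun β v => H β (y, v))) ^ (3 / 4 : ℝ) ≤
        c ^ (3 / 4 : ℝ) * (n + X) ^ 2 := by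
    rw [lintegral_fst_mul_sq h0]
    calc (X ^ 2) ^ (1 / 4 : ℝ) * (∫⁻ y, sobSq 2 (fun β v => H β (y, v))) ^ (3 / 4 : ℝ)
        ≤ ((n + X) ^ 2) ^ (1 / 4 : ℝ) * (c * (n + X) ^ 2) ^ (3 / 4 : ℝ) := by
          gcongr
          · exact le_add_self
          · refine hn.trans ?_
            rw [hc, ENNReal.coe_natCast]
            gcongr
            exact le_self_add
      _ = c ^ (3 / 4 : ℝ) * (((n + X) ^ 2) ^ (1 / 4 : ℝ) * ((n + X) ^ 2) ^ (3 / 4 : ℝ)) := by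
          rw [ENNReal.mul_rpow_of_nonneg _ _ (by norm_num)]
          ring
      _ = _ := by
          rw [← ENNReal.rpow_add_of_nonneg _ _ (by norm_num) (by norm_num)]
          norm_num
  -- Since 5/2 = 2 + 2 · 1/4, the gain |t|^{-1/2} in the error term supplies exactly the squared
  -- weight of the Z' norm.
  have hsplit : ENNReal.ofReal (japaneseBracket t ^ (-(5 / 2) : ℝ)) =
      ENNReal.ofReal (japaneseBracket t ^ (-2 : ℝ)) * a ^ 2 := by
    rw [← ENNReal.ofReal_pow (by positivity), ← ENNReal.ofReal_mul (by positivity),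
      ← Real.rpow_natCast, ← Real.rpow_mul hj.le, ← Real.rpow_add hj]
    norm_num
  have ht52 : ENNReal.ofReal (|t| ^ (-2 : ℝ)) * ENNReal.ofReal (|t| ^ (-(1 / 2) : ℝ)) =
      ENNReal.ofReal (|t| ^ (-(5 / 2) : ℝ)) := by
    rw [← ENNReal.ofReal_mul (by positivity), ← Real.rpow_add htpos]
    norm_num
  refine (eLpNorm_exponent_top (μ := volume)).le.trans (essSup_le_of_ae_le _ ?_)
  filter_upwards [density_ae_eq_transport h0 t, hC t ht0 H hH, hZv] with x hx hx1 hx2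
  rw [hx]
  calc ‖transport t (fun p => H 0 p ^ 2) x‖ₑ
      ≤ ENNReal.ofReal (|t| ^ (-2 : ℝ)) * (Z ^ 2 + C * ENNReal.ofReal (|t| ^ (-(1 / 2) : ℝ)) *
          (c ^ (3 / 4 : ℝ) * (n + X) ^ 2)) := by
        refine (enorm_transport_sq_le ht0 (hH.measurable 0).measurable x).trans ?_
        gcongr
        exact hx1.trans (by gcongr)
    _ = ENNReal.ofReal (|t| ^ (-2 : ℝ)) * Z ^ 2 +
          ENNReal.ofReal (|t| ^ (-(5 / 2) : ℝ)) * (C * c ^ (3 / 4 : ℝ)) * (n + X) ^ 2 := by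
        rw [← ht52]; ring
    _ ≤ D * ENNReal.ofReal (japaneseBracket t ^ (-2 : ℝ)) * Z ^ 2 +
          D' * ENNReal.ofReal (japaneseBracket t ^ (-(5 / 2) : ℝ)) * (C * c ^ (3 / 4 : ℝ)) *
            (n + X) ^ 2 := by
        gcongr ?_ * _ + ?_ * _ * _
        · exact hD t ht
        · exact hD' t ht
    _ = ENNReal.ofReal (japaneseBracket t ^ (-2 : ℝ)) *
          (D * Z ^ 2 + D' * C * c ^ (3 / 4 : ℝ) * (a * (n + X)) ^ 2) := by
        rw [hsplit]; ring
    _ ≤ ENNReal.ofReal (japaneseBracket t ^ (-2 : ℝ)) *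
          (D * (Z + a * (n + X)) ^ 2 + D' * C * c ^ (3 / 4 : ℝ) * (Z + a * (n + X)) ^ 2) := by
        gcongr
        · exact le_self_add
        · exact le_add_self
    _ = (D + D' * C * c ^ (3 / 4 : ℝ)) * ENNReal.ofReal (japaneseBracket t ^ (-2 : ℝ)) *
          normZ' t h ^ 2 := by
        rw [normZ']; ring
    _ ≤ _ := by
        push_cast
        rw [ENNReal.coe_rpow_of_nonneg _ (by norm_num)]
        gcongr
        exact le_add_self

end

end ScreenedVP

theorem mainTheorem3 (τ : ℝ) (hτ : 0 < τ) :
    (∃ C : ℝ≥0, ∀ (t : ℝ), τ ≤ |t| → ∀ h : ScreenedVP.Plane × ScreenedVP.Plane → ℝ,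
      eLpNorm (ScreenedVP.density h t) ⊤ volume ≤
        C * ENNReal.ofReal (ScreenedVP.japaneseBracket t ^ (-2 : ℝ)) *
          ScreenedVP.normZ' t h ^ 2) ∧
    (∀ δ : ℝ, 0 < δ → δ < 1 → ∀ α : Fin 2 → ℕ,
      ∃ C : ℝ≥0, ∀ (t : ℝ), τ ≤ |t| → ∀ h : ScreenedVP.Plane × ScreenedVP.Plane → ℝ,
        ScreenedVP.normL2xHv (ScreenedVP.multiLength α + 1) h < ⊤ →
        ∃ F : ScreenedVP.Plane → ScreenedVP.Plane,
          ScreenedVP.IsWeakDerivGrad α (ScreenedVP.potential h t) F ∧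
          eLpNorm F ⊤ volume ≤
            C * ENNReal.ofReal (ScreenedVP.japaneseBracket t ^
                (-2 - (ScreenedVP.multiLength α : ℝ) + δ)) *
              ScreenedVP.normL2xHv (ScreenedVP.multiLength α + 1) h ^ 2) ∧
    (∀ δ : ℝ, 0 < δ → δ < 1 → ∀ α : Fin 2 → ℕ,
      ∃ C : ℝ≥0, ∀ (t : ℝ), τ ≤ |t| → ∀ h : ScreenedVP.Plane × ScreenedVP.Plane → ℝ,
        ScreenedVP.normL2xHv (ScreenedVP.multiLength α + 2) h < ⊤ →
        ∃ F : ScreenedVP.Plane → ScreenedVP.Plane,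
          ScreenedVP.IsWeakDerivGrad α (ScreenedVP.potential h t) F ∧
          eLpNorm F ⊤ volume ≤
            C * ENNReal.ofReal (ScreenedVP.japaneseBracket t ^
                (-3 - (ScreenedVP.multiLength α : ℝ) + δ)) *
              ScreenedVP.normL2xHv (ScreenedVP.multiLength α + 2) h ^ 2) ∧
    (∀ α : Fin 2 → ℕ, 2 ≤ ScreenedVP.multiLength α →
      ∃ C : ℝ≥0, ∀ (t : ℝ), τ ≤ |t| → ∀ h : ScreenedVP.Plane × ScreenedVP.Plane → ℝ,
        ScreenedVP.normL2xHv (ScreenedVP.multiLength α) h < ⊤ →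
        ∃ F : ScreenedVP.Plane → ScreenedVP.Plane,
          ScreenedVP.IsWeakDerivGrad α (ScreenedVP.potential h t) F ∧
          eLpNorm F 2 volume ≤
            C * ENNReal.ofReal (ScreenedVP.japaneseBracket t ^
                (-(1 / 2) - (ScreenedVP.multiLength α : ℝ))) *
              ScreenedVP.normL2xHv (ScreenedVP.multiLength α) h ^ 2) := by
  exact ⟨ScreenedVP.exists_eLpNorm_density_le hτ,
    fun δ hδ _ α => ScreenedVP.exists_gradient_bound_top hτ hδ α,
    fun δ hδ _ α => ScreenedVP.exists_gradient_bound_top' hτ hδ α,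
    fun α hα => ScreenedVP.exists_gradient_bound_two hτ hα⟩
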